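/- Let $F$ be a field of characteristic $0$ and let $M\subseteq F$ be an additive subgroup of finite rank. Let $\mathrm{Vir}[M]$ be the Lie algebra over $F$ with basis $\{L_\mu, c \mid \mu\in M\}$ and brackets $$[L_\mu,L_\nu]=(\nu-\mu)L_{\mu+\nu}+\tfrac1{12}(\mu^3-\mu)\,\delta_{\mu+\nu,0}\,c,\qquad [c,L_\mu]=0,$$ graded by $M$ with $L_\mu$ in degree $\mu$ and $c$ in degree $0$. For $\alpha,\beta\in F$ let $A_{\alpha,\beta}(M)$, $A_\alpha(M)$, $B_\alpha(M)$ be the $\mathrm{Vir}[M]$-modules with basis $\{v_\nu\mid\nu\in M\}$, on which $c$ acts by $0$ and, for all $\mu,\nu\in M$, - $A_{\alpha,\beta}(M)$: $L_\mu v_\nu=(\alpha+\nu+\mu\beta)v_{\mu+\nu}$; - $A_\alpha(M)$: $L_\mu v_\nu=(\nu+\mu)v_{\mu+\nu}$ if $\nu\neq0$, and $L_\mu v_0=\mu(\mu+\alpha)v_\mu$; - $B_\alpha(M)$: $L_\mu v_\nu=\nu\, v_{\mu+\nu}$ if $\nu\ne-\mu$, and $L_\mu v_{-\mu}=-\mu(\mu+\alpha)v_0$.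 Let $A'_{\alpha,\beta}(M)$ be the nontrivial irreducible subquotient of $A_{\alpha,\beta}(M)$: it is $A_{\alpha,\beta}(M)$ itself unless $\alpha\in M$ and $\beta\in\{0,1\}$; for $\alpha\in M$ it is the quotient $A_{\alpha,0}(M)/Fv_{-\alpha}$ if $\beta=0$, and the submodule of $A_{\alpha,1}(M)$ spanned by the $v_\nu$ with $\nu\neq-\alpha$ if $\beta=1$. Let $Fv_0$ be the one-dimensional trivial module. **Theorem 4.5.** Let $V=\bigoplus_{j\in M}V_j$ be an $M$-graded $\mathrm{Vir}[M]$-module with $\dim V>1$ and $\dim V_j\le1$ for all $j\in M$. Suppose that there is $a\in F$ such that $L_0$ acts on $V_j$ as the scalar $a+j$ for all $j\in M$. Then $V$ is isomorphic, as a $\mathrm{Vir}[M]$-module, to one of the following, for appropriate $\alpha,\beta\in F$: (i) $A'_{\alpha,\beta}(M)$; (ii) the direct sum of modules $A'_{0,0}(M)\oplus Fv_0$; (iii) $A_\alpha(M)$; (iv) $B_\alpha(M)$; (v) $A_{0,0}(M)$ or $A_{0,1}(M)$. -/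

import Mathlib

namespace GenVir

noncomputable section

open Finsupp in
/-- The bilinear map `(e_μ, e_ν) ↦ φ μ ν • e_{μ+ν}` on the space with basis `{e_μ | μ ∈ M}`. -/
def bilin {F : Type*} [Field F] {M : AddSubgroup F} (φ : M → M → F) :
    (M →₀ F) →ₗ[F] (M →₀ F) →ₗ[F] (M →₀ F) :=
  linearCombination F fun μ => linearCombination F fun ν => single (μ + ν) (φ μ ν)

theorem bilin_single {F : Type*} [Field F] {M : AddSubgroup F} (φ : M → M → F) (μ ν : M)
    (s t : F) : bilin φ (Finsupp.single μ s) (Finsupp.single ν t)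
      = Finsupp.single (μ + ν) (s * t * φ μ ν) := by
  simp only [bilin, Finsupp.linearCombination_single, LinearMap.smul_apply, Finsupp.smul_single,
    smul_eq_mul, mul_assoc]

/-- The structure constants `ν - μ` of the centreless algebra. -/
def wittCoeff {F : Type*} [Field F] (M : AddSubgroup F) (μ ν : M) : F := (ν : F) - (μ : F)

/-- If the coefficients `φ` satisfy the commutation relation of the operators
`L_μ v_ν = φ μ ν • v_{μ+ν}`, then so does the bilinear extension. -/
theorem bilin_leibniz {F : Type*} [Field F] {M : AddSubgroup F} (φ : M → M → F)
    (hφ : ∀ μ ν k : M, φ μ (ν + k) * φ ν k - φ ν (μ + k) * φ μ k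
      = ((ν : F) - (μ : F)) * φ (μ + ν) k) (f g m : M →₀ F) :
    bilin φ f (bilin φ g m)
      = bilin φ (bilin (wittCoeff M) f g) m + bilin φ g (bilin φ f m) := by
  induction f using Finsupp.induction_linear with
  | zero => simp
  | add f₁ f₂ h₁ h₂ => simp only [map_add, LinearMap.add_apply, h₁, h₂]; abel
  | single μ r =>
    induction g using Finsupp.induction_linear with
    | zero => simp
    | add g₁ g₂ h₁ h₂ => simp only [map_add, LinearMap.add_apply, h₁, h₂]; abel
    | single ν s =>
      induction m using Finsupp.induction_linear with
      | zero => simp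
      | add m₁ m₂ h₁ h₂ => simp only [map_add, h₁, h₂]; abel
      | single k t =>
        simp only [bilin_single, wittCoeff]
        rw [show ν + (μ + k) = μ + (ν + k) by abel, show μ + ν + k = μ + (ν + k) by abel,
          ← Finsupp.single_add]
        congr 1
        linear_combination (r * s * t) * hφ μ ν k

open scoped Classical in
/-- The 2-cocycle `(e_μ, e_ν) ↦ δ_{μ+ν,0} (μ³ - μ) / 12`. -/
def cocycle {F : Type*} [Field F] (M : AddSubgroup F) : (M →₀ F) →ₗ[F] (M →₀ F) →ₗ[F] F :=
  Finsupp.linearCombination F fun μ => Finsupp.linearCombination F fun ν =>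
    if μ + ν = 0 then ((μ : F) ^ 3 - (μ : F)) / 12 else 0

open scoped Classical in
theorem cocycle_single {F : Type*} [Field F] (M : AddSubgroup F) (μ ν : M) (s t : F) :
    cocycle M (Finsupp.single μ s) (Finsupp.single ν t)
      = s * t * (if μ + ν = 0 then ((μ : F) ^ 3 - (μ : F)) / 12 else 0) := by
  simp [cocycle, Finsupp.linearCombination_single, mul_assoc]

/-- The space underlying the generalized Virasoro algebra `Vir[M]`: the pair `(f, s)` stands for
`∑ f(μ) L_μ + s c`. -/
def Vir {F : Type*} [Field F] (M : AddSubgroup F) : Type _ := (M →₀ F) × F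

namespace Vir

instance {F : Type*} [Field F] (M : AddSubgroup F) : AddCommGroup (Vir M) :=
  inferInstanceAs (AddCommGroup ((M →₀ F) × F))

instance {F : Type*} [Field F] (M : AddSubgroup F) : Module F (Vir M) :=
  inferInstanceAs (Module F ((M →₀ F) × F))

/-- The basis element `L_μ`. -/
def L {F : Type*} [Field F] {M : AddSubgroup F} (μ : M) : Vir M := (Finsupp.single μ 1, 0)

/-- The central basis element `c`. -/
def c {F : Type*} [Field F] (M : AddSubgroup F) : Vir M := (0, 1)

instance {F : Type*} [Field F] (M : AddSubgroup F) : Bracket (Vir M) (Vir M) :=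
  ⟨fun x y => (bilin (wittCoeff M) x.1 y.1, cocycle M x.1 y.1)⟩

theorem bracket_def {F : Type*} [Field F] {M : AddSubgroup F} (x y : Vir M) :
    ⁅x, y⁆ = ((bilin (wittCoeff M) x.1 y.1, cocycle M x.1 y.1) : (M →₀ F) × F) := rfl

theorem bilin_witt_skew {F : Type*} [Field F] {M : AddSubgroup F} (f g : M →₀ F) :
    bilin (wittCoeff M) f g + bilin (wittCoeff M) g f = 0 := by
  induction f using Finsupp.induction_linear with
  | zero => simp
  | add f₁ f₂ h₁ h₂ =>
    simp only [map_add, LinearMap.add_apply]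
    rw [add_add_add_comm, h₁, h₂, add_zero]
  | single μ r =>
    induction g using Finsupp.induction_linear with
    | zero => simp
    | add g₁ g₂ h₁ h₂ =>
      simp only [map_add, LinearMap.add_apply]
      rw [add_add_add_comm, h₁, h₂, add_zero]
    | single ν s =>
      simp only [bilin_single, wittCoeff]
      rw [add_comm ν μ, ← Finsupp.single_add, Finsupp.single_eq_zero]
      ring

theorem cocycle_skew {F : Type*} [Field F] {M : AddSubgroup F} (f g : M →₀ F) :
    cocycle M f g + cocycle M g f = 0 := by
  induction f using Finsupp.induction_linear with
  | zero => simp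
  | add f₁ f₂ h₁ h₂ =>
    simp only [map_add, LinearMap.add_apply]
    rw [add_add_add_comm, h₁, h₂, add_zero]
  | single μ r =>
    induction g using Finsupp.induction_linear with
    | zero => simp
    | add g₁ g₂ h₁ h₂ =>
      simp only [map_add, LinearMap.add_apply]
      rw [add_add_add_comm, h₁, h₂, add_zero]
    | single ν s =>
      rw [cocycle_single, cocycle_single, add_comm ν μ]
      split_ifs with h
      · have : (ν : F) = -(μ : F) := by
          have := congrArg (Subtype.val) h
          simp only [AddSubgroup.coe_add, ZeroMemClass.coe_zero] at this
          linear_combination this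
        rw [this]; ring
      · simp

theorem cocycle_jacobi {F : Type*} [Field F] {M : AddSubgroup F} (f g m : M →₀ F) :
    cocycle M f (bilin (wittCoeff M) g m)
      = cocycle M (bilin (wittCoeff M) f g) m + cocycle M g (bilin (wittCoeff M) f m) := by
  induction f using Finsupp.induction_linear with
  | zero => simp
  | add f₁ f₂ h₁ h₂ => simp only [map_add, LinearMap.add_apply, h₁, h₂]; abel
  | single μ r =>
    induction g using Finsupp.induction_linear with
    | zero => simp
    | add g₁ g₂ h₁ h₂ => simp only [map_add, LinearMap.add_apply, h₁, h₂]; abel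
    | single ν s =>
      induction m using Finsupp.induction_linear with
      | zero => simp
      | add m₁ m₂ h₁ h₂ => simp only [map_add, h₁, h₂]; abel
      | single k t =>
        simp only [bilin_single, cocycle_single, wittCoeff]
        rw [show ν + (μ + k) = μ + (ν + k) by abel, show μ + ν + k = μ + (ν + k) by abel]
        split_ifs with h
        · have : (k : F) = -(μ : F) - (ν : F) := by
            have := congrArg (Subtype.val) h
            simp only [AddSubgroup.coe_add, ZeroMemClass.coe_zero] at this
            linear_combination this
          rw [this, AddSubgroup.coe_add]; ring
        · simp

/-- Skew-symmetry holds with `⁅x, x⁆ = 0` because the characteristic is not two. -/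
instance {F : Type*} [Field F] [CharZero F] (M : AddSubgroup F) : LieRing (Vir M) where
  add_lie x y z := Prod.ext
    (by change bilin _ (x.1 + y.1) _ = bilin _ _ _ + bilin _ _ _; simp)
    (by change cocycle _ (x.1 + y.1) _ = cocycle _ _ _ + cocycle _ _ _; simp)
  lie_add x y z := Prod.ext
    (by change bilin _ _ (y.1 + z.1) = bilin _ _ _ + bilin _ _ _; simp)
    (by change cocycle _ _ (y.1 + z.1) = cocycle _ _ _ + cocycle _ _ _; simp)
  lie_self x := Prod.ext
    (self_eq_neg.mp (eq_neg_of_add_eq_zero_left (bilin_witt_skew x.1 x.1)))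
    (self_eq_neg.mp (eq_neg_of_add_eq_zero_left (cocycle_skew x.1 x.1)))
  leibniz_lie x y z := Prod.ext
    (bilin_leibniz (wittCoeff M) (fun μ ν k => by simp only [wittCoeff, AddSubgroup.coe_add]; ring)
      x.1 y.1 z.1)
    (cocycle_jacobi x.1 y.1 z.1)

instance {F : Type*} [Field F] [CharZero F] (M : AddSubgroup F) : LieAlgebra F (Vir M) where
  lie_smul r x y := Prod.ext
    (by change bilin _ _ (r • y.1) = r • bilin _ _ _; simp)
    (by change cocycle _ _ (r • y.1) = r • cocycle _ _ _; simp)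

open scoped Classical in
/-- `[L_μ, L_ν] = (ν - μ) L_{μ+ν} + δ_{μ+ν,0} (μ³ - μ)/12 c`. -/
theorem L_bracket_L {F : Type*} [Field F] [CharZero F] {M : AddSubgroup F} (μ ν : M) :
    ⁅L μ, L ν⁆ = ((ν : F) - (μ : F)) • L (μ + ν)
      + (if μ + ν = 0 then ((μ : F) ^ 3 - (μ : F)) / 12 else 0) • c M := by
  refine Prod.ext ?_ ?_
  · change bilin _ (Finsupp.single μ 1) (Finsupp.single ν 1)
      = _ • Finsupp.single (μ + ν) (1 : F) + _ • (0 : M →₀ F)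
    simp [bilin_single, wittCoeff]
  · change cocycle _ (Finsupp.single μ 1) (Finsupp.single ν 1) = _ • (0 : F) + _ • (1 : F)
    simp [cocycle_single]

theorem c_bracket {F : Type*} [Field F] [CharZero F] {M : AddSubgroup F} (x : Vir M) :
    ⁅c M, x⁆ = 0 := by
  refine Prod.ext ?_ ?_
  · change bilin _ (0 : M →₀ F) _ = 0
    simp
  · change cocycle _ (0 : M →₀ F) _ = 0
    simp

open scoped Classical in
/-- The homogeneous component `Vir[M]_μ`: it is `F L_μ` for `μ ≠ 0` and `F L_0 ⊕ F c` for
`μ = 0`. -/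
def homogeneous {F : Type*} [Field F] {M : AddSubgroup F} (μ : M) : Submodule F (Vir M) :=
  if μ = 0 then Submodule.span F {L 0, c M} else Submodule.span F {L μ}

end Vir

open scoped Classical in
/-- An `M`-grading of a `Vir[M]`-module `V`: a direct sum decomposition `V = ⨁_{j ∈ M} V_j` with
`Vir[M]_μ V_j ⊆ V_{μ+j}`. -/
structure IsGrading {F : Type*} [Field F] [CharZero F] {M : AddSubgroup F} {V : Type*}
    [AddCommGroup V] [Module F V] [LieRingModule (Vir M) V] [LieModule F (Vir M) V]
    (Vj : M → Submodule F V) : Prop where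
  isInternal : DirectSum.IsInternal Vj
  lie_mem : ∀ (μ j : M), ∀ x ∈ Vir.homogeneous μ, ∀ v ∈ Vj j, ⁅x, v⁆ ∈ Vj (μ + j)

/-- Coefficients `φ μ ν` for which `L_μ v_ν = φ μ ν • v_{μ+ν}`, `c v_ν = 0` respects the defining
relations of `Vir[M]`. -/
structure Coeff {F : Type*} [Field F] (M : AddSubgroup F) where
  φ : M → M → F
  rel : ∀ μ ν k : M, φ μ (ν + k) * φ ν k - φ ν (μ + k) * φ μ k
      = ((ν : F) - (μ : F)) * φ (μ + ν) k

/-- The space with basis `{v_μ | μ ∈ M}` on which `Vir[M]` acts by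
`L_μ v_ν = φ μ ν • v_{μ+ν}` and `c v_ν = 0`. -/
def CoeffModule {F : Type*} [Field F] {M : AddSubgroup F} (_φ : Coeff M) : Type _ := M →₀ F

namespace CoeffModule

instance {F : Type*} [Field F] {M : AddSubgroup F} (φ : Coeff M) :
    AddCommGroup (CoeffModule φ) := inferInstanceAs (AddCommGroup (M →₀ F))

instance {F : Type*} [Field F] {M : AddSubgroup F} (φ : Coeff M) :
    Module F (CoeffModule φ) := inferInstanceAs (Module F (M →₀ F))

/-- The basis vector `v_ν`. -/
def v {F : Type*} [Field F] {M : AddSubgroup F} (φ : Coeff M) (ν : M) : CoeffModule φ :=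
  Finsupp.single ν (1 : F)

/-- The action of `∑ f(μ) L_μ`. -/
def act {F : Type*} [Field F] {M : AddSubgroup F} (φ : Coeff M) :
    (M →₀ F) →ₗ[F] CoeffModule φ →ₗ[F] CoeffModule φ :=
  bilin φ.φ

theorem act_single {F : Type*} [Field F] {M : AddSubgroup F} (φ : Coeff M) (μ ν : M) (r : F) :
    act φ (Finsupp.single μ r) (v φ ν) = (r * φ.φ μ ν) • v φ (μ + ν) := by
  have h := bilin_single φ.φ μ ν r 1
  rw [mul_one, ← mul_one (r * φ.φ μ ν), ← smul_eq_mul (r * φ.φ μ ν) 1,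
    ← Finsupp.smul_single] at h
  exact h

/-- `(f, s) = ∑ f(μ) L_μ + s c` acts by `f` alone: the central element acts by zero. -/
instance {F : Type*} [Field F] [CharZero F] {M : AddSubgroup F} (φ : Coeff M) :
    LieRingModule (Vir M) (CoeffModule φ) where
  bracket x m := act φ x.1 m
  add_lie x y m := LinearMap.congr_fun (map_add (act φ) x.1 y.1) m
  lie_add x m n := map_add (act φ x.1) m n
  leibniz_lie x y m := bilin_leibniz φ.φ φ.rel x.1 y.1 m

instance {F : Type*} [Field F] [CharZero F] {M : AddSubgroup F} (φ : Coeff M) :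
    LieModule F (Vir M) (CoeffModule φ) where
  smul_lie r x m := LinearMap.congr_fun (map_smul (act φ) r x.1) m
  lie_smul r x m := map_smul (act φ x.1) r m

theorem L_lie_v {F : Type*} [Field F] [CharZero F] {M : AddSubgroup F} (φ : Coeff M) (μ ν : M) :
    ⁅(Vir.L μ : Vir M), v φ ν⁆ = φ.φ μ ν • v φ (μ + ν) := by
  have h := act_single φ μ ν 1
  rw [one_mul] at h
  exact h

theorem c_lie {F : Type*} [Field F] [CharZero F] {M : AddSubgroup F} (φ : Coeff M)
    (m : CoeffModule φ) : ⁅Vir.c M, m⁆ = 0 :=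
  LinearMap.congr_fun (map_zero (act φ)) m

/-- The submodule spanned by the `v_ν` with `ν ∈ S`, for `S` stable under the action. -/
def spanOn {F : Type*} [Field F] [CharZero F] {M : AddSubgroup F} (φ : Coeff M) (S : Set M)
    (hS : ∀ μ, ∀ ν ∈ S, φ.φ μ ν ≠ 0 → μ + ν ∈ S) :
    LieSubmodule F (Vir M) (CoeffModule φ) where
  toSubmodule := Submodule.span F (v φ '' S)
  lie_mem := by
    intro x m hm
    change act φ x.1 m ∈ Submodule.span F (v φ '' S)
    generalize x.1 = f
    change m ∈ Submodule.span F (v φ '' S) at hm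
    induction hm using Submodule.span_induction with
    | zero => rw [map_zero]; exact Submodule.zero_mem _
    | add m n _ _ h₁ h₂ => rw [map_add]; exact Submodule.add_mem _ h₁ h₂
    | smul r m _ h => rw [map_smul]; exact Submodule.smul_mem _ r h
    | mem m hm =>
      obtain ⟨ν, hν, rfl⟩ := hm
      induction f using Finsupp.induction_linear with
      | zero => rw [map_zero]; exact Submodule.zero_mem _
      | add f g h₁ h₂ => rw [map_add]; exact Submodule.add_mem _ h₁ h₂
      | single μ r =>
        rw [act_single]
        by_cases h : φ.φ μ ν = 0
        · rw [h, mul_zero, zero_smul]; exact Submodule.zero_mem _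
        · exact Submodule.smul_mem _ _ (Submodule.subset_span ⟨_, hS μ ν hν h, rfl⟩)

end CoeffModule

/-- Coefficients of `A_{a,b}(M)`: `L_μ v_ν = (a + ν + μ b) v_{μ+ν}`. -/
def coeffAab {F : Type*} [Field F] (M : AddSubgroup F) (a b : F) : Coeff M where
  φ μ ν := a + (ν : F) + (μ : F) * b
  rel μ ν k := by simp only [AddSubgroup.coe_add]; ring

open scoped Classical in
/-- Coefficients of `A_a(M)`: `L_μ v_ν = (ν + μ) v_{μ+ν}` for `ν ≠ 0`, and
`L_μ v_0 = μ (μ + a) v_μ`. -/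
def coeffAa {F : Type*} [Field F] (M : AddSubgroup F) (a : F) : Coeff M where
  φ μ ν := if ν = 0 then (μ : F) * ((μ : F) + a) else (ν : F) + (μ : F)
  rel μ ν k := by
    have hc : ∀ x y : M, x + y = 0 ↔ (x : F) + (y : F) = 0 := fun x y => by
      rw [← AddSubgroup.coe_add, ZeroMemClass.coe_eq_zero]
    have hz : ∀ x : M, x = 0 ↔ (x : F) = 0 := fun x => ZeroMemClass.coe_eq_zero.symm
    by_cases hk : k = 0
    · subst hk
      simp only [hz, AddSubgroup.coe_add, ZeroMemClass.coe_zero, add_zero, if_true]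
      split_ifs with h₁ h₂ h₂ <;> simp_all <;> ring
    · simp only [hk, hc, if_false, AddSubgroup.coe_add]
      split_ifs with h₁ h₂ h₂
      · have e₁ : (k : F) = -ν := by linear_combination h₁
        have e₂ : (μ : F) = ν := by linear_combination h₂ - h₁
        rw [e₁, e₂]; ring
      · have e₁ : (k : F) = -ν := by linear_combination h₁
        rw [e₁]; ring
      · have e₁ : (k : F) = -μ := by linear_combination h₂
        rw [e₁]; ring
      · ring

open scoped Classical in
/-- Coefficients of `B_a(M)`: `L_μ v_ν = ν v_{μ+ν}` for `ν ≠ -μ`, and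
`L_μ v_{-μ} = -μ (μ + a) v_0`. -/
def coeffBa {F : Type*} [Field F] (M : AddSubgroup F) (a : F) : Coeff M where
  φ μ ν := if ν = -μ then -(μ : F) * ((μ : F) + a) else (ν : F)
  rel μ ν k := by
    have hc : ∀ x y : M, x = -y ↔ (x : F) = -(y : F) := fun x y => by
      rw [← NegMemClass.coe_neg, Subtype.coe_inj]
    simp only [hc, AddSubgroup.coe_add]
    by_cases h₁ : (k : F) = -ν <;> by_cases h₂ : (k : F) = -μ
    · have e : (ν : F) = μ := by linear_combination h₁ - h₂
      simp [h₁, e]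
    · by_cases h₃ : (μ : F) = 0
      · have hn : (-(ν : F) = 0) ↔ False :=
          iff_false_intro fun h => h₂ (by rw [h₁, h, h₃, neg_zero])
        simp only [h₁, h₃, zero_add, add_neg_cancel, neg_zero, hn, if_true, if_false]
        ring
      · have h₄ : (-(ν : F) = -(μ + ν)) ↔ False :=
          iff_false_intro fun h => h₃ (by linear_combination h)
        have h₅ : ((μ : F) + -ν = -ν) ↔ False :=
          iff_false_intro fun h => h₃ (by linear_combination h)
        have h₆ : (-(ν : F) = -μ) ↔ False :=
          iff_false_intro fun h => h₂ (h₁.trans h)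
        have h₇ : ((0 : F) = -μ) ↔ False :=
          iff_false_intro fun h => h₃ (by linear_combination h)
        simp only [h₁, add_neg_cancel, h₄, h₅, h₆, h₇, if_false, if_true]
        ring
    · by_cases h₃ : (ν : F) = 0
      · have hn : (-(μ : F) = 0) ↔ False :=
          iff_false_intro fun h => h₁ (by rw [h₂, h, h₃, neg_zero])
        simp only [h₂, h₃, zero_add, add_zero, add_neg_cancel, neg_zero, hn, if_true, if_false]
        ring
      · have h₄ : (-(μ : F) = -(μ + ν)) ↔ False :=
          iff_false_intro fun h => h₃ (by linear_combination h)
        have h₅ : ((ν : F) + -μ = -μ) ↔ False :=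
          iff_false_intro fun h => h₃ (by linear_combination h)
        have h₆ : (-(μ : F) = -ν) ↔ False :=
          iff_false_intro fun h => h₁ (h₂.trans h)
        have h₇ : ((0 : F) = -ν) ↔ False :=
          iff_false_intro fun h => h₃ (by linear_combination h)
        simp only [h₂, add_neg_cancel, h₄, h₅, h₆, h₇, if_false, if_true]
        ring
    · by_cases h₃ : (k : F) = -(μ + ν)
      · have h₄ : (ν : F) + k = -μ := by linear_combination h₃
        have h₅ : (μ : F) + k = -ν := by linear_combination h₃
        rw [if_neg h₁, if_neg h₂, if_pos h₃, if_pos h₄, if_pos h₅, h₃]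
        ring
      · have h₄ : ¬ ((ν : F) + k = -μ) := fun h => h₃ (by linear_combination h)
        have h₅ : ¬ ((μ : F) + k = -ν) := fun h => h₃ (by linear_combination h)
        rw [if_neg h₁, if_neg h₂, if_neg h₃, if_neg h₄, if_neg h₅]
        ring

/-- The module `A_{a,b}(M)`. -/
abbrev Aab {F : Type*} [Field F] (M : AddSubgroup F) (a b : F) : Type _ :=
  CoeffModule (coeffAab M a b)

/-- The module `A_a(M)`. -/
abbrev Aa {F : Type*} [Field F] (M : AddSubgroup F) (a : F) : Type _ :=
  CoeffModule (coeffAa M a)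

/-- The module `B_a(M)`. -/
abbrev Ba {F : Type*} [Field F] (M : AddSubgroup F) (a : F) : Type _ :=
  CoeffModule (coeffBa M a)

/-- The submodule of `A_{a,b}(M)` obtained by omitting the vector of weight zero if `b = 1`;
it is everything if `b ≠ 1` or `a ∉ M`. -/
def AabTop {F : Type*} [Field F] [CharZero F] (M : AddSubgroup F) (a b : F) :
    LieSubmodule F (Vir M) (Aab M a b) :=
  CoeffModule.spanOn _ {ν | b = 1 → a + (ν : F) ≠ 0} (by
    rintro μ ν - h rfl h'
    apply h
    simp only [coeffAab]
    simp only [AddSubgroup.coe_add] at h'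
    linear_combination h')

/-- The submodule of `A_{a,b}(M)` spanned by the vector of weight zero if `b = 0`;
it is zero if `b ≠ 0` or `a ∉ M`. -/
def AabBot {F : Type*} [Field F] [CharZero F] (M : AddSubgroup F) (a b : F) :
    LieSubmodule F (Vir M) (Aab M a b) :=
  CoeffModule.spanOn _ {ν | b = 0 ∧ a + (ν : F) = 0} (by
    rintro μ ν ⟨rfl, h⟩ h'
    exact absurd (by simp [coeffAab, h]) h')

/-- The nontrivial irreducible subquotient `A'_{a,b}(M)` of `A_{a,b}(M)`. It is `A_{a,b}(M)` itself
unless `a ∈ M` and `b ∈ {0, 1}`; for `a ∈ M` it is `A_{a,0}(M) / F v_{-a}` if `b = 0`, and the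
submodule of `A_{a,1}(M)` spanned by the `v_ν` with `ν ≠ -a` if `b = 1`. -/
abbrev Aab' {F : Type*} [Field F] [CharZero F] (M : AddSubgroup F) (a b : F) : Type _ :=
  AabTop M a b ⧸ (AabBot M a b).comap (AabTop M a b).incl

/-- The direct sum `P ⊕ Q` of two `Vir[M]`-modules, with componentwise action. -/
instance prodLieRingModule {F : Type*} [Field F] [CharZero F] {M : AddSubgroup F} {P Q : Type*}
    [AddCommGroup P] [LieRingModule (Vir M) P] [AddCommGroup Q] [LieRingModule (Vir M) Q] :
    LieRingModule (Vir M) (P × Q) where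
  bracket x m := (⁅x, m.1⁆, ⁅x, m.2⁆)
  add_lie x y m := Prod.ext (add_lie x y m.1) (add_lie x y m.2)
  lie_add x m n := Prod.ext (lie_add x m.1 n.1) (lie_add x m.2 n.2)
  leibniz_lie x y m := Prod.ext (leibniz_lie x y m.1) (leibniz_lie x y m.2)

instance prodLieModule {F : Type*} [Field F] [CharZero F] {M : AddSubgroup F} {P Q : Type*}
    [AddCommGroup P] [Module F P] [LieRingModule (Vir M) P] [LieModule F (Vir M) P]
    [AddCommGroup Q] [Module F Q] [LieRingModule (Vir M) Q] [LieModule F (Vir M) Q] :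
    LieModule F (Vir M) (P × Q) where
  smul_lie r x m := Prod.ext (smul_lie r x m.1) (smul_lie r x m.2)
  lie_smul r x m := Prod.ext (lie_smul r x m.1) (lie_smul r x m.2)

/-- The one-dimensional trivial `Vir[M]`-module `F v_0`. -/
abbrev Fv0 {F : Type*} [Field F] (M : AddSubgroup F) : Type _ := TrivialLieModule F (Vir M) F

end

end GenVir

/-!
# Weight modules with multiplicity one over generalized Virasoro algebras

Choose a spanning vector `w u` of each weight space and write the action as `L_{v - u} w_u = e u v
• w_v`. The module is then a matrix of scalars `e u v` indexed by pairs of points of the group,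
the bracket relations are identities along parallelograms, and rescaling the `w u` changes `e` by
a coboundary. What is invariant are the products of `e` around closed paths, and the proof
determines these: first the loops `e u v * e v u`, then the triangles `e u v * e v w * e w u`.
Throughout, `X u` is the weight (the eigenvalue of `L_0`) at `u`.

*Charge and support.* On a line `k + ℤ h` the commutation relation at a loop is a recursion for
the loops. It makes the finite runs of the support symmetric about one centre, so that a point of
nonzero weight, or of nonzero charge, forces a half-line into the support. Along a half-line, the
product of a triangle and its reverse is the product of three loops; this is a polynomial
identity, whose leading terms give `c = 0` (`PartialSystem.charge_eq_zero`). The same identities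
show that only a vector of weight zero can be missing (`PartialSystem.mem_of_weight_ne_zero`).

*Loops.* On a line the same product formula gives, by induction on the distance, `e u v * e v u =
X u * X v + B * (X v - X u) ^ 2` (`System.exists_pairing`), and then the normal form of all
coefficients on the line. It remains to see that `B` does not depend on the line. A double
commutator at a base point `x` (`System.double_commutator`) expresses loops off a line through
paths along lines, and shows that the second differences of `loopForm x γ = e x (x + γ) * e (x +
γ) x - X x * X (x + γ)` in `γ` are quadratic; since `loopForm` is homogeneous, it is a quadratic
form. Comparing a triangle with its three neighbours, as polynomial identities evaluated at the
positions where a neighbour coincides with the triangle, leaves only multiples of the square of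
the weight (`System.loopForm_eq_of_ne_zero`). Hence `B` is a constant
(`System.exists_pairing_eq`).

*Triangles.* For each triangle there are two possible values (`System.triangle_dichotomy`), which
correspond to the two roots of `β * (1 - β) = B`. Two triangles with a common edge, in general
position, belong to the same root, because otherwise translation along that edge would give an
impossible polynomial identity (`System.triangle_propagate`). So `e` and the coefficients `(1 - β)
* X u + β * X v` of a tensor density module have the same triangles, and are equal up to rescaling
wherever the loops do not vanish identically (`System.exists_rescaling`). If `B = 0`, there may be
one exceptional vector, of weight zero; the coefficients into and out of it satisfy a functional
equation with affine solutions (`System.exists_rescaling_of_weight_eq_zero`), which are the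
parameters of `A_α` and `B_α` and of the degenerate cases.
-/

/-! ### Coefficients of weight modules -/

namespace GenVir

/-- The value of `e u v * e v u` in a tensor density module, in terms of the weights `x`, `y` of `u`
and `v`; the parameter is `B = β (1 - β)`. -/
def pairing {F : Type*} [Field F] (B x y : F) : F := x * y + B * (y - x) ^ 2

/-- The part of the triangle value `e u v * e v w * e w u` of a tensor density module that is
unchanged under `β ↦ 1 - β`, in terms of the weights of `u`, `v`, `w`. -/
def meanTriangle {F : Type*} [Field F] (B x y z : F) : F :=
  (1 - 3 * B) * (x * y * z)
    + B / 2 * (x ^ 2 * y + x ^ 2 * z + y ^ 2 * x + y ^ 2 * z + z ^ 2 * x + z ^ 2 * y)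

/-- An affine function on a line. -/
theorem affine_zsmul {F G : Type*} [Field F] [AddCommGroup G] {X : G → F}
    (hX : ∀ u v v' w : G, v + v' = u + w → X v + X v' = X u + X w) (k h : G) (n : ℤ) :
    X (k + n • h) = X k + n * (X (k + h) - X k) := by
  induction n using Int.induction_on with
  | zero => simp
  | succ i hi =>
    have := hX k (k + (i : ℤ) • h) (k + h) (k + ((i : ℤ) + 1) • h)
      (by rw [add_smul, one_smul]; abel)
    push_cast at hi ⊢
    linear_combination -this + hi
  | pred i hi =>
    have := hX k (k + (-(i : ℤ) - 1) • h) (k + h) (k + (-(i : ℤ)) • h)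
      (by rw [sub_smul, one_smul]; abel)
    push_cast at hi ⊢
    linear_combination this + hi

theorem zsmul_line_injective {F G : Type*} [Field F] [CharZero F] [AddCommGroup G] {X : G → F}
    (hX : ∀ u v v' w : G, v + v' = u + w → X v + X v' = X u + X w)
    (hi : Function.Injective X) (k : G) {h : G} (hh : h ≠ 0) :
    Function.Injective fun n : ℤ => k + n • h := by
  intro m n hmn
  have h2 : X (k + h) - X k ≠ 0 := by
    rw [sub_ne_zero]
    exact fun h0 => hh (by simpa using hi h0)
  have h3 := congrArg X hmn
  simp only [affine_zsmul hX] at h3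
  exact_mod_cast mul_right_cancel₀ h2 (add_left_cancel h3)

theorem zsmul_line_add {G : Type*} [AddCommGroup G] (k h : G) {u v v' w : ℤ}
    (huv : v + v' = u + w) : k + v • h + (k + v' • h) = k + u • h + (k + w • h) := by
  rw [show k + v • h + (k + v' • h) = k + k + (v + v') • h by rw [add_smul]; abel, huv, add_smul]
  abel

/-- A weight module with weight multiplicities at most one, central charge `c` and weights in a
coset, in coordinates: `X u` is the weight at `u`, `S` is the set of `u` at which there is a nonzero
vector, and `e u v` is the coefficient of the operator of degree `v - u` from `u` to `v`. -/
structure PartialSystem {F G : Type*} [Field F] [AddCommGroup G] (X : G → F) (c : F) (S : Set G)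
    (e : G → G → F) : Prop where
  affine : ∀ u v v' w : G, v + v' = u + w → X v + X v' = X u + X w
  injective : Function.Injective X
  supp : ∀ u v, e u v ≠ 0 → u ∈ S ∧ v ∈ S
  diag : ∀ u ∈ S, e u u = X u
  comm : ∀ u v v' w : G, v + v' = u + w → u ≠ w →
    e u v * e v w - e u v' * e v' w = (X v - X v') * e u w
  loop : ∀ u ∈ S, ∀ v v' : G, v + v' = u + u →
    e u v * e v u - e u v' * e v' u = (X v - X v') * X u + ((X u - X v) ^ 3 - (X u - X v)) / 12 * c

namespace PartialSystem

variable {F G : Type*} [Field F] [AddCommGroup G] {X : G → F} {c : F} {S : Set G} {e : G → G → F}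

/-- The dual system: all edges are reversed. -/
theorem dual (H : PartialSystem X c S e) : PartialSystem X c S (fun u v => e v u) where
  affine := H.affine
  injective := H.injective
  supp u v h := (H.supp v u h).symm
  diag := H.diag
  comm u v v' w h hne := by
    have := H.comm w v v' u (by rw [h, add_comm]) hne.symm
    linear_combination this
  loop u hu v v' h := by
    have := H.loop u hu v v' h
    linear_combination this

/-- Restriction of a system to a line `{k + n • h | n ∈ ℤ}`. -/
theorem line [CharZero F] (H : PartialSystem X c S e) (k : G) {h : G} (hh : h ≠ 0) :
    PartialSystem (fun n : ℤ => X (k + n • h)) c {n | k + n • h ∈ S}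
      (fun m n => e (k + m • h) (k + n • h)) where
  affine _ _ _ _ huv := H.affine _ _ _ _ (zsmul_line_add k h huv)
  injective := H.injective.comp (zsmul_line_injective H.affine H.injective k hh)
  supp _ _ := H.supp _ _
  diag _ := H.diag _
  comm _ _ _ _ huv hne := H.comm _ _ _ _ (zsmul_line_add k h huv)
    ((zsmul_line_injective H.affine H.injective k hh).ne hne)
  loop _ hu _ _ huv := H.loop _ hu _ _ (zsmul_line_add k h huv)

end PartialSystem

/-- The function `n ↦ meanTriangle + W` has a constant defect `δ` in the product formula for a
triangle only if `δ = 0`. -/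
theorem defect_eq_zero {F : Type*} [Field F] [CharZero F] {x h D B W W' δ : F} (hh : h ≠ 0)
    (hD : D ≠ 0)
    (H : ∀ n : ℕ, (meanTriangle B (x + n * D * h) (x + n * D * h + h) (x + n * D * h + D * h) + W)
        * (meanTriangle B (x + n * D * h) (x + n * D * h + h) (x + n * D * h + D * h) + W')
      = pairing B (x + n * D * h) (x + n * D * h + h)
        * pairing B (x + n * D * h + h) (x + n * D * h + D * h)
        * (pairing B (x + n * D * h) (x + n * D * h + D * h) + δ)) : δ = 0 := by
  have h0 := H 0
  have h1 := H 1
  have h2 := H 2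
  have h3 := H 3
  have h4 := H 4
  simp only [meanTriangle, pairing] at h0 h1 h2 h3 h4
  push_cast at h0 h1 h2 h3 h4
  -- the fourth difference
  have key : 24 * (D * h) ^ 4 * δ = 0 := by
    linear_combination -(h4 - 4 * h3 + 6 * h2 - 4 * h1 + h0)
  have : (24 * (D * h) ^ 4 : F) ≠ 0 :=
    mul_ne_zero (by norm_num) (pow_ne_zero _ (mul_ne_zero hD hh))
  exact (mul_eq_zero.mp key).resolve_left this

namespace PartialSystem

variable {F : Type*} [Field F] {X : ℤ → F} {c : F} {S : Set ℤ} {e : ℤ → ℤ → F}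

theorem weight_eq (H : PartialSystem X c S e) (m n : ℤ) : X n = X m + (n - m) * (X 1 - X 0) := by
  have h1 := affine_zsmul H.affine 0 1 n
  have h2 := affine_zsmul H.affine 0 1 m
  simp only [smul_eq_mul, mul_one, zero_add] at h1 h2
  linear_combination h1 - h2

theorem step_ne_zero (H : PartialSystem X c S e) : X 1 - X 0 ≠ 0 := by
  rw [sub_ne_zero]
  exact fun h => one_ne_zero (H.injective h)

/-- Comparison of the triangles `j, j + 1, j + d + 1` before and after translation by `d + 1`. -/
theorem triangle_shift (H : PartialSystem X c S e) {d : ℤ} (hd : 0 < d) (j : ℤ) :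
    e (j + (d + 1)) (j + (d + 1) + 1) * e (j + (d + 1) + 1) (j + (d + 1) + (d + 1))
        * e (j + (d + 1) + (d + 1)) (j + (d + 1))
      - e j (j + 1) * e (j + 1) (j + (d + 1)) * e (j + (d + 1)) j
    = (X (j + (d + 1) + (d + 1)) - X (j + 1))
        * (e (j + (d + 1)) (j + (d + 1) + 1) * e (j + (d + 1) + 1) (j + (d + 1)))
      + (X (j + (d + 1) + 1) - X j)
        * (e (j + 1) (j + (d + 1)) * e (j + (d + 1)) (j + 1)) := by
  have h1 := H.comm (j + (d + 1) + 1) (j + (d + 1) + (d + 1)) (j + 1) (j + (d + 1))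
    (by ring) (by omega)
  have h2 := H.comm (j + (d + 1)) (j + (d + 1) + 1) j (j + 1) (by ring) (by omega)
  linear_combination e (j + (d + 1)) (j + (d + 1) + 1) * h1 + e (j + 1) (j + (d + 1)) * h2

/-- If the loops of lengths `1` and `d` have the expected values, then so do the triangles with
sides `1`, `d`, `d + 1`, up to a constant. -/
theorem triangle_eq [CharZero F] (H : PartialSystem X c S e) {k d : ℤ} (hd : 0 < d) {B : F}
    (h1 : ∀ m, k ≤ m → e m (m + 1) * e (m + 1) m = pairing B (X m) (X (m + 1)))
    (h2 : ∀ m, k ≤ m → e m (m + d) * e (m + d) m = pairing B (X m) (X (m + d)))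
    (m : ℤ) (hm : k ≤ m) : ∃ W : F, ∀ n : ℕ,
      e (m + n * (d + 1)) (m + n * (d + 1) + 1)
        * e (m + n * (d + 1) + 1) (m + n * (d + 1) + (d + 1))
        * e (m + n * (d + 1) + (d + 1)) (m + n * (d + 1))
      = meanTriangle B (X (m + n * (d + 1))) (X (m + n * (d + 1) + 1))
        (X (m + n * (d + 1) + (d + 1))) + W := by
  refine ⟨e m (m + 1) * e (m + 1) (m + (d + 1)) * e (m + (d + 1)) m
    - meanTriangle B (X m) (X (m + 1)) (X (m + (d + 1))), fun n => ?_⟩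
  induction n with
  | zero => simp
  | succ n ih =>
    obtain ⟨j, hj⟩ : ∃ j, j = m + n * (d + 1) := ⟨_, rfl⟩
    have hkj : k ≤ j := by
      rw [hj]
      have : (0 : ℤ) ≤ n * (d + 1) := by positivity
      omega
    have e1 : m + ((n + 1 : ℕ) : ℤ) * (d + 1) = j + (d + 1) := by rw [hj]; push_cast; ring
    rw [← hj] at ih
    rw [e1]
    have h3 := H.triangle_shift hd j
    rw [h1 _ (by omega), show j + (d + 1) = j + 1 + d by ring, h2 (j + 1) (by omega)] at h3
    rw [show j + (d + 1) = j + 1 + d by ring] at ih ⊢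
    rw [show j + 1 + d + (d + 1) = j + 1 + d + 1 + d by ring] at h3 ⊢
    have w1 := H.weight_eq j (j + 1)
    have w2 := H.weight_eq j (j + 1 + d)
    have w3 := H.weight_eq j (j + 1 + d + 1)
    have w4 := H.weight_eq j (j + 1 + d + 1 + d)
    push_cast at w1 w2 w3 w4
    rw [eq_add_of_sub_eq h3, ih, w1, w2, w3, w4]
    simp only [meanTriangle, pairing]
    ring

/-- Along a half-line in the support, the product formula for the triangles with sides `1`, `d`,
`d + 1` passes the shape of the loop values from lengths `1` and `d` to length `d + 1`. -/
theorem pairing_succ [CharZero F] (H : PartialSystem X 0 S e) {k d : ℤ} (hk : ∀ m, k ≤ m → m ∈ S)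
    (hd : 0 < d) {B : F} (h1 : ∀ m, k ≤ m → e m (m + 1) * e (m + 1) m = pairing B (X m) (X (m + 1)))
    (h2 : ∀ m, k ≤ m → e m (m + d) * e (m + d) m = pairing B (X m) (X (m + d)))
    (m : ℤ) (hm : k ≤ m) :
    e m (m + (d + 1)) * e (m + (d + 1)) m = pairing B (X m) (X (m + (d + 1))) := by
  obtain ⟨W, hW⟩ := H.triangle_eq hd h1 h2 m hm
  obtain ⟨W', hW'⟩ := H.dual.triangle_eq hd (B := B) (k := k)
    (fun m hm => by rw [mul_comm, h1 m hm]) (fun m hm => by rw [mul_comm, h2 m hm]) m hm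
  have hδ : ∀ n : ℕ, e (m + n * (d + 1)) (m + n * (d + 1) + (d + 1))
        * e (m + n * (d + 1) + (d + 1)) (m + n * (d + 1))
      = pairing B (X (m + n * (d + 1))) (X (m + n * (d + 1) + (d + 1)))
        + (e m (m + (d + 1)) * e (m + (d + 1)) m - pairing B (X m) (X (m + (d + 1)))) := by
    intro n
    induction n with
    | zero => simp
    | succ n ih =>
      obtain ⟨j, hj⟩ : ∃ j, j = m + n * (d + 1) := ⟨_, rfl⟩
      have hkj : k ≤ j := by
        rw [hj]
        have : (0 : ℤ) ≤ n * (d + 1) := by positivity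
        omega
      have e1 : m + ((n + 1 : ℕ) : ℤ) * (d + 1) = j + (d + 1) := by rw [hj]; push_cast; ring
      rw [← hj] at ih
      rw [e1]
      have h3 := H.loop (j + (d + 1)) (hk _ (by omega)) (j + (d + 1) + (d + 1)) j (by ring)
      have w2 := H.weight_eq j (j + (d + 1))
      have w4 := H.weight_eq j (j + (d + 1) + (d + 1))
      push_cast at w2 w4
      rw [eq_add_of_sub_eq h3, mul_comm (e (j + (d + 1)) j), ih, w2, w4]
      simp only [pairing]
      ring
  have := defect_eq_zero (x := X m) (h := X 1 - X 0) (D := d + 1) (B := B) (W := W) (W' := W')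
    (δ := e m (m + (d + 1)) * e (m + (d + 1)) m - pairing B (X m) (X (m + (d + 1))))
    H.step_ne_zero (by norm_cast; omega) (fun n => by
      have hn := congrArg₂ (· * ·) (hW n) (hW' n)
      have a1 := h1 (m + n * (d + 1)) (by
        have : (0 : ℤ) ≤ n * (d + 1) := by positivity
        omega)
      have a2 := h2 (m + n * (d + 1) + 1) (by
        have : (0 : ℤ) ≤ n * (d + 1) := by positivity
        omega)
      have a3 := hδ n
      rw [show m + n * (d + 1) + 1 + d = m + n * (d + 1) + (d + 1) by ring] at a2
      have w1 := H.weight_eq m (m + n * (d + 1))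
      have w2 := H.weight_eq m (m + n * (d + 1) + 1)
      have w3 := H.weight_eq m (m + n * (d + 1) + (d + 1))
      push_cast at w1 w2 w3
      rw [show X m + n * (d + 1) * (X 1 - X 0) = X (m + n * (d + 1)) by rw [w1]; ring,
        show X (m + n * (d + 1)) + (X 1 - X 0) = X (m + n * (d + 1) + 1) by rw [w1, w2]; ring,
        show X (m + n * (d + 1)) + (d + 1) * (X 1 - X 0) = X (m + n * (d + 1) + (d + 1)) by
          rw [w1, w3]; ring, ← a1, ← a2, ← a3, ← hn]
      ring)
  exact sub_eq_zero.mp this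

end PartialSystem
end GenVir

/-! ### Half-lines in the support -/

namespace GenVir
namespace PartialSystem

variable {F : Type*} [Field F] [CharZero F] {X : ℤ → F} {c : F} {S : Set ℤ} {e : ℤ → ℤ → F}

/-- The system on `ℤ` with the opposite orientation. -/
theorem neg (H : PartialSystem X c S e) :
    PartialSystem (fun n => X (-n)) c {n | -n ∈ S} (fun m n => e (-m) (-n)) := by
  simpa using H.line 0 (h := -1) (by norm_num)

omit [CharZero F] in
theorem edge_eq_zero_of_left (H : PartialSystem X c S e) {u : ℤ} (hu : u ∉ S) (v : ℤ) :
    e u v = 0 :=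
  by_contra fun h => hu (H.supp u v h).1

omit [CharZero F] in
theorem edge_eq_zero_of_right (H : PartialSystem X c S e) {v : ℤ} (hv : v ∉ S) (u : ℤ) :
    e u v = 0 :=
  by_contra fun h => hv (H.supp u v h).2

theorem loop_succ (H : PartialSystem X c S e) {n d : ℤ} (hn : n ∈ S) :
    e n (n + d) * e (n + d) n = e (n - d) n * e n (n - d) + 2 * d * (X 1 - X 0) * X n
      - ((d * (X 1 - X 0)) ^ 3 - d * (X 1 - X 0)) / 12 * c := by
  have h := H.loop n hn (n + d) (n - d) (by ring)
  have w1 := H.weight_eq n (n + d)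
  have w2 := H.weight_eq n (n - d)
  push_cast at w1 w2
  rw [w1, w2] at h
  linear_combination h

/-- The upper end of the run of `S` through `s`. -/
theorem exists_run_end {S : Set ℤ} {s : ℤ} (hs : s ∈ S) (h : ∃ n, s ≤ n ∧ n ∉ S) :
    ∃ j, s ≤ j ∧ j + 1 ∉ S ∧ ∀ m, s ≤ m → m ≤ j → m ∈ S := by
  classical
  obtain ⟨n, hn, hnS⟩ := h
  have hex : ∃ i : ℕ, s + i ∉ S := ⟨(n - s).toNat, by
    rwa [Int.toNat_of_nonneg (by omega), add_sub_cancel]⟩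
  have h1 := Nat.find_spec hex
  have h2 : Nat.find hex ≠ 0 := fun h0 => by
    rw [h0] at h1
    exact h1 (by simpa using hs)
  refine ⟨s + Nat.find hex - 1, by omega, by simpa using h1, fun m hm hm' => ?_⟩
  have h3 := Nat.find_min hex (m := (m - s).toNat) (by omega)
  rw [not_not, Int.toNat_of_nonneg (by omega), add_sub_cancel] at h3
  exact h3

/-- A finite run of the support is symmetric about a point that does not depend on the run. -/
theorem run_center (H : PartialSystem X c S e) {i j : ℤ} (hij : i ≤ j) (hi : i - 1 ∉ S)
    (hj : j + 1 ∉ S) (hS : ∀ m, i ≤ m → m ≤ j → m ∈ S) :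
    (X 1 - X 0) ^ 2 * ((i : F) + j)
      = ((X 1 - X 0) ^ 3 - (X 1 - X 0)) / 12 * c - 2 * X 0 * (X 1 - X 0) := by
  have key : ∀ n : ℕ, i - 1 + n ≤ j → e (i - 1 + n) (i - 1 + n + 1) * e (i - 1 + n + 1) (i - 1 + n)
      = n * (2 * X 0 * (X 1 - X 0) + (X 1 - X 0) ^ 2 * (n + 2 * i - 1)
        - ((X 1 - X 0) ^ 3 - (X 1 - X 0)) / 12 * c) := by
    intro n
    induction n with
    | zero =>
      intro _
      simp [H.edge_eq_zero_of_left hi]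
    | succ n ih =>
      intro hn
      have h1 := H.loop_succ (n := i - 1 + (n + 1 : ℕ)) (d := 1) (hS _ (by push_cast; omega) hn)
      rw [h1, show i - 1 + ((n + 1 : ℕ) : ℤ) - 1 = i - 1 + n by push_cast; ring]
      rw [show i - 1 + ((n + 1 : ℕ) : ℤ) = i - 1 + n + 1 by push_cast; ring, ih (by omega),
        H.weight_eq 0 (i - 1 + n + 1)]
      push_cast
      ring
  have h2 := key (j + 1 - i).toNat (by omega)
  have h3 : (((j + 1 - i).toNat : ℕ) : ℤ) = j + 1 - i := Int.toNat_of_nonneg (by omega)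
  have h4 : (((j + 1 - i).toNat : ℕ) : F) = j + 1 - i := by
    have := congrArg (Int.cast (R := F)) h3
    push_cast at this
    exact_mod_cast this
  rw [h3, h4, show i - 1 + (j + 1 - i) = j by ring, H.edge_eq_zero_of_right hj, zero_mul] at h2
  have h5 : ((j : F) + 1 - i) ≠ 0 := by
    have : j + 1 - i ≠ 0 := by omega
    exact_mod_cast this
  have h6 := (mul_eq_zero.mp h2.symm).resolve_left h5
  linear_combination h6

/-- If the weight or the central charge at `u` does not vanish, the support contains a half-line. -/
theorem exists_half_line (H : PartialSystem X c S e) {u : ℤ} (hu : u ∈ S) (h : X u ≠ 0 ∨ c ≠ 0) :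
    (∃ N, ∀ n, N ≤ n → n ∈ S) ∨ (∃ N, ∀ n, n ≤ N → n ∈ S) := by
  by_contra hcon
  push Not at hcon
  obtain ⟨hup, hdown⟩ := hcon
  have hh := H.step_ne_zero
  have run : ∀ s ∈ S, ∃ i j, i ≤ s ∧ s ≤ j ∧ (∀ m, i ≤ m → m ≤ j → m ∈ S) ∧
      (X 1 - X 0) ^ 2 * ((i : F) + j)
      = ((X 1 - X 0) ^ 3 - (X 1 - X 0)) / 12 * c - 2 * X 0 * (X 1 - X 0) ∧
      i - 1 ∉ S ∧ j + 1 ∉ S := by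
    intro s hs
    obtain ⟨j, hsj, hj, hj'⟩ := exists_run_end hs (hup s)
    obtain ⟨i, hsi, hi, hi'⟩ := exists_run_end (S := {n | -n ∈ S}) (s := -s) (by simpa using hs) (by
      obtain ⟨n, hn, hn'⟩ := hdown s
      exact ⟨-n, by omega, by simpa using hn'⟩)
    have hi1 : -i - 1 ∉ S := by
      intro h0
      exact hi (by simpa [sub_eq_add_neg, add_comm] using h0)
    have hS : ∀ m, -i ≤ m → m ≤ j → m ∈ S := by
      intro m h1 h2
      rcases le_total s m with h3 | h3
      · exact hj' m h3 h2
      · simpa using hi' (-m) (by omega) (by omega)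
    exact ⟨-i, j, by omega, hsj, hS, H.run_center (by omega) hi1 hj hS, hi1, hj⟩
  obtain ⟨i, j, hiu, huj, hS, hc, hi, hj⟩ := run u hu
  have bound : ∀ s ∈ S, i ≤ s ∧ s ≤ j := by
    intro s hs
    obtain ⟨i', j', hi's, hsj', hS', hc', hi', hj'⟩ := run s hs
    have h1 : i' + j' = i + j := by
      have h2 : (X 1 - X 0) ^ 2 * ((i' : F) + j') = (X 1 - X 0) ^ 2 * ((i : F) + j) := by
        rw [hc, hc']
      exact_mod_cast mul_left_cancel₀ (pow_ne_zero 2 hh) h2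
    by_contra hns
    rcases lt_or_ge s i with h3 | h3
    · have : j' < i := by
        by_contra h4
        exact hi (hS' _ (by omega) (by omega))
      omega
    · have : j < i' := by
        by_contra h4
        exact hj (hS' _ (by omega) (by omega))
      omega
  have far : ∀ n : ℤ, j - i < n →
      2 * n * (X 1 - X 0) * X u - ((n * (X 1 - X 0)) ^ 3 - n * (X 1 - X 0)) / 12 * c = 0 := by
    intro n hn
    have h1 := H.loop_succ (d := n) hu
    rw [H.edge_eq_zero_of_right (v := u + n) (fun h0 => by have := bound _ h0; omega),
      H.edge_eq_zero_of_right (v := u - n) (fun h0 => by have := bound _ h0; omega)] at h1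
    linear_combination -h1
  have far' : ∀ n : ℤ, j - i < n → 24 * X u = ((n * (X 1 - X 0)) ^ 2 - 1) * c := by
    intro n hn
    have hn0 : (n : F) ≠ 0 := by
      have : n ≠ 0 := by omega
      exact_mod_cast this
    apply mul_left_cancel₀ (mul_ne_zero hn0 hh)
    linear_combination 12 * far n hn
  have h1 := far' (j - i + 1) (by omega)
  have h2 := far' (j - i + 2) (by omega)
  have h3 : (2 * (j - i + 1) + 1 : F) ≠ 0 := by
    have : 2 * (j - i + 1) + 1 ≠ 0 := by omega
    exact_mod_cast this
  have hc0 : c = 0 := by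
    have h4 : (X 1 - X 0) ^ 2 * (2 * (j - i + 1) + 1) * c = 0 := by
      push_cast at h1 h2
      linear_combination h1 - h2
    exact (mul_eq_zero.mp h4).resolve_left (mul_ne_zero (pow_ne_zero 2 hh) h3)
  rw [hc0, mul_zero] at h1
  exact h.elim (fun h0 => h0 ((mul_eq_zero.mp h1).resolve_left (by norm_num))) (fun h0 => h0 hc0)

/-- The loops `m, m + 1` and the triangles `m, m + 1, m + 2` along a half-line in the support. -/
theorem small_triangle_eq (H : PartialSystem X c S e) {k : ℤ} (hk : ∀ m, k ≤ m → m ∈ S) (n : ℕ) :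
    e (k + n) (k + n + 1) * e (k + n + 1) (k + n)
      = e k (k + 1) * e (k + 1) k + 2 * (X 1 - X 0) * n * X k + (X 1 - X 0) ^ 2 * (n * (n + 1))
        - n * (((X 1 - X 0) ^ 3 - (X 1 - X 0)) / 12 * c) ∧
    e (k + n) (k + n + 1) * e (k + n + 1) (k + n + 2) * e (k + n + 2) (k + n)
      = e k (k + 1) * e (k + 1) (k + 2) * e (k + 2) k
        + 3 * (X 1 - X 0) * (n * (e k (k + 1) * e (k + 1) k) + (X 1 - X 0) * X k * n * (n + 1)
          + (X 1 - X 0) ^ 2 * (n * (n + 1) * (n + 2) / 3)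
          - ((X 1 - X 0) ^ 3 - (X 1 - X 0)) / 12 * c * (n * (n + 1) / 2)) := by
  induction n with
  | zero => simp
  | succ n ih =>
    obtain ⟨ih1, ih2⟩ := ih
    obtain ⟨j, hj⟩ : ∃ j, j = k + (n : ℤ) := ⟨_, rfl⟩
    have e1 : k + ((n + 1 : ℕ) : ℤ) = j + 1 := by rw [hj]; push_cast; ring
    have h1 := H.loop_succ (n := j + 1) (d := 1) (hk _ (by omega))
    have h2 := H.comm (j + 2) (j + 3) j (j + 1) (by ring) (by omega)
    have w1 := H.weight_eq k (j + 1)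
    have w2 := H.weight_eq j (j + 3)
    rw [e1]
    rw [← hj] at ih1 ih2
    rw [add_sub_cancel_right, ih1, w1] at h1
    rw [show j + 1 + 1 = j + 2 by ring] at h1 ⊢
    rw [show j + 1 + 2 = j + 3 by ring]
    rw [w2] at h2
    rw [hj] at h1 h2
    rw [hj] at ih2 ⊢
    push_cast at h1 h2 ⊢
    refine ⟨by linear_combination h1, ?_⟩
    linear_combination h2 * e (k + n + 1) (k + n + 2) + ih2 + 3 * (X 1 - X 0) * h1

/-- The fifth difference of the product formula for the triangles `m, m + 1, m + 2` at even `m`. -/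
theorem charge_relation {F : Type*} [Field F] [CharZero F] {x h A B p q κ κ' : F}
    (H : ∀ l : ℕ, (p + 3 * h * (2 * l * A + h * x * (2 * l) * (2 * l + 1)
          + h ^ 2 * (2 * l * (2 * l + 1) * (2 * l + 2) / 3) - κ * (2 * l * (2 * l + 1) / 2)))
        * (q + 3 * h * (2 * l * A + h * x * (2 * l) * (2 * l + 1)
          + h ^ 2 * (2 * l * (2 * l + 1) * (2 * l + 2) / 3) - κ * (2 * l * (2 * l + 1) / 2)))
      = (A + 2 * h * (2 * l) * x + h ^ 2 * (2 * l * (2 * l + 1)) - 2 * l * κ)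
        * (A + 2 * h * (2 * l + 1) * x + h ^ 2 * ((2 * l + 1) * (2 * l + 2)) - (2 * l + 1) * κ)
        * (B + 4 * h * l * x + 4 * h ^ 2 * (l * (l + 1)) - l * κ')) :
    h ^ 4 * (κ' - 2 * κ) = 0 := by
  have h0 := H 0
  have h1 := H 1
  have h2 := H 2
  have h3 := H 3
  have h4 := H 4
  have h5 := H 5
  push_cast at h0 h1 h2 h3 h4 h5
  linear_combination (1 / 1920) * (h5 - 5 * h4 + 10 * h3 - 10 * h2 + 5 * h1 - h0)

/-- The product formula for the triangles `m, m + 1, m + 2` forces the central charge to vanish. -/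
theorem charge_eq_zero_of_half_line (H : PartialSystem X c S e) {k : ℤ}
    (hk : ∀ m, k ≤ m → m ∈ S) : c = 0 := by
  have hh := H.step_ne_zero
  have t2 : ∀ l : ℕ, e (k + (2 * l : ℕ)) (k + (2 * l : ℕ) + 2)
        * e (k + (2 * l : ℕ) + 2) (k + (2 * l : ℕ))
      = e k (k + 2) * e (k + 2) k + 4 * (X 1 - X 0) * l * X k
        + 4 * (X 1 - X 0) ^ 2 * (l * (l + 1))
        - l * (((2 * (X 1 - X 0)) ^ 3 - 2 * (X 1 - X 0)) / 12 * c) := by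
    intro l
    induction l with
    | zero => simp
    | succ l ih =>
      obtain ⟨j, hj⟩ : ∃ j, j = k + ((2 * l : ℕ) : ℤ) := ⟨_, rfl⟩
      have e1 : k + ((2 * (l + 1) : ℕ) : ℤ) = j + 2 := by rw [hj]; push_cast; ring
      have h1 := H.loop_succ (n := j + 2) (d := 2) (hk _ (by omega))
      have w1 := H.weight_eq k (j + 2)
      rw [e1]
      rw [← hj] at ih
      rw [add_sub_cancel_right, ih, w1] at h1
      rw [h1, hj]
      push_cast
      ring
  have key := charge_relation (x := X k) (h := X 1 - X 0) (A := e k (k + 1) * e (k + 1) k)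
    (B := e k (k + 2) * e (k + 2) k) (p := e k (k + 1) * e (k + 1) (k + 2) * e (k + 2) k)
    (q := e (k + 1) k * e (k + 2) (k + 1) * e k (k + 2))
    (κ := ((X 1 - X 0) ^ 3 - (X 1 - X 0)) / 12 * c)
    (κ' := ((2 * (X 1 - X 0)) ^ 3 - 2 * (X 1 - X 0)) / 12 * c) (fun l => by
      have h1 := (H.small_triangle_eq hk (2 * l)).1
      have h1' := (H.small_triangle_eq hk (2 * l + 1)).1
      have h2 := (H.small_triangle_eq hk (2 * l)).2
      have h3 := (H.dual.small_triangle_eq hk (2 * l)).2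
      have h4 := t2 l
      rw [show k + ((2 * l + 1 : ℕ) : ℤ) + 1 = k + ((2 * l : ℕ) : ℤ) + 2 by push_cast; ring,
        show k + ((2 * l + 1 : ℕ) : ℤ) = k + ((2 * l : ℕ) : ℤ) + 1 by push_cast; ring] at h1'
      rw [mul_comm (e (k + 1) k)] at h3
      have h5 := congrArg₂ (· * ·) h2 h3
      have h6 := congrArg₂ (· * ·) (congrArg₂ (· * ·) h1 h1') h4
      push_cast at h5 h6
      linear_combination h6 - h5)
  have h1 : (X 1 - X 0) ^ 7 / 2 * c = 0 := by linear_combination key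
  exact (mul_eq_zero.mp h1).resolve_left (div_ne_zero (pow_ne_zero _ hh) two_ne_zero)

/-- Along a half-line in the support, the deviation of a loop from the product of the weights is
homogeneous of degree two in the length. -/
theorem two_step_loop (H : PartialSystem X 0 S e) {k : ℤ} (hk : ∀ m, k ≤ m → m ∈ S) :
    e k (k + 2) * e (k + 2) k - X k * X (k + 2)
      = 4 * (e k (k + 1) * e (k + 1) k - X k * X (k + 1)) := by
  have hh := H.step_ne_zero
  have h1 : ∀ m, k ≤ m → e m (m + 1) * e (m + 1) m
      = pairing ((e k (k + 1) * e (k + 1) k - X k * X (k + 1)) / (X 1 - X 0) ^ 2)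
        (X m) (X (m + 1)) := by
    intro m hm
    obtain ⟨n, rfl⟩ := Int.le.dest hm
    have h2 := (H.small_triangle_eq hk n).1
    have w1 := H.weight_eq k (k + n)
    have w2 := H.weight_eq k (k + n + 1)
    have w3 := H.weight_eq k (k + 1)
    push_cast at w1 w2 w3
    rw [h2, w1, w2, w3]
    simp only [pairing]
    field_simp
    ring
  have h2 := H.pairing_succ hk one_pos h1 h1 k le_rfl
  rw [one_add_one_eq_two] at h2
  have w1 := H.weight_eq k (k + 2)
  have w3 := H.weight_eq k (k + 1)
  push_cast at w1 w3
  rw [h2, w1, w3]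
  simp only [pairing]
  field_simp
  ring

end PartialSystem
end GenVir

/-! ### The central charge and the support -/

namespace GenVir
namespace PartialSystem

variable {F : Type*} [Field F] [CharZero F] {X : ℤ → F} {c : F} {S : Set ℤ} {e : ℤ → ℤ → F}

/-- The weight at the lower end `i` of an upper half-line in the support. -/
theorem weight_of_half_line_end (H : PartialSystem X 0 S e) {i : ℤ} (hi : i - 1 ∉ S)
    (hS : ∀ m, i ≤ m → m ∈ S) :
    (3 * X i - (X 1 - X 0)) * (X i - (X 1 - X 0)) = 0 := by
  have h1 := H.loop_succ (d := 1) (hS i le_rfl)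
  have h2 := H.loop_succ (d := 1) (hS (i + 1) (by omega))
  have h3 := H.loop_succ (d := 2) (hS (i + 1) (by omega))
  have h4 := H.two_step_loop (k := i + 1) (fun m hm => hS m (by omega))
  rw [H.edge_eq_zero_of_left hi] at h1
  rw [show i + 1 - 2 = i - 1 by ring, H.edge_eq_zero_of_left hi] at h3
  rw [add_sub_cancel_right] at h2
  have w1 := H.weight_eq i (i + 1)
  have w2 := H.weight_eq i (i + 1 + 1)
  have w3 := H.weight_eq i (i + 1 + 2)
  push_cast at w1 w2 w3 h1 h2 h3
  rw [h3, h2, h1, w1, w2, w3] at h4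
  linear_combination h4

/-- Below the end of an upper half-line in the support, only one point is missing. -/
theorem mem_of_half_line_end (H : PartialSystem X 0 S e) {i : ℤ} (hi : i - 1 ∉ S)
    (hS : ∀ m, i ≤ m → m ∈ S) : i - 2 ∈ S := by
  by_contra hi2
  have h0 := H.weight_of_half_line_end hi hS
  have h1 := H.loop_succ (d := 1) (hS i le_rfl)
  have h3 := H.loop_succ (d := 2) (hS i le_rfl)
  have h4 := H.two_step_loop hS
  rw [H.edge_eq_zero_of_left hi] at h1
  rw [H.edge_eq_zero_of_left hi2] at h3
  have w1 := H.weight_eq i (i + 1)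
  have w2 := H.weight_eq i (i + 2)
  push_cast at w1 w2 h1 h3
  rw [h3, h1, w1, w2] at h4
  have h5 : X i * (3 * X i - 2 * (X 1 - X 0)) = 0 := by linear_combination h4
  have hh := H.step_ne_zero
  rcases mul_eq_zero.mp h5 with h6 | h6
  · rw [h6] at h0
    exact pow_ne_zero 2 hh (by linear_combination h0)
  · exact pow_ne_zero 2 hh (by linear_combination (-3) * h0 + (3 * X i - 2 * (X 1 - X 0)) * h6)

/-- If the support of a system on a line without central charge contains an upper half-line, at most
the point of weight zero is missing from it. -/
theorem weight_eq_zero_of_upper_half_line (H : PartialSystem X 0 S e)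
    (hS : ∃ N, ∀ n, N ≤ n → n ∈ S) {n : ℤ} (hn : n ∉ S) : X n = 0 := by
  obtain ⟨N, hN⟩ := hS
  have hh := H.step_ne_zero
  obtain ⟨i', hi1, hi2, hi3⟩ := exists_run_end (S := {n | -n ∈ S}) (s := -N)
    (by simpa using hN N le_rfl) ⟨-n, by
      have : ¬ N ≤ n := fun h0 => hn (hN n h0)
      omega, by simpa using hn⟩
  obtain ⟨i, rfl⟩ : ∃ i, i' = -i := ⟨-i', by ring⟩
  have hi : i - 1 ∉ S := fun h0 => hi2 (by simpa [sub_eq_add_neg, add_comm] using h0)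
  have hup : ∀ m, i ≤ m → m ∈ S := by
    intro m hm
    rcases le_total N m with h1 | h1
    · exact hN m h1
    · simpa using hi3 (-m) (by omega) (by omega)
  have hx := H.weight_of_half_line_end hi hup
  have hi2S := H.mem_of_half_line_end hi hup
  have w2 := H.weight_eq i (i - 2)
  push_cast at w2
  by_cases hdown : ∀ m, m ≤ i - 2 → m ∈ S
  · have h1 := H.neg.weight_of_half_line_end (i := -(i - 2))
      (by
        intro h0
        apply hi
        have h1 : -(-(i - 2) - 1) ∈ S := h0
        rwa [show -(-(i - 2) - 1) = i - 1 by ring] at h1)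
      (fun m hm => hdown (-m) (by omega))
    have w3 := H.weight_eq 0 (-1)
    rw [neg_neg, neg_zero, w3, w2] at h1
    push_cast at h1
    have h2 : X i - (X 1 - X 0) = 0 := by
      rcases mul_eq_zero.mp hx with h2 | h2
      · exfalso
        exact pow_ne_zero 2 hh (by linear_combination (3 / 8) * h1
          - (3 / 8) * (X i - (X 1 - X 0) - 4 / 3 * (X 1 - X 0)) * h2)
      · exact h2
    have hni : n = i - 1 := by
      by_contra h0
      rcases lt_or_ge n (i - 1) with h3 | h3
      · exact hn (hdown n (by omega))
      · exact hn (hup n (by omega))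
    rw [hni, H.weight_eq i (i - 1)]
    push_cast
    linear_combination h2
  · exfalso
    push Not at hdown
    obtain ⟨m, hm, hmS⟩ := hdown
    obtain ⟨j', hj1, hj2, hj3⟩ := exists_run_end (S := {n | -n ∈ S}) (s := -(i - 2))
      (by simpa using hi2S) ⟨-m, by omega, by simpa using hmS⟩
    obtain ⟨j, rfl⟩ : ∃ j, j' = -j := ⟨-j', by ring⟩
    have hc := H.run_center (i := j) (j := i - 2) (by omega)
      (fun h0 => hj2 (by simpa [sub_eq_add_neg, add_comm] using h0))
      (by rwa [show i - 2 + 1 = i - 1 by ring])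
      (fun m h1 h2 => by simpa using hj3 (-m) (by omega) (by omega))
    have w4 := H.weight_eq 0 i
    push_cast at w4 hc
    have hsum : 2 * X i = (i - j + 2) * (X 1 - X 0) := by
      apply mul_left_cancel₀ hh
      linear_combination hc + 2 * (X 1 - X 0) * w4
    rcases mul_eq_zero.mp hx with h2 | h2
    · have h3 : (X 1 - X 0) * (3 * (i - j + 2) - 2) = 0 := by
        linear_combination 2 * h2 - 3 * hsum
      have h4 := (mul_eq_zero.mp h3).resolve_left hh
      have h5 : 3 * (i - j + 2) - 2 = 0 := by exact_mod_cast h4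
      omega
    · have h3 : (X 1 - X 0) * ((i - j + 2) - 2) = 0 := by
        linear_combination 2 * h2 - hsum
      have h4 := (mul_eq_zero.mp h3).resolve_left hh
      have h5 : (i - j + 2) - 2 = 0 := by exact_mod_cast h4
      omega

variable {G : Type*} [AddCommGroup G] {Y : G → F} {T : Set G} {f : G → G → F}

/-- A nonzero central charge would force half-lines into the support. -/
theorem charge_eq_zero (H : PartialSystem Y c T f) [Nontrivial G] (hT : T.Nonempty) : c = 0 := by
  by_contra hc
  obtain ⟨u, hu⟩ := hT
  obtain ⟨h, hh⟩ := exists_ne (0 : G)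
  have H1 := H.line u hh
  rcases H1.exists_half_line (u := 0) (by simpa using hu) (Or.inr hc) with ⟨N, hN⟩ | ⟨N, hN⟩
  · exact hc (H1.charge_eq_zero_of_half_line hN)
  · exact hc (H1.neg.charge_eq_zero_of_half_line (k := -N) (fun m hm => hN (-m) (by omega)))

/-- Without central charge, the support is everything but possibly the point of weight zero. -/
theorem mem_of_weight_ne_zero (H : PartialSystem Y 0 T f) {u v : G} (hu : u ∈ T) (hu0 : Y u ≠ 0)
    (hv0 : Y v ≠ 0) : v ∈ T := by
  by_contra hv
  have hh : v - u ≠ 0 := by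
    rw [sub_ne_zero]
    rintro rfl
    exact hv hu
  have H1 := H.line u hh
  have h1 : Y (u + (1 : ℤ) • (v - u)) = 0 := by
    rcases H1.exists_half_line (u := 0) (by simpa using hu) (Or.inl (by simpa using hu0))
      with hN | ⟨N, hN⟩
    · exact H1.weight_eq_zero_of_upper_half_line hN (by simpa using hv)
    · have := H1.neg.weight_eq_zero_of_upper_half_line (n := -1)
        ⟨-N, fun m hm => hN (-m) (by omega)⟩ (by simpa using hv)
      simpa using this
  exact hv0 (by simpa using h1)

end PartialSystem
end GenVir

/-! ### Loops of length two on a line -/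

namespace GenVir

/-- A weight module in coordinates, with all weights of a coset and without central charge: `X u` is
the weight at `u`, and `e u v` is the coefficient of the operator of degree `v - u` from `u` to
`v`. At `u` of weight zero the coefficients may be those of a missing vector. -/
structure System {F G : Type*} [Field F] [AddCommGroup G] (X : G → F) (e : G → G → F) : Prop where
  affine : ∀ u v v' w : G, v + v' = u + w → X v + X v' = X u + X w
  injective : Function.Injective X
  diag : ∀ u, e u u = X u
  comm : ∀ u v v' w : G, v + v' = u + w → e u v * e v w - e u v' * e v' w = (X v - X v') * e u w

/-- The coefficients of the tensor density module with parameter `β`. -/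
def density {F : Type*} [Field F] (β x y : F) : F := (1 - β) * x + β * y

namespace System

variable {F G : Type*} [Field F] [AddCommGroup G] {X : G → F} {e : G → G → F}

theorem toPartialSystem (H : System X e) : PartialSystem X 0 Set.univ e where
  affine := H.affine
  injective := H.injective
  supp _ _ _ := ⟨trivial, trivial⟩
  diag u _ := H.diag u
  comm u v v' w h _ := H.comm u v v' w h
  loop u _ v v' h := by rw [H.comm u v v' u h, H.diag]; ring

theorem dual (H : System X e) : System X (fun u v => e v u) where
  affine := H.affine
  injective := H.injective
  diag := H.diag
  comm u v v' w h := by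
    have := H.comm w v v' u (by rw [h, add_comm])
    linear_combination this

theorem line [CharZero F] (H : System X e) (k : G) {h : G} (hh : h ≠ 0) :
    System (fun n : ℤ => X (k + n • h)) (fun m n => e (k + m • h) (k + n • h)) where
  affine _ _ _ _ huv := H.affine _ _ _ _ (zsmul_line_add k h huv)
  injective := H.injective.comp (zsmul_line_injective H.affine H.injective k hh)
  diag _ := H.diag _
  comm _ _ _ _ huv := H.comm _ _ _ _ (zsmul_line_add k h huv)

/-- Rescaling of the basis vectors. -/
theorem twist (H : System X e) {f : G → F} (hf : ∀ u, f u ≠ 0) :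
    System X (fun u v => e u v * f u / f v) where
  affine := H.affine
  injective := H.injective
  diag u := by rw [H.diag, mul_div_assoc, div_self (hf u), mul_one]
  comm u v v' w h := by
    have h1 := H.comm u v v' w h
    have hv := hf v
    have hv' := hf v'
    have hw := hf w
    field_simp
    linear_combination f u * h1

end System

theorem PartialSystem.toSystem {F G : Type*} [Field F] [AddCommGroup G] {X : G → F} {S : Set G}
    {e : G → G → F} (H : PartialSystem X 0 S e) (hS : ∀ u, u ∉ S → X u = 0) : System X e where
  affine := H.affine
  injective := H.injective
  diag u := by
    by_cases hu : u ∈ S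
    · exact H.diag u hu
    · rw [hS u hu]
      exact by_contra fun h => hu (H.supp u u h).1
  comm u v v' w h := by
    by_cases huw : u = w
    · subst huw
      by_cases hu : u ∈ S
      · rw [H.loop u hu v v' h, H.diag u hu]
        ring
      · have h0 : ∀ v, e u v = 0 := fun v => by_contra fun h => hu (H.supp u v h).1
        simp [h0]
    · exact H.comm u v v' w h huw

namespace System

section Line

variable {F : Type*} [Field F] [CharZero F] {X : ℤ → F} {e : ℤ → ℤ → F}

/-- On a line, the values of the loops of length two are those of a tensor density module. -/
theorem exists_pairing (H : System X e) :
    ∃ B : F, ∀ m n, e m n * e n m = pairing B (X m) (X n) := by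
  have P := H.toPartialSystem
  have hh := P.step_ne_zero
  obtain ⟨B, hB⟩ : ∃ B, B = (e 0 1 * e 1 0 - X 0 * X 1) / (X 1 - X 0) ^ 2 := ⟨_, rfl⟩
  have hB0 : e 0 1 * e 1 0 = pairing B (X 0) (X 1) := by
    rw [hB, pairing]
    field_simp
    ring
  have step : ∀ m, (e (m - 1) m * e m (m - 1) = pairing B (X (m - 1)) (X m) ↔
      e m (m + 1) * e (m + 1) m = pairing B (X m) (X (m + 1))) := by
    intro m
    have h1 := P.loop_succ (n := m) (d := 1) trivial
    have w1 := P.weight_eq m (m + 1)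
    have w2 := P.weight_eq m (m - 1)
    push_cast at w1 w2 h1
    rw [h1, w1, w2]
    simp only [pairing]
    constructor <;> intro h2
    · linear_combination h2
    · linear_combination h2
  have h1 : ∀ m, e m (m + 1) * e (m + 1) m = pairing B (X m) (X (m + 1)) := by
    intro m
    induction m using Int.induction_on with
    | zero => simpa using hB0
    | succ i hi =>
      apply (step _).mp
      simpa using hi
    | pred i hi =>
      have := (step (-i)).mpr hi
      simpa using this
  have hd : ∀ d : ℕ, 1 ≤ d → ∀ m : ℤ, e m (m + d) * e (m + d) m = pairing B (X m) (X (m + d)) := by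
    intro d hd
    induction d, hd using Nat.le_induction with
    | base => simpa using h1
    | succ d hd ih =>
      intro m
      have := P.pairing_succ (k := m) (d := d) (fun _ _ => trivial) (by omega) (fun m _ => h1 m)
        (fun m _ => ih m) m le_rfl
      simpa using this
  refine ⟨B, fun m n => ?_⟩
  rcases lt_trichotomy m n with h | rfl | h
  · have := hd (n - m).toNat (by omega) m
    rwa [Int.toNat_of_nonneg (by omega), add_sub_cancel] at this
  · rw [H.diag, pairing]
    ring
  · have := hd (m - n).toNat (by omega) n
    rw [Int.toNat_of_nonneg (by omega), add_sub_cancel] at this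
    rw [mul_comm, this, pairing, pairing]
    ring

end Line

variable {F G : Type*} [Field F] [CharZero F] [AddCommGroup G] {X : G → F} {e : G → G → F} {B : F}

/-- The defect of a triangle is unchanged when a vertex is reflected in the midpoint of the
opposite side. -/
theorem defect_reflect (H : System X e)
    (hB : ∀ u v, e u v * e v u = pairing B (X u) (X v)) {u v v' w : G} (h : v + v' = u + w) :
    e u v * e v w * e w u - meanTriangle B (X u) (X v) (X w)
      = e u v' * e v' w * e w u - meanTriangle B (X u) (X v') (X w) := by
  have h1 := H.comm u v v' w h
  have h2 := hB u w
  have h3 : X v' = X u + X w - X v := by linear_combination H.affine u v v' w h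
  rw [h3] at h1 ⊢
  simp only [pairing, meanTriangle] at h2 ⊢
  linear_combination e w u * h1 + (2 * X v - X u - X w) * h2

theorem defect_translate (H : System X e)
    (hB : ∀ u v, e u v * e v u = pairing B (X u) (X v)) (u v w : G) (n : ℕ) :
    e (u + n • (v - u)) (v + n • (v - u)) * e (v + n • (v - u)) (w + n • (v - u))
        * e (w + n • (v - u)) (u + n • (v - u))
      - meanTriangle B (X (u + n • (v - u))) (X (v + n • (v - u))) (X (w + n • (v - u)))
    = e u v * e v w * e w u - meanTriangle B (X u) (X v) (X w) := by
  induction n with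
  | zero => simp
  | succ n ih =>
    have h1 := H.defect_reflect hB (u := w + n • (v - u)) (v := u + n • (v - u))
      (v' := w + (n + 1) • (v - u)) (w := v + n • (v - u)) (by rw [add_smul, one_smul]; abel)
    have h2 := H.defect_reflect hB (u := v + n • (v - u)) (v := w + n • (v - u))
      (v' := v + (n + 1) • (v - u)) (w := w + (n + 1) • (v - u)) (by rw [add_smul, one_smul]; abel)
    rw [← ih, show u + (n + 1) • (v - u) = v + n • (v - u) by rw [add_smul, one_smul]; abel]
    simp only [meanTriangle] at *
    linear_combination -h1 - h2

/-- The square of the defect of a triangle, from the product formula. -/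
theorem defect_sq (H : System X e)
    (hB : ∀ u v, e u v * e v u = pairing B (X u) (X v)) (u v w : G) :
    (e u v * e v w * e w u - meanTriangle B (X u) (X v) (X w)) ^ 2
      = B ^ 2 * (1 - 4 * B) / 4 * ((X u - X v) * (X v - X w) * (X w - X u)) ^ 2 := by
  by_cases huv : u = v
  · subst huv
    have h1 := hB u w
    rw [H.diag]
    have : X u * e u w * e w u - meanTriangle B (X u) (X u) (X w) = 0 := by
      simp only [meanTriangle, pairing] at h1 ⊢
      linear_combination X u * h1
    rw [this]
    ring
  have hne : X v - X u ≠ 0 := sub_ne_zero.mpr fun h => huv (H.injective h).symm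
  obtain ⟨W, hW⟩ : ∃ W, W = e u v * e v w * e w u - meanTriangle B (X u) (X v) (X w) := ⟨_, rfl⟩
  obtain ⟨W', hW'⟩ : ∃ W', W' = e v u * e w v * e u w - meanTriangle B (X u) (X v) (X w) := ⟨_, rfl⟩
  have key : ∀ n : ℕ, (meanTriangle B (X u + n * (X v - X u)) (X v + n * (X v - X u))
        (X w + n * (X v - X u)) + W)
      * (meanTriangle B (X u + n * (X v - X u)) (X v + n * (X v - X u))
        (X w + n * (X v - X u)) + W')
      = pairing B (X u + n * (X v - X u)) (X v + n * (X v - X u))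
        * pairing B (X v + n * (X v - X u)) (X w + n * (X v - X u))
        * pairing B (X w + n * (X v - X u)) (X u + n * (X v - X u)) := by
    intro n
    have h1 := H.defect_translate hB u v w n
    have h2 := H.dual.defect_translate (fun u v => by rw [mul_comm, hB]) u v w n
    rw [← hW] at h1
    rw [← hW'] at h2
    have t : ∀ z : G, X (z + n • (v - u)) = X z + n * (X v - X u) := by
      intro z
      have h3 := affine_zsmul H.affine z (v - u) n
      have h4 := H.affine u v z (z + (v - u)) (by abel)
      rw [natCast_zsmul] at h3
      rw [h3]
      push_cast
      linear_combination -(n : F) * h4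
    rw [← t, ← t, ← t, ← hB, ← hB, ← hB, ← sub_eq_iff_eq_add'.mp h1, ← sub_eq_iff_eq_add'.mp h2]
    ring
  have k0 := key 0
  -- `key` is a polynomial identity of degree four in `q`, without constant term
  have k1 := key 1
  have k2 := key 2
  have k3 := key 3
  simp only [meanTriangle, pairing] at k0 k1 k2 k3
  push_cast at k0 k1 k2 k3
  have hsum : W + W' = 0 := by
    have h6 : 6 * (X v - X u) ^ 3 * (W + W') = 0 := by
      linear_combination k3 - 3 * k2 + 3 * k1 - k0
    exact (mul_eq_zero.mp h6).resolve_left (mul_ne_zero (by norm_num) (pow_ne_zero 3 hne))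
  rw [← hW]
  have hW2 : W' = -W := by linear_combination hsum
  rw [hW2] at k0
  linear_combination -k0

end System
end GenVir

/-! ### Triangles -/

namespace GenVir

/-- A polynomial that vanishes on an arithmetic progression is zero. -/
theorem polynomial_eq_zero_of_shifted_progression {F : Type*} [Field F] [CharZero F]
    {P : Polynomial F} {c s : F} (hs : s ≠ 0) (h : ∀ n : ℕ, P.eval (c + n * s) = 0) : P = 0 := by
  apply Polynomial.eq_zero_of_infinite_isRoot
  refine (Set.infinite_range_of_injective (f := fun n : ℕ => c + (n : F) * s) ?_).mono ?_
  · intro m n hmn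
    exact_mod_cast mul_right_cancel₀ hs (add_left_cancel hmn)
  · rintro _ ⟨n, rfl⟩
    exact h n

theorem polynomial_eq_zero_of_progression {F : Type*} [Field F] [CharZero F] {P : Polynomial F}
    {s : F} (hs : s ≠ 0) (h : ∀ n : ℕ, P.eval (n * s) = 0) : P = 0 :=
  polynomial_eq_zero_of_shifted_progression (c := 0) hs fun n => by rw [zero_add, h]

namespace System

open Filter

variable {F G : Type*} [Field F] [CharZero F] [AddCommGroup G] {X : G → F} {e : G → G → F} {B : F}

omit [CharZero F] in
theorem pairing_eq_density (β x y : F) :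
    pairing (β * (1 - β)) x y = density β x y * density β y x := by
  simp only [pairing, density]
  ring

/-- The triangle values of the two tensor density modules with the same loop values. -/
theorem density_triangle (β x y z : F) :
    density β x y * density β y z * density β z x = meanTriangle (β * (1 - β)) x y z
      - β * (1 - β) * (1 - 2 * β) / 2 * ((x - y) * (y - z) * (z - x)) := by
  simp only [density, meanTriangle]
  ring

/-- Each single triangle is that of the tensor density module with parameter `β` or `1 - β`. -/
theorem triangle_dichotomy {β : F} (H : System X e)
    (hB : ∀ u v, e u v * e v u = pairing (β * (1 - β)) (X u) (X v)) (u v w : G) :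
    e u v * e v w * e w u
        = density β (X u) (X v) * density β (X v) (X w) * density β (X w) (X u) ∨
      e u v * e v w * e w u
        = density β (X v) (X u) * density β (X w) (X v) * density β (X u) (X w) := by
  have h1 := H.defect_sq hB u v w
  have h2 := density_triangle β (X u) (X v) (X w)
  have h3 := density_triangle β (X w) (X v) (X u)
  rw [h2, show density β (X v) (X u) * density β (X w) (X v) * density β (X u) (X w)
    = density β (X w) (X v) * density β (X v) (X u) * density β (X u) (X w) by ring, h3,
    ← sub_eq_zero, ← sub_eq_zero (b := meanTriangle _ (X w) _ _ - _), ← mul_eq_zero]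
  simp only [meanTriangle] at h1 ⊢
  linear_combination h1

omit [CharZero F] in
theorem eventually_weight_ne (H : System X e) (r : F) :
    ∀ᶠ u in cofinite, X u ≠ r := by
  rw [eventually_cofinite]
  simp only [not_not]
  exact Set.Subsingleton.finite fun a ha b hb => H.injective (ha.trans hb.symm)

omit [CharZero F] in
theorem eventually_mul_weight_ne (H : System X e) {a : F} (ha : a ≠ 0) (r : F) :
    ∀ᶠ u in cofinite, a * X u ≠ r := by
  filter_upwards [H.eventually_weight_ne (r / a)] with u hu h
  exact hu (by rw [← h]; field_simp)

omit [CharZero F] in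
theorem weight_translate (H : System X e) (u w z : G) (n : ℕ) :
    X (z + n • (w - u)) = X z + n * (X w - X u) := by
  have h3 := affine_zsmul H.affine z (w - u) n
  have h4 := H.affine u w z (z + (w - u)) (by abel)
  rw [natCast_zsmul] at h3
  rw [h3]
  push_cast
  linear_combination -(n : F) * h4

/-- The four faces of a tetrahedron: two faces with a common edge cannot belong to the parameters
`β` and `1 - β`, except for special positions of the vertices. Otherwise, translation along the
common edge `u w` would give an identity between polynomials in the weight whose right-hand side is
divisible by `density β (X u) (X w)`, while the left-hand side is not. -/
theorem triangle_propagate {β : F} (h0 : β ≠ 0) (h1 : β ≠ 1) (h2 : 1 - 2 * β ≠ 0) (H : System X e)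
    (hB : ∀ u v, e u v * e v u = pairing (β * (1 - β)) (X u) (X v)) {u v w z : G}
    (huv : u ≠ v) (huw : u ≠ w) (hvw : v ≠ w) (huz : u ≠ z) (hwz : w ≠ z)
    (hc : β * X z ≠ β * X w - (1 - β) * (X v - X u))
    (hc' : (1 - β) * X z ≠ (1 - β) * X u - β * (X v - X w))
    (hT : e u v * e v w * e w u
        = density β (X u) (X v) * density β (X v) (X w) * density β (X w) (X u)) :
    e u w * e w z * e z u
        = density β (X u) (X w) * density β (X w) (X z) * density β (X z) (X u) := by
  refine (H.triangle_dichotomy hB u w z).resolve_right fun hT' => ?_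
  have h1' : 1 - β ≠ 0 := sub_ne_zero.mpr (Ne.symm h1)
  have hX : ∀ {a b : G}, a ≠ b → X b - X a ≠ 0 := fun hab =>
    sub_ne_zero.mpr fun h => hab (H.injective h).symm
  set p : G → G → Polynomial F := fun a b =>
    Polynomial.X + Polynomial.C (density β (X a) (X b)) with hp
  have hpe : ∀ (a b : G) (y : F), (p a b).eval y = y + density β (X a) (X b) := by
    intro a b y
    simp [hp]
  have hpn : ∀ (a b : G) (n : ℕ), (p a b).eval (n * (X w - X u))
      = density β (X (a + n • (w - u))) (X (b + n • (w - u))) := by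
    intro a b n
    rw [hpe, H.weight_translate, H.weight_translate, density, density]
    ring
  -- the left-hand side, and the four candidates for the right-hand side
  set L : Polynomial F := p u v * p v w * p w u * (p w u * p z w * p u z) * (p v z * p z v) with hL
  set R : Polynomial F := p u w * p w u with hR
  set Q : Polynomial F :=
    (L - p v w * p w z * p z v * (p u v * p v z * p z u) * R)
    * (L - p v w * p w z * p z v * (p v u * p z v * p u z) * R)
    * ((L - p w v * p z w * p v z * (p u v * p v z * p z u) * R)
    * (L - p w v * p z w * p v z * (p v u * p z v * p u z) * R)) with hQ
  have hQ0 : Q = 0 := by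
    refine polynomial_eq_zero_of_progression (hX huw) fun n => ?_
    set τ : G → G := fun a => a + n • (w - u) with hτ
    have t1 : e (τ u) (τ v) * e (τ v) (τ w) * e (τ w) (τ u) = density β (X (τ u)) (X (τ v))
        * density β (X (τ v)) (X (τ w)) * density β (X (τ w)) (X (τ u)) := by
      have ht := H.dual.defect_translate (fun u v => by rw [mul_comm, hB]) u w v n
      have hD := density_triangle β (X (τ u)) (X (τ v)) (X (τ w))
      have hD' := density_triangle β (X u) (X v) (X w)
      simp only [hτ] at hD ⊢
      rw [hD]
      rw [H.weight_translate, H.weight_translate, H.weight_translate] at ht ⊢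
      simp only [meanTriangle] at ht hD' ⊢
      linear_combination ht + hT + hD'
    have t2 : e (τ u) (τ w) * e (τ w) (τ z) * e (τ z) (τ u) = density β (X (τ w)) (X (τ u))
        * density β (X (τ z)) (X (τ w)) * density β (X (τ u)) (X (τ z)) := by
      have ht := H.defect_translate hB u w z n
      have hD := density_triangle β (X (τ z)) (X (τ w)) (X (τ u))
      have hD' := density_triangle β (X z) (X w) (X u)
      simp only [hτ] at hD ⊢
      rw [mul_comm (density β (X (w + n • (w - u))) (X (u + n • (w - u)))), hD]
      rw [H.weight_translate, H.weight_translate, H.weight_translate] at ht ⊢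
      simp only [meanTriangle] at ht hD' ⊢
      linear_combination ht + hT' + hD'
    have t3 := H.triangle_dichotomy hB (τ v) (τ w) (τ z)
    have t4 := H.triangle_dichotomy hB (τ u) (τ v) (τ z)
    have t5 := hB (τ u) (τ w)
    have t6 := hB (τ v) (τ z)
    rw [pairing_eq_density] at t5 t6
    have key : e (τ u) (τ v) * e (τ v) (τ w) * e (τ w) (τ u)
        * (e (τ u) (τ w) * e (τ w) (τ z) * e (τ z) (τ u)) * (e (τ v) (τ z) * e (τ z) (τ v))
      = e (τ v) (τ w) * e (τ w) (τ z) * e (τ z) (τ v)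
        * (e (τ u) (τ v) * e (τ v) (τ z) * e (τ z) (τ u)) * (e (τ u) (τ w) * e (τ w) (τ u)) := by
      ring
    rw [t1, t2, t5, t6] at key
    simp only [hQ, hL, hR, Polynomial.eval_mul, Polynomial.eval_sub, hpn]
    change _ = (0 : F)
    rcases t3 with t3 | t3 <;> rcases t4 with t4 | t4 <;> rw [t3, t4] at key <;>
      simp only [hτ] at key <;> rw [key] <;> ring
  have hev := congrArg (Polynomial.eval (-density β (X u) (X w))) hQ0
  have hR0 : R.eval (-density β (X u) (X w)) = 0 := by
    simp [hR, hpe]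
  have hL0 : L.eval (-density β (X u) (X w)) = 0 := by
    simp only [hQ, Polynomial.eval_mul, Polynomial.eval_sub, hR0, Polynomial.eval_zero, mul_zero,
      sub_zero] at hev
    simpa only [mul_self_eq_zero] using hev
  simp only [hL, Polynomial.eval_mul, hpe, density] at hL0
  have f1 : -((1 - β) * X u + β * X w) + ((1 - β) * X u + β * X v) ≠ 0 := by
    intro h
    exact mul_ne_zero h0 (hX hvw) (by linear_combination -h)
  have f2 : -((1 - β) * X u + β * X w) + ((1 - β) * X v + β * X w) ≠ 0 := by
    intro h
    exact mul_ne_zero h1' (hX huv) (by linear_combination h)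
  have f3 : -((1 - β) * X u + β * X w) + ((1 - β) * X w + β * X u) ≠ 0 := by
    intro h
    exact mul_ne_zero h2 (hX huw) (by linear_combination h)
  have f4 : -((1 - β) * X u + β * X w) + ((1 - β) * X z + β * X w) ≠ 0 := by
    intro h
    exact mul_ne_zero h1' (hX huz) (by linear_combination h)
  have f5 : -((1 - β) * X u + β * X w) + ((1 - β) * X u + β * X z) ≠ 0 := by
    intro h
    exact mul_ne_zero h0 (hX hwz) (by linear_combination h)
  have f6 : -((1 - β) * X u + β * X w) + ((1 - β) * X v + β * X z) ≠ 0 := by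
    intro h
    exact hc (by linear_combination h)
  have f7 : -((1 - β) * X u + β * X w) + ((1 - β) * X z + β * X v) ≠ 0 := by
    intro h
    exact hc' (by linear_combination h)
  exact (mul_ne_zero (mul_ne_zero (mul_ne_zero (mul_ne_zero f1 f2) f3)
    (mul_ne_zero (mul_ne_zero f3 f4) f5)) (mul_ne_zero f6 f7)) hL0

end System
end GenVir

/-! ### The parameter of the triangles -/

namespace GenVir

/-- The triangle `u, v, w` takes the value that it has in the tensor density module with
parameter `β`. -/
def TriangleLaw {F G : Type*} [Field F] (X : G → F) (e : G → G → F) (β : F) (u v w : G) : Prop :=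
  e u v * e v w * e w u = density β (X u) (X v) * density β (X v) (X w) * density β (X w) (X u)

namespace System

open Filter

variable {F G : Type*} [Field F] [CharZero F] [AddCommGroup G] {X : G → F} {e : G → G → F} {B : F}

/-- The law passes from the triangle `u`, `v`, `w` to almost all triangles with the edge `u w`. -/
theorem eventually_triangleLaw {β : F} (h0 : β ≠ 0) (h1 : β ≠ 1) (h2 : 1 - 2 * β ≠ 0)
    (H : System X e) (hB : ∀ u v, e u v * e v u = pairing (β * (1 - β)) (X u) (X v)) {u v w : G}
    (huv : u ≠ v) (huw : u ≠ w) (hvw : v ≠ w) (hT : TriangleLaw X e β u v w) :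
    ∀ᶠ z in cofinite, u ≠ z ∧ w ≠ z ∧ TriangleLaw X e β u w z := by
  filter_upwards [H.eventually_weight_ne (X u), H.eventually_weight_ne (X w),
    H.eventually_mul_weight_ne h0 (β * X w - (1 - β) * (X v - X u)),
    H.eventually_mul_weight_ne (sub_ne_zero.mpr h1.symm) ((1 - β) * X u - β * (X v - X w))]
    with z hu hw hc hc'
  have hu' : u ≠ z := fun h => hu (by rw [h])
  have hw' : w ≠ z := fun h => hw (by rw [h])
  exact ⟨hu', hw', H.triangle_propagate h0 h1 h2 hB huv huw hvw hu' hw' hc hc' hT⟩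

/-- One triangle determines the parameter of almost all others. -/
theorem eventually_triangleLaw_of_triangleLaw {β : F} (h0 : β ≠ 0) (h1 : β ≠ 1)
    (h2 : 1 - 2 * β ≠ 0) (H : System X e)
    (hB : ∀ u v, e u v * e v u = pairing (β * (1 - β)) (X u) (X v)) {u v w : G}
    (huv : u ≠ v) (huw : u ≠ w) (hvw : v ≠ w) (hT : TriangleLaw X e β u v w) :
    ∀ᶠ z in cofinite, ∀ᶠ y in cofinite, ∀ᶠ p in cofinite,
      z ≠ y ∧ z ≠ p ∧ y ≠ p ∧ TriangleLaw X e β y z p := by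
  filter_upwards [H.eventually_triangleLaw h0 h1 h2 hB huv huw hvw hT] with z ⟨huz, hwz, hz⟩
  filter_upwards [H.eventually_triangleLaw h0 h1 h2 hB huw huz hwz hz] with y ⟨huy, hzy, hy⟩
  have hy' : TriangleLaw X e β y u z := by
    unfold TriangleLaw at hy ⊢
    linear_combination hy
  filter_upwards [H.eventually_triangleLaw h0 h1 h2 hB huy.symm hzy.symm huz hy']
    with p ⟨hyp, hzp, hp⟩
  exact ⟨hzy, hzp, hyp, hp⟩

/-- If `β (1 - β) (1 - 2 β) = 0`, there is only one possible value for each triangle. -/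
theorem triangleLaw_of_degenerate {β : F} (h : β * (1 - β) * (1 - 2 * β) = 0) (H : System X e)
    (hB : ∀ u v, e u v * e v u = pairing (β * (1 - β)) (X u) (X v)) (u v w : G) :
    TriangleLaw X e β u v w := by
  have h1 := H.defect_sq hB u v w
  have h2 : (β * (1 - β)) ^ 2 * (1 - 4 * (β * (1 - β))) = (β * (1 - β) * (1 - 2 * β)) ^ 2 := by ring
  rw [h2, h, zero_pow two_ne_zero, zero_div, zero_mul] at h1
  rw [TriangleLaw, density_triangle, h, zero_div, zero_mul, sub_zero]
  exact sub_eq_zero.mp (pow_eq_zero_iff two_ne_zero |>.mp h1)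

theorem _root_.GenVir.exists_distinct (G : Type*) [Infinite G] :
    ∃ u v w : G, u ≠ v ∧ u ≠ w ∧ v ≠ w := by
  classical
  obtain ⟨s, hs⟩ := Infinite.exists_subset_card_eq G 3
  obtain ⟨u, v, w, h1, h2, h3, -⟩ := Finset.card_eq_three.mp hs
  exact ⟨u, v, w, h1, h2, h3⟩

/-- If the loops of length two are those of a tensor density module, then so are all triangles, for
one parameter `β`. -/
theorem exists_triangleLaw [Infinite G] (H : System X e)
    (hB : ∀ u v, e u v * e v u = pairing B (X u) (X v)) :
    ∃ β : F, β * (1 - β) = B ∧ (B = 0 → β = 0) ∧ ∀ u v w, TriangleLaw X e β u v w := by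
  by_cases hB0 : B = 0
  · refine ⟨0, by simp [hB0], fun _ => rfl, H.triangleLaw_of_degenerate (by simp) ?_⟩
    simpa [hB0] using hB
  by_cases hB4 : 4 * B = 1
  · have hb : (1 / 2 : F) * (1 - 1 / 2) = B := by linear_combination (-1 / 4) * hB4
    refine ⟨1 / 2, hb, fun h => absurd h hB0, H.triangleLaw_of_degenerate (by norm_num) ?_⟩
    rwa [hb]
  have hX : ∀ {a b : G}, a ≠ b → X a - X b ≠ 0 := fun hab =>
    sub_ne_zero.mpr fun h => hab (H.injective h)
  obtain ⟨u, v, w, huv, huw, hvw⟩ := exists_distinct G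
  obtain ⟨D, hD⟩ : ∃ D, D = (X u - X v) * (X v - X w) * (X w - X u) := ⟨_, rfl⟩
  have hD0 : D ≠ 0 := by
    rw [hD]
    exact mul_ne_zero (mul_ne_zero (hX huv) (hX hvw)) (hX huw.symm)
  obtain ⟨W, hW⟩ : ∃ W, W = e u v * e v w * e w u - meanTriangle B (X u) (X v) (X w) := ⟨_, rfl⟩
  have hsq := H.defect_sq hB u v w
  rw [← hD, ← hW] at hsq
  -- the root of `β (1 - β) = B` for which the triangle `u, v, w` has the right value
  obtain ⟨β, hβ⟩ : ∃ β, β = (1 + 2 * W / (B * D)) / 2 := ⟨_, rfl⟩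
  have hβB : β * (1 - β) = B := by
    have h1 : (2 * W / (B * D)) ^ 2 = 1 - 4 * B := by
      rw [div_pow, div_eq_iff (pow_ne_zero 2 (mul_ne_zero hB0 hD0))]
      linear_combination 4 * hsq
    rw [hβ]
    linear_combination (-1 / 4) * h1
  have hr : B * (1 - 2 * β) * D = -2 * W := by
    rw [hβ]
    field_simp
    ring
  have h0 : β ≠ 0 := by
    rintro rfl
    exact hB0 (by rw [← hβB]; ring)
  have h1 : β ≠ 1 := by
    rintro rfl
    exact hB0 (by rw [← hβB]; ring)
  have h2 : 1 - 2 * β ≠ 0 := by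
    intro h
    exact hB4 (by rw [← hβB]; linear_combination -(1 - 2 * β) * h)
  have hT : TriangleLaw X e β u v w := by
    rw [TriangleLaw, density_triangle, hβB, ← hD]
    linear_combination -hW + hr / 2
  refine ⟨β, hβB, fun h => absurd h hB0, fun u' v' w' => ?_⟩
  rw [← hβB] at hB
  by_cases hd : u' = v' ∨ u' = w' ∨ v' = w'
  · rcases H.triangle_dichotomy hB u' v' w' with hT' | hT'
    · exact hT'
    · rw [TriangleLaw, hT']
      simp only [density]
      rcases hd with rfl | rfl | rfl <;> ring
  push Not at hd
  obtain ⟨huv', huw', hvw'⟩ := hd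
  refine (H.triangle_dichotomy hB u' v' w').resolve_right fun hT' => ?_
  have hT'' : TriangleLaw X e (1 - β) u' v' w' := by
    rw [TriangleLaw, hT']
    simp only [density]
    ring
  have e1 := H.eventually_triangleLaw_of_triangleLaw h0 h1 h2 hB huv huw hvw hT
  have e2 := H.eventually_triangleLaw_of_triangleLaw (β := 1 - β) (sub_ne_zero.mpr h1.symm)
    (fun h => h0 (by linear_combination -h)) (fun h => h2 (by linear_combination -h))
    (fun u v => by rw [hB]; congr 1; ring) huv' huw' hvw' hT''
  obtain ⟨z, hz1, hz2⟩ := (e1.and e2).exists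
  obtain ⟨y, hy1, hy2⟩ := (hz1.and hz2).exists
  obtain ⟨p, ⟨hzy, hzp, hyp, hp1⟩, -, -, -, hp2⟩ := (hy1.and hy2).exists
  have h3 := hp1.symm.trans hp2
  rw [density_triangle, density_triangle] at h3
  have h4 : β * (1 - β) * (1 - 2 * β) * ((X y - X z) * (X z - X p) * (X p - X y)) = 0 := by
    simp only [meanTriangle] at h3
    linear_combination -h3
  rw [hβB] at h4
  exact mul_ne_zero (mul_ne_zero hB0 h2)
    (mul_ne_zero (mul_ne_zero (hX hzy.symm) (hX hzp)) (hX hyp.symm)) h4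

end System
end GenVir

/-! ### Normal forms of the coefficients -/

namespace GenVir

open Filter

/-- A multiplicative cocycle that is defined on cofinitely many edges at each vertex of `V` is a
coboundary. -/
theorem exists_potential {F G : Type*} [Field F] [Infinite G] (V : Set G) (good : G → G → Prop)
    (ρ : G → G → F) (hsymm : ∀ u v, good u v → good v u) (hV : ∀ u v, good u v → u ∈ V)
    (hcof : ∀ u ∈ V, ∀ᶠ v in cofinite, good u v)
    (hinv : ∀ u v, good u v → ρ u v * ρ v u = 1)
    (hcoc : ∀ u v w, good u v → good v w → good u w → ρ u v * ρ v w = ρ u w) :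
    ∃ f : G → F, (∀ u, f u ≠ 0) ∧ ∀ u v, good u v → ρ u v * f u = f v := by
  classical
  by_cases hne : ∃ k, k ∈ V
  swap
  · exact ⟨fun _ => 1, fun _ => one_ne_zero, fun u v h => absurd ⟨u, hV u v h⟩ hne⟩
  obtain ⟨k, hk⟩ := hne
  have hz : ∀ u ∈ V, ∃ z, good k z ∧ good u z := fun u hu => ((hcof k hk).and (hcof u hu)).exists
  choose! z hz using hz
  have indep : ∀ u ∈ V, ∀ y, good k y → good u y →
      ρ k (z u) * ρ (z u) u = ρ k y * ρ y u := by
    intro u hu y hy hy'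
    obtain ⟨h1, h2⟩ := hz u hu
    obtain ⟨x, ⟨⟨hx1, hx2⟩, hx3⟩, hx4⟩ := (((hcof k hk).and (hcof u hu)).and
      (hcof _ (hV _ _ (hsymm _ _ hy)))).and (hcof _ (hV _ _ (hsymm _ _ h1))) |>.exists
    have hs : ∀ {a b}, good a b → good b a := fun h => hsymm _ _ h
    rw [← hcoc k x y hx1 (hs hx3) hy, ← hcoc k x (z u) hx1 (hs hx4) h1, mul_assoc, mul_assoc,
      hcoc x y u (hs hx3) (hs hy') (hs hx2), hcoc x (z u) u (hs hx4) (hs h2) (hs hx2)]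
  have hρ : ∀ u v, good u v → ρ u v ≠ 0 := fun u v h h0 => by
    have := hinv u v h
    rw [h0, zero_mul] at this
    exact zero_ne_one this
  refine ⟨fun u => if u ∈ V then ρ k (z u) * ρ (z u) u else 1, fun u => ?_, fun u v h => ?_⟩
  · simp only
    split_ifs with hu
    · exact mul_ne_zero (hρ _ _ (hz u hu).1) (hρ _ _ (hsymm _ _ (hz u hu).2))
    · exact one_ne_zero
  · have hu := hV u v h
    have hv := hV v u (hsymm u v h)
    obtain ⟨y, ⟨h1, h2⟩, h3⟩ := (((hcof k hk).and (hcof u hu)).and (hcof v hv)).exists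
    simp only [if_pos hu, if_pos hv]
    rw [indep u hu y h1 h2, indep v hv y h1 h3,
      ← hcoc y u v (hsymm _ _ h2) h (hsymm _ _ h3)]
    ring

/-- The functional equation of the coefficients at a vector of weight zero has only affine
solutions. -/
theorem exists_affine_of_functional_equation {F G : Type*} [Field F] [CharZero F] [AddCommGroup G]
    {x g : G → F} (hx : ∀ u v, x (u + v) = x u + x v) (hinj : Function.Injective x)
    (hg : ∀ u v, u ≠ 0 → v ≠ 0 → u + v ≠ 0 →
      x u * g u - x v * g v = (x u - x v) * g (u + v)) :
    ∃ κ l : F, ∀ u, u ≠ 0 → g u = κ * x u + l := by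
  by_cases hn : ∃ s : G, s ≠ 0
  swap
  · exact ⟨0, 0, fun u hu => absurd ⟨u, hu⟩ hn⟩
  obtain ⟨s, hs⟩ := hn
  have x0 : x 0 = 0 := by
    have := hx 0 0
    rw [add_zero] at this
    linear_combination -this
  have xne : ∀ u, x u ≠ 0 ↔ u ≠ 0 := fun u => by
    rw [← x0]
    exact hinj.ne_iff
  have hs' : x s ≠ 0 := (xne s).mpr hs
  obtain ⟨κ, hκ⟩ : ∃ κ, κ = (g (s + s) - g s) / x s := ⟨_, rfl⟩
  obtain ⟨r, hr⟩ : ∃ r : G → F, ∀ u, r u = g u - g s - κ * (x u - x s) := ⟨_, fun _ => rfl⟩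
  have r1 : r s = 0 := by rw [hr]; ring
  have r2 : r (s + s) = 0 := by
    rw [hr, hκ, hx]
    field_simp
    ring
  have hre : ∀ u v, u ≠ 0 → v ≠ 0 → u + v ≠ 0 →
      x u * r u - x v * r v = (x u - x v) * r (u + v) := by
    intro u v hu hv huv
    rw [hr, hr, hr, hx]
    linear_combination hg u v hu hv huv
  have xs2 : s + s ≠ 0 := by
    rw [← xne, hx]
    intro h
    exact hs' (by linear_combination h / 2)
  have gen : ∀ u, u ≠ 0 → u + s ≠ 0 → u + (s + s) ≠ 0 → r u = 0 := by
    intro u h0 h1 h2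
    have e1 := hre u s h0 hs h1
    have e2 := hre (u + s) s h1 hs (by rwa [add_assoc])
    have e3 := hre u (s + s) h0 xs2 h2
    rw [add_assoc, hx] at e2
    rw [hx] at e3
    rw [r1] at e1 e2
    rw [r2] at e3
    have e4 : r (u + s) = 0 := by
      have : 2 * x s ^ 2 * r (u + s) = 0 := by
        linear_combination x u * (e3 - e1) - (x u - 2 * x s) * e2
      exact (mul_eq_zero.mp this).resolve_left (mul_ne_zero two_ne_zero (pow_ne_zero 2 hs'))
    rw [e4] at e1
    exact (mul_eq_zero.mp (by linear_combination e1 : x u * r u = 0)).resolve_left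
      ((xne u).mpr h0)
  have xneg : x (-s) = -x s := by
    have := hx s (-s)
    rw [add_neg_cancel, x0] at this
    linear_combination -this
  have sum_ne : ∀ (n : ℕ) (v : G), n ≠ 0 → x v = n * x s → v ≠ 0 := by
    intro n v hn hv
    rw [← xne, hv]
    exact mul_ne_zero (Nat.cast_ne_zero.mpr hn) hs'
  have hneg1 : r (-s) = 0 := by
    have h3 : r (s + s + s) = 0 :=
      gen _ (sum_ne 3 _ (by norm_num) (by rw [hx, hx]; push_cast; ring))
        (sum_ne 4 _ (by norm_num) (by rw [hx, hx, hx]; push_cast; ring))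
        (sum_ne 5 _ (by norm_num) (by rw [hx, hx, hx]; push_cast; ring))
    have h4 := hre (-s) (s + s + s) (neg_ne_zero.mpr hs)
      (sum_ne 3 _ (by norm_num) (by rw [hx, hx]; push_cast; ring))
      (sum_ne 2 _ (by norm_num) (by rw [hx, hx, hx, xneg]; push_cast; ring))
    rw [show -s + (s + s + s) = s + s by abel, r2, h3, xneg] at h4
    exact (mul_eq_zero.mp (by linear_combination -h4 : x s * r (-s) = 0)).resolve_left hs'
  have hneg2 : r (-(s + s)) = 0 := by
    have h4 := hre s (-(s + s)) hs (neg_ne_zero.mpr xs2)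
      (by rw [show s + -(s + s) = -s by abel]; exact neg_ne_zero.mpr hs)
    rw [show s + -(s + s) = -s by abel, hneg1, r1, show -(s + s) = -s + -s by abel, hx, xneg] at h4
    rw [show -(s + s) = -s + -s by abel]
    exact (mul_eq_zero.mp (by linear_combination h4 / 2 : x s * r (-s + -s) = 0)).resolve_left hs'
  refine ⟨κ, g s - κ * x s, fun u hu => ?_⟩
  have : r u = 0 := by
    by_cases h1 : u + s = 0
    · rwa [eq_neg_of_add_eq_zero_left h1]
    by_cases h2 : u + (s + s) = 0
    · rwa [eq_neg_of_add_eq_zero_left h2]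
    exact gen u hu h1 h2
  rw [hr] at this
  linear_combination this

namespace System

variable {F G : Type*} [Field F] [CharZero F] [AddCommGroup G] {X : G → F} {e : G → G → F} {B : F}

omit [CharZero F] in
theorem eventually_pairing_ne (H : System X e) {u : G} (hu : X u ≠ 0 ∨ B ≠ 0) :
    ∀ᶠ v in cofinite, pairing B (X u) (X v) ≠ 0 := by
  set P : Polynomial F := Polynomial.C (X u) * Polynomial.X
    + Polynomial.C B * (Polynomial.X - Polynomial.C (X u)) ^ 2 with hP
  have hev : ∀ y, P.eval y = pairing B (X u) y := by
    intro y
    simp [hP, pairing]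
  have hP0 : P ≠ 0 := by
    intro h0
    have h1 := hev (X u)
    have h2 := hev 0
    rw [h0, Polynomial.eval_zero, pairing] at h1 h2
    have hXu : X u = 0 := by
      have : X u ^ 2 = 0 := by linear_combination -h1
      exact pow_eq_zero_iff two_ne_zero |>.mp this
    have h3 := hev 1
    rw [h0, Polynomial.eval_zero, pairing, hXu] at h3
    rcases hu with hu | hu
    · exact hu hXu
    · exact hu (by linear_combination -h3)
  classical
  rw [eventually_cofinite]
  simp only [not_not]
  refine ((P.roots.toFinset.finite_toSet).preimage (H.injective.injOn)).subset ?_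
  intro v hv
  simp only [Set.mem_preimage, Finset.mem_coe, Multiset.mem_toFinset]
  rw [Polynomial.mem_roots hP0, Polynomial.IsRoot, hev]
  exact hv

/-- After rescaling, the coefficients between vectors that lie on nonzero loops of length two are
those of a tensor density module. -/
theorem exists_rescaling [Infinite G] (H : System X e)
    (hB : ∀ u v, e u v * e v u = pairing B (X u) (X v)) :
    ∃ (β : F) (f : G → F), β * (1 - β) = B ∧ (B = 0 → β = 0) ∧ (∀ u, f u ≠ 0) ∧
      ∀ u v, (X u ≠ 0 ∨ B ≠ 0) → (X v ≠ 0 ∨ B ≠ 0) →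
        e u v * f u / f v = density β (X u) (X v) := by
  obtain ⟨β, hβ, hβ0, hT⟩ := H.exists_triangleLaw hB
  have hp : ∀ u v, pairing B (X u) (X v) = density β (X u) (X v) * density β (X v) (X u) := by
    intro u v
    rw [← hβ, pairing_eq_density]
  have hg : ∀ u v, pairing B (X u) (X v) ≠ 0 →
      e u v ≠ 0 ∧ e v u ≠ 0 ∧ density β (X u) (X v) ≠ 0 ∧ density β (X v) (X u) ≠ 0 := by
    intro u v h
    have h' := h
    rw [← hB] at h
    rw [hp] at h'
    exact ⟨left_ne_zero_of_mul h, right_ne_zero_of_mul h, left_ne_zero_of_mul h',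
      right_ne_zero_of_mul h'⟩
  have hsymm : ∀ u v, pairing B (X u) (X v) = pairing B (X v) (X u) := by
    intro u v
    simp only [pairing]
    ring
  obtain ⟨f, hf, hfe⟩ := exists_potential {u | X u ≠ 0 ∨ B ≠ 0}
    (fun u v => pairing B (X u) (X v) ≠ 0) (fun u v => e u v / density β (X u) (X v))
    (fun u v h => by rwa [hsymm])
    (fun u v h => by
      by_contra h'
      simp only [Set.mem_ofPred_eq, not_or, not_not] at h'
      exact h (by rw [pairing, h'.1, h'.2]; ring))
    (fun u hu => H.eventually_pairing_ne hu)
    (fun u v h => by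
      obtain ⟨-, -, h3, h4⟩ := hg u v h
      rw [div_mul_div_comm, hB, hp, div_self (mul_ne_zero h3 h4)])
    (fun u v w huv hvw huw => by
      obtain ⟨-, -, h1, -⟩ := hg u v huv
      obtain ⟨-, -, h2, -⟩ := hg v w hvw
      obtain ⟨h4, h5, h3, h6⟩ := hg u w huw
      have h7 := hT u v w
      have h8 := hB u w
      rw [TriangleLaw] at h7
      rw [hp] at h8
      rw [div_mul_div_comm, div_eq_div_iff (mul_ne_zero h1 h2) h3]
      refine mul_right_cancel₀ h5 ?_
      linear_combination density β (X u) (X w) * h7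
        - density β (X u) (X v) * density β (X v) (X w) * h8)
  have key : ∀ u v, pairing B (X u) (X v) ≠ 0 → e u v * f u / f v = density β (X u) (X v) := by
    intro u v h
    obtain ⟨-, -, h3, -⟩ := hg u v h
    have h4 := hfe u v h
    rw [div_mul_eq_mul_div, div_eq_iff h3] at h4
    rw [h4]
    field_simp [hf v]
  refine ⟨β, f, hβ, hβ0, hf, fun u w hu hw => ?_⟩
  have hinv : Tendsto (fun v => u + w - v) cofinite cofinite :=
    (sub_right_injective (b := u + w)).tendsto_cofinite
  obtain ⟨v, ⟨⟨⟨⟨h1, h2⟩, h3⟩, h4⟩, h5⟩⟩ := (((((H.eventually_pairing_ne hu).and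
    (H.eventually_pairing_ne hw)).and (hinv.eventually (H.eventually_pairing_ne hu))).and
    (hinv.eventually (H.eventually_pairing_ne hw))).and
    (H.eventually_mul_weight_ne two_ne_zero (X u + X w))).exists
  have hvw : v + (u + w - v) = u + w := by abel
  have h6 := (H.twist hf).comm u v (u + w - v) w hvw
  have h7 := H.affine _ _ _ _ hvw
  rw [key u v h1, key v w (by rwa [hsymm]), key u _ h3, key _ w (by rwa [hsymm])] at h6
  have h8 : X v - X (u + w - v) ≠ 0 := by
    intro h
    exact h5 (by linear_combination h + h7)
  refine mul_left_cancel₀ h8 ?_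
  rw [← h6]
  have h9 : X (u + w - v) = X u + X w - X v := by linear_combination h7
  rw [h9]
  simp only [density]
  ring

/-- The normal form around a vertex of weight zero that is not seen by the loops. -/
theorem exists_rescaling_of_weight_eq_zero [Infinite G] (H : System X e)
    (hB : ∀ u v, e u v * e v u = pairing 0 (X u) (X v)) {k : G} (hk : X k = 0) :
    ∃ (f : G → F) (κ l κ' l' : F), (∀ u, f u ≠ 0) ∧
      (∀ u v, u ≠ k → v ≠ k → e u v * f u / f v = X u) ∧
      (∀ v, v ≠ k → e k v * f k / f v = κ * X v + l) ∧
      (∀ v, v ≠ k → e v k * f v / f k = X v * (κ' * X v + l')) ∧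
      (κ = 0 ∧ l = 0 ∨ κ' = 0 ∧ l' = 0) := by
  obtain ⟨β, f, -, hβ, hf, hfe⟩ := H.exists_rescaling hB
  obtain rfl := hβ rfl
  have Xne : ∀ u, u ≠ k → X u ≠ 0 := fun u hu h => hu (H.injective (h.trans hk.symm))
  have he : ∀ u v, u ≠ k → v ≠ k → e u v * f u / f v = X u := by
    intro u v hu hv
    rw [hfe u v (Or.inl (Xne u hu)) (Or.inl (Xne v hv)), density]
    ring
  have hadd : ∀ u v, X (u + v + k) = X (u + k) + X (v + k) := by
    intro u v
    have := H.affine (u + v + k) (u + k) (v + k) k (by abel)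
    rw [hk] at this
    linear_combination -this
  have hinj : Function.Injective fun u => X (u + k) :=
    H.injective.comp (add_left_injective k)
  have shift : ∀ u, u ≠ 0 → u + k ≠ k := fun u hu h => hu (by simpa using h)
  obtain ⟨κ, l, hout⟩ := exists_affine_of_functional_equation
    (g := fun u => e k (u + k) * f k / f (u + k)) hadd hinj (by
      intro u v hu hv huv
      have h := (H.twist hf).comm k (u + k) (v + k) (u + v + k) (by abel)
      rw [he _ _ (shift u hu) (shift _ huv), he _ _ (shift v hv) (shift _ huv)] at h
      linear_combination h)
  obtain ⟨κ', l', hin⟩ := exists_affine_of_functional_equation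
    (g := fun u => e (u + k) k * f (u + k) / f k / X (u + k)) hadd hinj (by
      intro u v hu hv huv
      have h := (H.twist hf).comm (u + v + k) (u + k) (v + k) k (by abel)
      rw [he _ _ (shift _ huv) (shift u hu), he _ _ (shift _ huv) (shift v hv)] at h
      have h1 := Xne _ (shift u hu)
      have h2 := Xne _ (shift v hv)
      have h3 := Xne _ (shift _ huv)
      rw [mul_div_cancel₀ _ h1, mul_div_cancel₀ _ h2]
      refine mul_left_cancel₀ h3 ?_
      rw [mul_left_comm, mul_div_cancel₀ _ h3]
      linear_combination h)
  have hout' : ∀ v, v ≠ k → e k v * f k / f v = κ * X v + l := by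
    intro v hv
    simpa using hout (v - k) (sub_ne_zero.mpr hv)
  have hin' : ∀ v, v ≠ k → e v k * f v / f k = X v * (κ' * X v + l') := by
    intro v hv
    have := hin (v - k) (sub_ne_zero.mpr hv)
    simp only [sub_add_cancel] at this
    rw [← this, mul_div_cancel₀ _ (Xne v hv)]
  refine ⟨f, κ, l, κ', l', hf, he, hout', hin', ?_⟩
  have hprod : (Polynomial.C κ * Polynomial.X + Polynomial.C l)
      * (Polynomial.C κ' * Polynomial.X + Polynomial.C l') = 0 := by
    apply Polynomial.eq_zero_of_infinite_isRoot
    have hinf : (X '' {k}ᶜ).Infinite :=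
      ((Set.finite_singleton k).infinite_compl).image H.injective.injOn
    refine hinf.mono ?_
    rintro _ ⟨v, hv, rfl⟩
    have hv' : v ≠ k := hv
    have h1 := hB k v
    rw [hk, pairing] at h1
    have h2 : (e k v * f k / f v) * (e v k * f v / f k) = e k v * e v k := by
      have := hf k
      have := hf v
      field_simp
    rw [hout' v hv', hin' v hv', h1] at h2
    change Polynomial.eval _ _ = _
    simp only [Polynomial.eval_mul, Polynomial.eval_add, Polynomial.eval_C, Polynomial.eval_X]
    refine (mul_eq_zero.mp (?_ : X v * _ = 0)).resolve_left (Xne v hv')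
    linear_combination h2
  have hcoeff : ∀ a b : F, Polynomial.C a * Polynomial.X + Polynomial.C b = 0 → a = 0 ∧ b = 0 := by
    intro a b h
    have h0 := congrArg (Polynomial.eval 0) h
    have h1 := congrArg (Polynomial.eval 1) h
    simp at h0 h1
    rw [h0, add_zero] at h1
    exact ⟨h1, h0⟩
  exact (mul_eq_zero.mp hprod).imp (hcoeff _ _) (hcoeff _ _)

/-- The composite of the operators from `u` to `n` and from `n` to `w` is a quadratic polynomial in
the weight at `n`. -/
theorem exists_quadratic_of_pairing [Infinite G] (H : System X e)
    (hB : ∀ u v, e u v * e v u = pairing B (X u) (X v)) (u w : G) :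
    ∃ a b c : F, ∀ n, e u n * e n w = a * X n ^ 2 + b * X n + c := by
  suffices h : ∃ f : G → F, (∀ u, f u ≠ 0) ∧ ∃ a b c : F,
      ∀ n, (e u n * f u / f n) * (e n w * f n / f w) = a * X n ^ 2 + b * X n + c by
    obtain ⟨f, hf, a, b, c, h⟩ := h
    refine ⟨a * f w / f u, b * f w / f u, c * f w / f u, fun n => ?_⟩
    have h1 := h n
    have h2 := hf u
    have h3 := hf n
    have h4 := hf w
    field_simp at h1 ⊢
    linear_combination h1
  by_cases hV : ∀ v, X v ≠ 0 ∨ B ≠ 0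
  · obtain ⟨β, f, -, -, hf, hfe⟩ := H.exists_rescaling hB
    refine ⟨f, hf, (1 - β) * β, (1 - β) ^ 2 * X u + β ^ 2 * X w,
      (1 - β) * β * X u * X w, fun n => ?_⟩
    rw [hfe _ _ (hV u) (hV n), hfe _ _ (hV n) (hV w), density, density]
    ring
  push Not at hV
  obtain ⟨k, hk, rfl⟩ := hV
  obtain ⟨f, κ, l, κ', l', hf, he, hout, hin, h0⟩ := H.exists_rescaling_of_weight_eq_zero hB hk
  refine ⟨f, hf, ?_⟩
  have hkk : e k k * f k / f k = 0 := by
    rw [H.diag, hk]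
    simp
  by_cases hu : u = k <;> by_cases hw : w = k
  · subst hu hw
    refine ⟨0, 0, 0, fun n => ?_⟩
    have h1 := hB w n
    rw [pairing, hk] at h1
    have := hf w
    have := hf n
    field_simp
    linear_combination h1
  · subst hu
    refine ⟨κ, l, 0, fun n => ?_⟩
    by_cases hn : n = u
    · rw [hn, hkk, hk]
      ring
    · rw [hout n hn, he n w hn hw]
      ring
  · subst hw
    refine ⟨X u * κ', X u * l', 0, fun n => ?_⟩
    by_cases hn : n = w
    · rw [hn, hkk, hk]
      ring
    · rw [hin n hn, he u n hu hn]
      ring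
  · refine ⟨0, X u, 0, fun n => ?_⟩
    by_cases hn : n = k
    · rw [hn, hin u hu, hout w hw, hk]
      rcases h0 with ⟨rfl, rfl⟩ | ⟨rfl, rfl⟩ <;> ring
    · rw [he u n hu hn, he n w hn hw]
      ring

/-- On a line, the composite of the operators from `u` to `n` and from `n` to `w` is a quadratic
polynomial in the weight at `n`. -/
theorem exists_quadratic {X : ℤ → F} {e : ℤ → ℤ → F} (H : System X e) (u w : ℤ) :
    ∃ a b c : F, ∀ n, e u n * e n w = a * X n ^ 2 + b * X n + c := by
  obtain ⟨B, hB⟩ := H.exists_pairing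
  exact H.exists_quadratic_of_pairing hB u w

end System
end GenVir

/-! ### Double commutators and second differences of loops -/

namespace GenVir
namespace System

variable {F G : Type*} [Field F] [AddCommGroup G] {X : G → F} {e : G → G → F}

theorem weight_add (H : System X e) (u v : G) : X (u + v) = X u + X v - X 0 := by
  linear_combination -H.affine (u + v) u v 0 (by abel)

theorem weight_sub (H : System X e) (u v : G) : X (u - v) = X u - X v + X 0 := by
  linear_combination H.affine u (u - v) v 0 (by abel)

theorem weight_add_zsmul (H : System X e) (u h : G) (n : ℤ) :
    X (u + n • h) = X u + n * (X h - X 0) := by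
  rw [affine_zsmul H.affine, H.weight_add]
  ring

/-- The iterated commutator of the product of the operators of degrees `a + b` and `a - b` with the
operators of degrees `x - y - a` and `y - x - a`, at a loop based at `x`. Each term on the left
contains two operators of degrees `a ± b` in succession, and so varies along a line if `b` does; on
the right one finds loops of length two. -/
theorem double_commutator (H : System X e) {x y y' a b : G} (hy : y' = x + x - y) {q α ε : F}
    (hq : q = X y - X x) (hα : α = X a - X 0) (hε : ε = X b - X 0) :
    e x (y - a) * (e (y - a) (x - a - a) * (e (x - a - a) (x - a + b) * e (x - a + b) x)
        - e (y - a) (y + b) * e (y + b) (y + a) * e (y + a) x)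
      - (e x (y' - a) * (e (y' - a) (y' + b) * e (y' + b) (y' + a))
        - e x (x + a + b) * e (x + a + b) (x + a + a) * e (x + a + a) (y' + a)) * e (y' + a) x
    = (-q - 2 * α - ε) * ((2 * q - α - ε) * (e x (x - a + b) * e (x - a + b) x)
        + (q - 2 * α + ε) * (e x (y' + b) * e (y' + b) x))
      + (-q - 2 * α + ε) * ((q - 2 * α - ε) * (e x (y + b) * e (y + b) x)
        + (2 * q - α + ε) * (e x (x + a + b) * e (x + a + b) x)) := by
  have c1 := H.comm (y - a) (x - a - a) (y + b) (x - a + b) (by abel)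
  have c2 := H.comm (y + b) (x - a + b) (y + a) x (by abel)
  have c3 := H.comm x (y' - a) (x + a + b) (y' + b) (by abel)
  have c4 := H.comm (x + a + b) (y' + b) (x + a + a) (y' + a) (by abel)
  have c5 := H.comm x (y - a) (y' + b) (x - a + b) (by rw [hy]; abel)
  have c6 := H.comm (y' + b) (x - a + b) (y' + a) x (by abel)
  have c7 := H.comm x (y - a) (x + a + b) (y + b) (by abel)
  have c8 := H.comm (x + a + b) (y + b) (y' + a) x (by rw [hy]; abel)
  have hXy : X y' = 2 * X x - X y := by
    rw [hy, H.weight_sub, H.weight_add]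
    ring
  simp only [H.weight_add, H.weight_sub, hXy] at c1 c2 c3 c4 c5 c6 c7 c8
  subst hq hα hε
  linear_combination e x (y - a) * (c1 * e (x - a + b) x + e (y - a) (y + b) * c2)
    - (c3 * e (y' + b) (y' + a) + e x (x + a + b) * c4) * e (y' + a) x
    + (X x - X y - 2 * X a + 3 * X 0 - X b) * (c5 * e (x - a + b) x + e x (y' + b) * c6)
    + (X x - X y - 2 * X a + X 0 + X b) * (c7 * e (y + b) x + e x (x + a + b) * c8)

variable [CharZero F]

theorem exists_quadratic_on_line (H : System X e) {h : G} (hh : h ≠ 0) (k : G) (i j : ℤ) :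
    ∃ a b c : F, ∀ n : ℤ, e (k + i • h) (k + n • h) * e (k + n • h) (k + j • h)
      = a * n ^ 2 + b * n + c := by
  obtain ⟨a, b, c, habc⟩ := (H.line k hh).exists_quadratic i j
  refine ⟨a * (X h - X 0) ^ 2, 2 * a * X k * (X h - X 0) + b * (X h - X 0),
    a * X k ^ 2 + b * X k + c, fun n => ?_⟩
  rw [habc n, H.weight_add_zsmul]
  ring

theorem exists_pairing_on_line (H : System X e) {h : G} (hh : h ≠ 0) (k : G) :
    ∃ B : F, ∀ m n : ℤ, e (k + m • h) (k + n • h) * e (k + n • h) (k + m • h)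
      = pairing B (X (k + m • h)) (X (k + n • h)) :=
  (H.line k hh).exists_pairing

omit [CharZero F] in
theorem step_ne_zero (H : System X e) {h : G} (hh : h ≠ 0) : X h - X 0 ≠ 0 :=
  sub_ne_zero.mpr (H.injective.ne hh)

/-- The deviation of the loop of length two from `x` to `x + γ` from the product of the weights. -/
def _root_.GenVir.loopForm (X : G → F) (e : G → G → F) (x γ : G) : F :=
  e x (x + γ) * e (x + γ) x - X x * X (x + γ)

theorem loopForm_zsmul (H : System X e) (x γ : G) (n : ℤ) :
    loopForm X e x (n • γ) = n ^ 2 * loopForm X e x γ := by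
  by_cases hγ : γ = 0
  · subst hγ
    rw [smul_zero, loopForm, add_zero, H.diag]
    ring
  obtain ⟨B, hB⟩ := H.exists_pairing_on_line hγ x
  have h1 := hB 0 n
  have h2 := hB 0 1
  rw [H.weight_add_zsmul, H.weight_add_zsmul] at h1 h2
  simp only [zero_smul, one_smul, add_zero, pairing, Int.cast_zero, Int.cast_one] at h1 h2
  rw [loopForm, loopForm, H.weight_add_zsmul, h1, H.weight_add, h2]
  ring

theorem loopForm_neg (H : System X e) (x γ : G) : loopForm X e x (-γ) = loopForm X e x γ := by
  have := H.loopForm_zsmul x γ (-1)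
  simpa using this

/-- The second difference of `loopForm` in a fixed direction is quadratic. -/
theorem exists_loopForm_add_loopForm (H : System X e) (x γ : G) {h : G} (hh : h ≠ 0) :
    ∃ a c : F, ∀ n : ℤ,
      loopForm X e x (γ + n • h) + loopForm X e x (γ - n • h) = a * n ^ 2 + c := by
  obtain ⟨s, hs⟩ : ∃ s, s = X h - X 0 := ⟨_, rfl⟩
  have hs0 : s ≠ 0 := hs ▸ H.step_ne_zero hh
  obtain ⟨y, hy⟩ : ∃ y, y = x + γ := ⟨_, rfl⟩
  obtain ⟨y', hy'⟩ : ∃ y', y' = x + x - y := ⟨_, rfl⟩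
  obtain ⟨q, hq⟩ : ∃ q, q = X y - X x := ⟨_, rfl⟩
  obtain ⟨B, hB⟩ := H.exists_pairing_on_line hh x
  have hB' : ∀ n : ℤ, e x (x + n • h) * e (x + n • h) x
      = X x * (X x + n * s) + B * (n * s) ^ 2 := by
    intro n
    have := hB 0 n
    rw [H.weight_add_zsmul, H.weight_add_zsmul] at this
    simp only [zero_smul, add_zero, pairing, Int.cast_zero] at this
    rw [this, hs]
    ring
  have hL : ∀ n : ℤ, X x = X y' + (q + n * s) - n * s := by
    intro n
    rw [hy', H.weight_sub, H.weight_add, hq]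
    ring
  have hy2 : ∀ n : ℤ, e x (y' + n • h) * e (y' + n • h) x
      = e x (y + (-n) • h) * e (y + (-n) • h) x - (2 * q - 2 * n * s) * X x := by
    intro n
    have := H.comm x (y + (-n) • h) (y' + n • h) x (by rw [hy', neg_smul]; abel)
    rw [H.diag, H.weight_add_zsmul, H.weight_add_zsmul, ← hs] at this
    push_cast at this
    linear_combination (-1 : F) * this - X x * (hL n - hq)
  -- the left-hand side of `double_commutator`
  have lhs : ∀ j : ℤ, ∃ a b c : F, ∀ n : ℤ, a * n ^ 2 + b * n + c
      = (-q - 2 * (j * s) - n * s) * ((2 * q - j * s - n * s)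
            * (X x * (X x + (n - j) * s) + B * ((n - j) * s) ^ 2)
          + (q - 2 * (j * s) + n * s) * (e x (y + (-n) • h) * e (y + (-n) • h) x
            - (2 * q - 2 * n * s) * X x))
        + (-q - 2 * (j * s) + n * s) * ((q - 2 * (j * s) - n * s)
            * (e x (y + n • h) * e (y + n • h) x)
          + (2 * q - j * s + n * s) * (X x * (X x + (j + n) * s) + B * ((j + n) * s) ^ 2)) := by
    intro j
    obtain ⟨a1, b1, c1, h1⟩ := H.exists_quadratic_on_line hh x (-j - j) 0
    obtain ⟨a2, b2, c2, h2⟩ := H.exists_quadratic_on_line hh y (-j) j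
    obtain ⟨a3, b3, c3, h3⟩ := H.exists_quadratic_on_line hh y' (-j) j
    obtain ⟨a4, b4, c4, h4⟩ := H.exists_quadratic_on_line hh x 0 (j + j)
    have key : ∀ n : ℤ, _ := fun n => H.double_commutator (x := x) (y := y) (a := j • h)
      (b := n • h) hy' hq rfl rfl
    have hX : ∀ n : ℤ, X (n • h) - X 0 = n * s := by
      intro n
      have := H.weight_add_zsmul 0 h n
      rw [zero_add] at this
      rw [this, hs]
      ring
    have e1 : ∀ n : ℤ, x - j • h + n • h = x + (n - j) • h := fun n => by
      rw [sub_smul]; abel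
    have e2 : ∀ n : ℤ, x + j • h + n • h = x + (j + n) • h := fun n => by
      rw [add_smul]; abel
    have e3 : x - j • h - j • h = x + (-j - j) • h := by
      rw [sub_smul, neg_smul]; abel
    have e4 : ∀ u, u - j • h = u + (-j) • h := fun u => by
      rw [neg_smul]; abel
    have h1' : ∀ n : ℤ, e (x + (-j - j) • h) (x + (n - j) • h) * e (x + (n - j) • h) x
        = a1 * (n - j) ^ 2 + b1 * (n - j) + c1 := by
      intro n
      have := h1 (n - j)
      rw [zero_smul, add_zero] at this
      rw [this]
      push_cast
      ring
    have h4' : ∀ n : ℤ, e x (x + (j + n) • h) * e (x + (j + n) • h) (x + (j + j) • h)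
        = a4 * (j + n) ^ 2 + b4 * (j + n) + c4 := by
      intro n
      have := h4 (j + n)
      rw [zero_smul, add_zero] at this
      rw [this]
      push_cast
      ring
    simp only [e1, e2, e3] at key
    simp only [e4, hX, h1', hy2, h4', mul_assoc (e (y + (-j) • h) _) _ (e (y + j • h) x),
      h3] at key
    obtain ⟨A, hA⟩ : ∃ A, A = e x (y + (-j) • h) := ⟨_, rfl⟩
    obtain ⟨A1, hA1⟩ : ∃ A, A = e (y + (-j) • h) (x + (-j - j) • h) := ⟨_, rfl⟩
    obtain ⟨A2, hA2⟩ : ∃ A, A = e (y + j • h) x := ⟨_, rfl⟩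
    obtain ⟨A3, hA3⟩ : ∃ A, A = e x (y' + (-j) • h) := ⟨_, rfl⟩
    obtain ⟨A4, hA4⟩ : ∃ A, A = e (x + (j + j) • h) (y' + j • h) := ⟨_, rfl⟩
    obtain ⟨A5, hA5⟩ : ∃ A, A = e (y' + j • h) x := ⟨_, rfl⟩
    refine ⟨A * (A1 * a1 - a2 * A2) - (A3 * a3 - a4 * A4) * A5,
      A * (A1 * (b1 - 2 * a1 * j) - b2 * A2) - (A3 * b3 - (b4 + 2 * a4 * j) * A4) * A5,
      A * (A1 * (a1 * j ^ 2 - b1 * j + c1) - c2 * A2)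
        - (A3 * c3 - (a4 * j ^ 2 + b4 * j + c4) * A4) * A5, fun n => ?_⟩
    have h5 := key n
    have h6 := hB' (n - j)
    have h7 := hB' (j + n)
    have h8 := h2 n
    push_cast at h6 h7
    rw [h6, h7, ← hA, ← hA1, ← hA2, ← hA3, ← hA4, ← hA5] at h5
    rw [← h5]
    linear_combination A * A2 * h8
  obtain ⟨a0, b0, c0, h0⟩ := lhs 0
  obtain ⟨a1, b1, c1, h1⟩ := lhs 1
  obtain ⟨U, hU⟩ : ∃ U : ℤ → F, ∀ n, U n = e x (y + n • h) * e (y + n • h) x := ⟨_, fun _ => rfl⟩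
  simp only [← hU] at h0 h1
  -- the difference of the identities for two values of `j` isolates the even part
  have hS : ∃ a b c d : F, ∀ n : ℤ, U n + U (-n) = a * n ^ 3 + b * n ^ 2 + c * n + d := by
    have h4 : (4 : F) * s ^ 2 ≠ 0 := mul_ne_zero (by norm_num) (pow_ne_zero 2 hs0)
    obtain ⟨r, hr⟩ : ∃ r : F → F → F, ∀ j t, r j t = (-q - 2 * (j * s) - t * s)
        * ((2 * q - j * s - t * s) * (X x * (X x + (t - j) * s) + B * ((t - j) * s) ^ 2)
          - (q - 2 * (j * s) + t * s) * ((2 * q - 2 * t * s) * X x))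
        + (-q - 2 * (j * s) + t * s)
          * ((2 * q - j * s + t * s) * (X x * (X x + (j + t) * s) + B * ((j + t) * s) ^ 2)) :=
      ⟨_, fun _ _ => rfl⟩
    obtain ⟨g, hg⟩ : ∃ g : F → F, ∀ t, g t = ((a1 - a0) * t ^ 2 + (b1 - b0) * t + (c1 - c0)
        - (r 1 t - r 0 t)) / (4 * s ^ 2) := ⟨_, fun _ => rfl⟩
    have hUg : ∀ n : ℤ, U n + U (-n) = g n := by
      intro n
      have e0 := h0 n
      have e1 := h1 n
      push_cast at e0 e1
      rw [hg, eq_div_iff h4, hr, hr]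
      linear_combination e0 - e1
    -- `g` is a cubic polynomial, since the quartic terms of `r 0` and `r 1` are equal
    refine ⟨(g 2 - 3 * g 1 + 3 * g 0 - g (-1)) / 6, (g 1 + g (-1) - 2 * g 0) / 2,
      g 1 - g 0 - (g 2 - 3 * g 1 + 3 * g 0 - g (-1)) / 6 - (g 1 + g (-1) - 2 * g 0) / 2, g 0,
      fun n => ?_⟩
    rw [hUg]
    simp only [hg, hr]
    ring
  obtain ⟨a, b, c, d, hS⟩ := hS
  refine ⟨b, d - 2 * X x * X y, fun n => ?_⟩
  have h2 := hS n
  have h3 := hS (-n)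
  rw [neg_neg] at h3
  push_cast at h3
  have hγ : ∀ n : ℤ, loopForm X e x (γ + n • h) = U n - X x * (X y + n * s) := by
    intro n
    rw [loopForm, ← add_assoc, ← hy, hU, H.weight_add_zsmul, hs]
  have h4 := hγ (-n)
  rw [neg_smul, ← sub_eq_add_neg] at h4
  rw [hγ, h4]
  push_cast
  linear_combination (h2 + h3) / 2

end System
end GenVir

/-! ### The parallelogram law -/

namespace GenVir

/-- A function that is quadratic on cyclic subgroups and has quadratic second differences satisfies
the parallelogram law. -/
theorem parallelogram_of_second_difference {F G : Type*} [Field F] [CharZero F] [AddCommGroup G]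
    {a : G → F} (hom : ∀ (u : G) (n : ℤ), a (n • u) = n ^ 2 * a u)
    (hd : ∀ u h : G, ∃ b c : F, ∀ n : ℤ, a (u + n • h) + a (u - n • h) = b * n ^ 2 + c)
    (u h : G) : a (u + h) + a (u - h) = 2 * a u + 2 * a h := by
  have quad : ∀ u h : G, a (u + (2 : ℤ) • h) + a (u - (2 : ℤ) • h) - 2 * a u
      = 4 * (a (u + h) + a (u - h) - 2 * a u) := by
    intro u h
    obtain ⟨b, c, hbc⟩ := hd u h
    have h0 := hbc 0
    have h1 := hbc 1
    have h2 := hbc 2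
    simp only [zero_smul, one_smul, add_zero, sub_zero] at h0 h1
    push_cast at h0 h1 h2
    linear_combination h2 - 4 * h1 + 3 * h0
  have e1 := quad u h
  have e4 := quad ((2 : ℤ) • h) u
  have neg : ∀ u v, a (u - v) = a (v - u) := by
    intro u v
    have := hom (v - u) (-1)
    rw [neg_smul, one_smul, neg_sub] at this
    rw [this]
    push_cast
    ring
  have d2 : ∀ v, a ((2 : ℤ) • v) = 4 * a v := fun v => by
    rw [hom]
    push_cast
    ring
  have f1 : a ((2 : ℤ) • h + (2 : ℤ) • u) = 4 * a (u + h) := by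
    rw [← smul_add, d2, add_comm]
  have f2 : a ((2 : ℤ) • h - (2 : ℤ) • u) = 4 * a (u - h) := by
    rw [← smul_sub, d2, neg]
  rw [f1, f2, d2] at e4
  rw [neg ((2 : ℤ) • h) u, add_comm _ u] at e4
  linear_combination (-1 / 3 : F) * e1 - e4 / 12

/-- A function satisfying the parallelogram law is a quadratic polynomial on each plane. -/
theorem quadratic_of_parallelogram {F G : Type*} [Field F] [CharZero F] [AddCommGroup G]
    {a : G → F} (ha : ∀ u h : G, a (u + h) + a (u - h) = 2 * a u + 2 * a h) (u h : G) (q k : ℤ) :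
    a (q • u + k • h) = q ^ 2 * a u + q * k * (a (u + h) - a u - a h) + k ^ 2 * a h := by
  have a0 : a 0 = 0 := by
    have := ha 0 0
    rw [add_zero, sub_zero] at this
    linear_combination -this / 2
  have line : ∀ (u h : G) (k : ℤ),
      a (u + k • h) = a u + k * (a (u + h) - a u - a h) + k ^ 2 * a h := by
    intro u h
    have up : ∀ k : ℤ, a (u + (k + 1) • h) + a (u + (k - 1) • h)
        = 2 * a (u + k • h) + 2 * a h := by
      intro k
      rw [← ha, add_smul, sub_smul, one_smul, add_assoc, add_sub_assoc]
    suffices H : ∀ k : ℕ, (a (u + (k : ℤ) • h) = a u + k * (a (u + h) - a u - a h) + k ^ 2 * a h) ∧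
        (a (u + ((k : ℤ) + 1) • h)
          = a u + (k + 1) * (a (u + h) - a u - a h) + (k + 1) ^ 2 * a h) ∧
        (a (u + (-(k : ℤ)) • h) = a u - k * (a (u + h) - a u - a h) + k ^ 2 * a h) ∧
        (a (u + (-(k : ℤ) - 1) • h)
          = a u - (k + 1) * (a (u + h) - a u - a h) + (k + 1) ^ 2 * a h) by
      intro k
      obtain ⟨m, rfl | rfl⟩ := k.eq_nat_or_neg
      · rw [(H m).1]
        push_cast
        ring
      · rw [(H m).2.2.1]
        push_cast
        ring
    intro k
    induction k with
    | zero =>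
      have := ha u h
      simp only [Nat.cast_zero, neg_zero, zero_add, zero_sub, zero_smul, one_smul, neg_smul,
        add_zero, ← sub_eq_add_neg]
      refine ⟨by ring, by ring, by ring, by linear_combination this⟩
    | succ m ih =>
      obtain ⟨h1, h2, h3, h4⟩ := ih
      have h5 := up (m + 1)
      have h6 := up (-(m : ℤ) - 1)
      rw [add_sub_cancel_right, h1, h2] at h5
      rw [sub_add_cancel, h3, h4] at h6
      push_cast
      rw [neg_add', h2, h4]
      refine ⟨by ring, by linear_combination h5, by ring, by linear_combination h6⟩
  have h1 := line (q • u) h k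
  have h2 := line h u q
  have h3 := line 0 u q
  rw [zero_add, zero_add, a0] at h3
  rw [h1, add_comm (q • u) h, h2, h3, add_comm h u]
  ring

namespace System

variable {F G : Type*} [Field F] [CharZero F] [AddCommGroup G] {X : G → F} {e : G → G → F}

theorem loopForm_parallelogram (H : System X e) (x u h : G) :
    loopForm X e x (u + h) + loopForm X e x (u - h)
      = 2 * loopForm X e x u + 2 * loopForm X e x h := by
  refine parallelogram_of_second_difference (H.loopForm_zsmul x) (fun u h => ?_) u h
  by_cases hh : h = 0
  · exact ⟨0, 2 * loopForm X e x u, fun n => by rw [hh, smul_zero, add_zero, sub_zero]; ring⟩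
  · exact H.exists_loopForm_add_loopForm x u hh

end System
end GenVir

/-! ### Relations between neighbouring triangles -/

namespace GenVir

/-- Consequences of the relations between the loops in the three triangles that have an edge in
common with the triangle at the weights `x`, `x + w`, `x + w + y`, where `y` runs through an
arithmetic progression. They are the values of polynomial identities at `y = w`, `-w / 2`, `-2 w`,
where one of the three reflections fixes the triangle. Here `G` is the sum of the two values of the
triangle `x`, `x + w`, `x + w + y`. -/
theorem neighbour_relations {F : Type*} [Field F] [CharZero F] {x w B b q₁ q₀ r₁ r₀ c s : F}
    (hw : w ≠ 0) (hB : B ≠ 0) (hs : s ≠ 0) (G : ℕ → F)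
    (h₁ : ∀ (n : ℕ) (y : F), y = c + n * s →
      (x * (x + w + y) + (B * (w + y) ^ 2 + q₁ * (w + y) + q₀))
      * ((x * (x + w) + B * w ^ 2) * ((x + w) * (x + w + y) + (B * y ^ 2 + r₁ * y + r₀))
        + (w - y) ^ 2 * (x * (x + w + y) + (B * (w + y) ^ 2 + q₁ * (w + y) + q₀))
        - (x * (x + y) + (B * y ^ 2 + q₁ * y + q₀)) * ((x + y) * (x + y + w) + b * w ^ 2)
        - (w - y) * G n) = 0)
    (h₂ : ∀ (n : ℕ) (y : F), y = c + n * s →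
      (x * (x + w + y) + (B * (w + y) ^ 2 + q₁ * (w + y) + q₀))
        * ((x + w) * (x + w + y) + (B * y ^ 2 + r₁ * y + r₀))
        + (2 * y + w) ^ 2 * (x * (x + w) + B * w ^ 2)
        - (x * (x - y) + (B * y ^ 2 + q₁ * y + q₀))
          * ((x + w) * (x - y) + (B * (w + y) ^ 2 + r₁ * (w + y) + r₀))
        - (2 * y + w) * G n = 0)
    (h₃ : ∀ (n : ℕ) (y : F), y = c + n * s →
      ((x + w) * (x + w + y) + (B * y ^ 2 + r₁ * y + r₀))
      * ((x * (x + w) + B * w ^ 2) * (x * (x + w + y) + (B * (w + y) ^ 2 + q₁ * (w + y) + q₀))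
        + (2 * w + y) ^ 2 * ((x + w) * (x + w + y) + (B * y ^ 2 + r₁ * y + r₀))
        - ((x + w) * (x + 2 * w + y) + (B * (w + y) ^ 2 + r₁ * (w + y) + r₀))
          * ((x + w + y) * (x + 2 * w + y) + b * w ^ 2)
        + (2 * w + y) * G n) = 0) :
    (x * (x + w) + B * w ^ 2) * ((x + w) * (x + 2 * w) + (B * w ^ 2 + r₁ * w + r₀))
      = (x * (x + w) + B * w ^ 2 + q₁ * w + q₀) * ((x + w) * (x + 2 * w) + b * w ^ 2) ∧
    q₁ * ((x + w) * (x + w / 2) + B * w ^ 2 / 4 + r₀)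
      = r₁ * (x * (x + w / 2) + B * w ^ 2 / 4 + q₀) ∧
    (x * (x + w) + B * w ^ 2) * (x * (x - w) + (B * w ^ 2 - q₁ * w + q₀))
      = (x * (x + w) + B * w ^ 2 - r₁ * w + r₀) * (x * (x - w) + b * w ^ 2) := by
  let Y : Polynomial F := Polynomial.X
  let C : F → Polynomial F := fun a => Polynomial.C a
  let g : Polynomial F := C x * (C (x + w) + Y) + (C B * (C w + Y) ^ 2 + C q₁ * (C w + Y) + C q₀)
  let r : Polynomial F := C (x + w) * (C (x + w) + Y) + (C B * Y ^ 2 + C r₁ * Y + C r₀)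
  let t : F := x * (x + w) + B * w ^ 2
  let K₁ : Polynomial F := C t * r + (C w - Y) ^ 2 * g
    - (C x * (C x + Y) + (C B * Y ^ 2 + C q₁ * Y + C q₀))
      * ((C x + Y) * (C (x + w) + Y) + C (b * w ^ 2))
  let K₂ : Polynomial F := g * r + (2 * Y + C w) ^ 2 * C t
    - (C x * (C x - Y) + (C B * Y ^ 2 + C q₁ * Y + C q₀))
      * (C (x + w) * (C x - Y) + (C B * (C w + Y) ^ 2 + C r₁ * (C w + Y) + C r₀))
  let K₃ : Polynomial F := C t * g + (C (2 * w) + Y) ^ 2 * r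
    - (C (x + w) * (C (x + 2 * w) + Y) + (C B * (C w + Y) ^ 2 + C r₁ * (C w + Y) + C r₀))
      * ((C (x + w) + Y) * (C (x + 2 * w) + Y) + C (b * w ^ 2))
  have hY : ∀ y : F, Polynomial.eval y Y = y := fun y => Polynomial.eval_X
  have hC : ∀ a y : F, Polynomial.eval y (C a) = a := fun a y => Polynomial.eval_C
  have h2 : ∀ y : F, Polynomial.eval y (2 : Polynomial F) = 2 := fun y => by simp
  have hg : ∀ y, g.eval y = x * (x + w + y) + (B * (w + y) ^ 2 + q₁ * (w + y) + q₀) := by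
    intro y
    simp only [g, Polynomial.eval_add, Polynomial.eval_mul, Polynomial.eval_pow, hY, hC]
  have hr : ∀ y, r.eval y = (x + w) * (x + w + y) + (B * y ^ 2 + r₁ * y + r₀) := by
    intro y
    simp only [r, Polynomial.eval_add, Polynomial.eval_mul, Polynomial.eval_pow, hY, hC]
  have hg0 : g ≠ 0 := by
    intro h
    have e0 := hg 0
    have e1 := hg 1
    have e2 := hg (-1)
    rw [h, Polynomial.eval_zero] at e0 e1 e2
    exact hB (by linear_combination e0 - e1 / 2 - e2 / 2)
  have hr0 : r ≠ 0 := by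
    intro h
    have e0 := hr 0
    have e1 := hr 1
    have e2 := hr (-1)
    rw [h, Polynomial.eval_zero] at e0 e1 e2
    exact hB (by linear_combination e0 - e1 / 2 - e2 / 2)
  have hK₁ : ∀ y, K₁.eval y = t * r.eval y + (w - y) ^ 2 * g.eval y
      - (x * (x + y) + (B * y ^ 2 + q₁ * y + q₀)) * ((x + y) * (x + w + y) + b * w ^ 2) := by
    intro y
    simp only [K₁, Polynomial.eval_add, Polynomial.eval_sub, Polynomial.eval_mul,
      Polynomial.eval_pow, hY, hC]
  have hK₂ : ∀ y, K₂.eval y = g.eval y * r.eval y + (2 * y + w) ^ 2 * t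
      - (x * (x - y) + (B * y ^ 2 + q₁ * y + q₀))
        * ((x + w) * (x - y) + (B * (w + y) ^ 2 + r₁ * (w + y) + r₀)) := by
    intro y
    simp only [K₂, Polynomial.eval_add, Polynomial.eval_sub, Polynomial.eval_mul,
      Polynomial.eval_pow, hY, hC, h2]
  have hK₃ : ∀ y, K₃.eval y = t * g.eval y + (2 * w + y) ^ 2 * r.eval y
      - ((x + w) * (x + 2 * w + y) + (B * (w + y) ^ 2 + r₁ * (w + y) + r₀))
        * ((x + w + y) * (x + 2 * w + y) + b * w ^ 2) := by
    intro y
    simp only [K₃, Polynomial.eval_add, Polynomial.eval_sub, Polynomial.eval_mul,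
      Polynomial.eval_pow, hY, hC]
  have z₁₂ : (2 * Y + C w) * K₁ - (C w - Y) * K₂ = 0 := by
    refine (mul_eq_zero.mp (?_ : g * _ = 0)).resolve_left hg0
    refine polynomial_eq_zero_of_shifted_progression (c := c) hs fun n => ?_
    obtain ⟨y, hy⟩ : ∃ y, y = c + n * s := ⟨_, rfl⟩
    have e1 := h₁ n y hy
    have e2 := h₂ n y hy
    rw [← hg, ← hr] at e1 e2
    rw [← hy]
    simp only [Polynomial.eval_sub, Polynomial.eval_mul, Polynomial.eval_add, hY, hC, h2, hK₁, hK₂]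
    linear_combination (2 * y + w) * e1 - g.eval y * (w - y) * e2
  have z₁₃ : (C (2 * w) + Y) * K₂ + (2 * Y + C w) * K₃ = 0 := by
    refine (mul_eq_zero.mp (?_ : r * _ = 0)).resolve_left hr0
    refine polynomial_eq_zero_of_shifted_progression (c := c) hs fun n => ?_
    obtain ⟨y, hy⟩ : ∃ y, y = c + n * s := ⟨_, rfl⟩
    have e1 := h₃ n y hy
    have e2 := h₂ n y hy
    rw [← hg, ← hr] at e1 e2
    rw [← hy]
    simp only [Polynomial.eval_mul, Polynomial.eval_add, hY, hC, h2, hK₃, hK₂]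
    linear_combination (2 * y + w) * e1 + r.eval y * (2 * w + y) * e2
  have a₁ := congrArg (Polynomial.eval w) z₁₂
  have a₂ := congrArg (Polynomial.eval (-w / 2)) z₁₂
  have a₃ := congrArg (Polynomial.eval (-2 * w)) z₁₃
  simp only [Polynomial.eval_sub, Polynomial.eval_mul, Polynomial.eval_add, hY, hC, h2,
    Polynomial.eval_zero, hK₁, hK₂, hK₃, hg, hr] at a₁ a₂ a₃
  have hw3 : 3 * w ≠ 0 := mul_ne_zero (by norm_num) hw
  have hw2 : w ^ 2 ≠ 0 := pow_ne_zero 2 hw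
  refine ⟨mul_left_cancel₀ hw3 ?_, mul_left_cancel₀ hw2 ?_, mul_left_cancel₀ hw3 ?_⟩
  · linear_combination a₁
  · linear_combination (-2 / 3 : F) * a₂
  · linear_combination -a₃

/-- The relations of `neighbour_relations`, for all multiples of a direction, exclude a deviation
`d₁`, `d₀` of the quadratic form from the square of the weight. -/
theorem deviation_eq_zero {F : Type*} [Field F] [CharZero F] {x w B d₁ d₀ d₁' d₀' : F} (hx : x ≠ 0)
    (hw : w ≠ 0) (hB : B ≠ 0) (n₁ : x * (x + w) + B * w ^ 2 ≠ 0)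
    (n₂ : 2 * x + w ≠ 0) (n₃ : x * (x + w) - B * w ^ 2 ≠ 0)
    (h : ∀ q : ℤ, ∃ b : F,
      (x * (x + w) + B * w ^ 2) * ((x + w) * (x + 2 * w) + (B * w ^ 2 + q * d₁' * w + q ^ 2 * d₀'))
        = (x * (x + w) + B * w ^ 2 + q * d₁ * w + q ^ 2 * d₀)
          * ((x + w) * (x + 2 * w) + b * w ^ 2) ∧
      q * d₁ * ((x + w) * (x + w / 2) + B * w ^ 2 / 4 + q ^ 2 * d₀')
        = q * d₁' * (x * (x + w / 2) + B * w ^ 2 / 4 + q ^ 2 * d₀) ∧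
      (x * (x + w) + B * w ^ 2) * (x * (x - w) + (B * w ^ 2 - q * d₁ * w + q ^ 2 * d₀))
        = (x * (x + w) + B * w ^ 2 - q * d₁' * w + q ^ 2 * d₀') * (x * (x - w) + b * w ^ 2)) :
    d₁ = 0 ∧ d₀ = 0 := by
  obtain ⟨t, ht⟩ : ∃ t, t = x * (x + w) + B * w ^ 2 := ⟨_, rfl⟩
  rw [← ht] at n₁
  have key : ∀ q : ℤ, t * ((x + w) * (x + 2 * w) + (B * w ^ 2 + q * d₁' * w + q ^ 2 * d₀'))
        * (t - q * d₁' * w + q ^ 2 * d₀')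
      - t * (x * (x - w) + (B * w ^ 2 - q * d₁ * w + q ^ 2 * d₀)) * (t + q * d₁ * w + q ^ 2 * d₀)
      = ((x + w) * (x + 2 * w) - x * (x - w)) * (t + q * d₁ * w + q ^ 2 * d₀)
        * (t - q * d₁' * w + q ^ 2 * d₀') := by
    intro q
    obtain ⟨b, h1, -, h3⟩ := h q
    rw [← ht] at h1 h3
    linear_combination (t - q * d₁' * w + q ^ 2 * d₀') * h1 - (t + q * d₁ * w + q ^ 2 * d₀) * h3
  have k1 := key 1
  have k2 := key (-1)
  have k3 := key 2
  have k4 := key (-2)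
  obtain ⟨_, -, l1, -⟩ := h 1
  obtain ⟨_, -, l2, -⟩ := h 2
  push_cast at k1 k2 k3 k4 l1 l2
  -- the coefficient of `q` in `key`
  have c1 : d₁' * x = d₁ * (x + w) := by
    refine mul_left_cancel₀ (mul_ne_zero (mul_ne_zero n₁ hw) hw) ?_
    subst ht
    linear_combination (k1 - k2) / 3 - (k3 - k4) / 24
  have c2 : d₁ * ((x + w) * (x + w / 2) + B * w ^ 2 / 4)
      = d₁' * (x * (x + w / 2) + B * w ^ 2 / 4) := by
    linear_combination (8 * l1 - l2) / 6
  have hd₁ : d₁ = 0 := by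
    have : B * w ^ 3 * d₁ = 0 := by
      linear_combination -4 * x * c2 - 4 * (x * (x + w / 2) + B * w ^ 2 / 4) * c1
    exact (mul_eq_zero.mp this).resolve_left (mul_ne_zero hB (pow_ne_zero 3 hw))
  have hd₁' : d₁' = 0 := by
    rw [hd₁, zero_mul] at c1
    exact (mul_eq_zero.mp c1).resolve_right hx
  refine ⟨hd₁, ?_⟩
  rw [hd₁, hd₁'] at k1 k3
  -- the coefficients of `q ^ 2` and `q ^ 4` in `key`
  have c3 : d₀' * (x ^ 2 + B * w ^ 2) = d₀ * ((x + w) ^ 2 + B * w ^ 2) := by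
    refine mul_left_cancel₀ n₁ ?_
    subst ht
    linear_combination (16 * k1 - k3) / 24
  have c4 : t * (d₀' ^ 2 - d₀ ^ 2) = 2 * w * (2 * x + w) * d₀ * d₀' := by
    subst ht
    linear_combination (k3 - 4 * k1) / 12
  by_contra hd₀
  refine mul_ne_zero (mul_ne_zero (pow_ne_zero 2 hd₀) (pow_ne_zero 3 hw)) (mul_ne_zero n₂ n₃) ?_
  obtain ⟨P, hP⟩ : ∃ P, P = x ^ 2 + B * w ^ 2 := ⟨_, rfl⟩
  obtain ⟨Q, hQ⟩ : ∃ Q, Q = (x + w) ^ 2 + B * w ^ 2 := ⟨_, rfl⟩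
  have e1 : t = P + x * w := by rw [ht, hP]; ring
  have e2 : Q = P + w * (2 * x + w) := by rw [hQ, hP]; ring
  have e3 : B * w ^ 2 = P - x ^ 2 := by rw [hP]; ring
  rw [← hP, ← hQ] at c3
  rw [e3]
  rw [e2] at c3
  rw [e1] at c4
  linear_combination P ^ 2 * c4 - (P + x * w) * (d₀' * P + d₀ * (P + w * (2 * x + w))) * c3
    + 2 * w * (2 * x + w) * d₀ * P * c3

end GenVir

/-! ### Loops of length two on the whole group -/

namespace GenVir
namespace System

variable {F G : Type*} [Field F] [CharZero F] [AddCommGroup G] {X : G → F} {e : G → G → F}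

omit [CharZero F] in
/-- The loops in the triangle that is obtained by reflecting `v` in the midpoint of the edge
`u w`. The parameter `g` is the sum of the two values of the triangle `u`, `v`, `w`. -/
theorem reflect_loops (H : System X e) {u v v' w : G} (h : v + v' = u + w) {g : F}
    (hg : g = e u v * e v w * e w u + e v u * e w v * e u w) :
    (e u w * e w u) * ((e u v * e v u) * (e v w * e w v) + (X v - X v') ^ 2 * (e u w * e w u)
      - (e u v' * e v' u) * (e v' w * e w v') - (X v - X v') * g) = 0 := by
  have h1 := H.comm u v v' w h
  have h2 := H.comm w v v' u (by rw [h, add_comm])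
  rw [hg]
  have h3 : e u v' * e v' w = e u v * e v w - (X v - X v') * e u w := by linear_combination -h1
  have h4 : e w v' * e v' u = e w v * e v u - (X v - X v') * e w u := by linear_combination -h2
  have h5 : e u v' * e v' u * (e v' w * e w v') = (e u v' * e v' w) * (e w v' * e v' u) := by ring
  rw [h5, h3, h4]
  ring

omit [CharZero F] in
theorem loop_eq (X : G → F) (e : G → G → F) (u v : G) :
    e u v * e v u = X u * X v + loopForm X e u (v - u) := by
  rw [loopForm, add_sub_cancel]
  ring

/-- On a plane, `loopForm` is a multiple of the square of the weight up to a deviation `d₁`, `d₀`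
that vanishes in the direction `h`. -/
theorem loopForm_eq_of_line (H : System X e) {h : G} (hh : h ≠ 0) (x γ : G) :
    ∃ d₁ d₀ : F, ∀ q k : ℤ, loopForm X e x (q • γ + k • h)
      = loopForm X e x h / (X h - X 0) ^ 2 * (q * (X γ - X 0) + k * (X h - X 0)) ^ 2
        + q * d₁ * (q * (X γ - X 0) + k * (X h - X 0)) + q ^ 2 * d₀ := by
  have hs := H.step_ne_zero hh
  obtain ⟨s, hs'⟩ : ∃ s, s = X h - X 0 := ⟨_, rfl⟩
  obtain ⟨t, ht⟩ : ∃ t, t = X γ - X 0 := ⟨_, rfl⟩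
  obtain ⟨b, hb⟩ : ∃ b, b = loopForm X e x (γ + h) - loopForm X e x γ - loopForm X e x h :=
    ⟨_, rfl⟩
  rw [← hs'] at hs
  refine ⟨b / s - 2 * (loopForm X e x h / s ^ 2) * t,
    loopForm X e x γ + loopForm X e x h / s ^ 2 * t ^ 2 - b / s * t, fun q k => ?_⟩
  rw [quadratic_of_parallelogram (H.loopForm_parallelogram x), ← hs', ← ht, ← hb]
  field_simp
  ring

theorem loopForm_add_zsmul (H : System X e) (x h : G) (m : ℤ) :
    loopForm X e (x + m • h) h = loopForm X e x h := by
  by_cases hh : h = 0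
  · rw [hh, smul_zero, add_zero]
  obtain ⟨B, hB⟩ := H.exists_pairing_on_line hh x
  have h1 := hB m (m + 1)
  have h2 := hB 0 1
  rw [add_smul, one_smul, ← add_assoc] at h1
  simp only [zero_smul, one_smul, add_zero, pairing] at h1 h2
  rw [loopForm, loopForm, h1, h2, H.weight_add (x + m • h) h, H.weight_add x h]
  ring

/-- At a vector of nonzero weight, `loopForm` is a multiple of the square of the weight. -/
theorem loopForm_eq_of_ne_zero (H : System X e) {x h : G} (hx : X x ≠ 0)
    (hh : loopForm X e x h ≠ 0) (γ : G) :
    loopForm X e x γ = loopForm X e x h / (X h - X 0) ^ 2 * (X γ - X 0) ^ 2 := by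
  have hh0 : h ≠ 0 := by
    rintro rfl
    exact hh (by rw [loopForm, add_zero, H.diag]; ring)
  have hs := H.step_ne_zero hh0
  obtain ⟨s, hs'⟩ : ∃ s, s = X h - X 0 := ⟨_, rfl⟩
  obtain ⟨t, ht⟩ : ∃ t, t = X γ - X 0 := ⟨_, rfl⟩
  rw [← hs'] at hs
  obtain ⟨B, hB⟩ : ∃ B, B = loopForm X e x h / s ^ 2 := ⟨_, rfl⟩
  have hB0 : B ≠ 0 := by
    rw [hB]
    exact div_ne_zero hh (pow_ne_zero 2 hs)
  have hBs : loopForm X e x h = B * s ^ 2 := by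
    rw [hB]
    field_simp
  -- a multiple of `h` for which the finitely many exceptional configurations do not occur
  obtain ⟨j, hj⟩ : ∃ j : ℕ, (j * s : F) ≠ 0 ∧ X x * (X x + j * s) + B * (j * s) ^ 2 ≠ 0 ∧
      2 * X x + j * s ≠ 0 ∧ X x * (X x + j * s) - B * (j * s) ^ 2 ≠ 0 := by
    by_contra! hne
    let Y : Polynomial F := Polynomial.X
    let C : F → Polynomial F := fun a => Polynomial.C a
    have h0 : Y * (C (X x) * (C (X x) + Y) + C B * Y ^ 2) * (C (2 * X x) + Y)
        * (C (X x) * (C (X x) + Y) - C B * Y ^ 2) = 0 := by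
      refine polynomial_eq_zero_of_progression hs fun n => ?_
      simp only [Y, C, Polynomial.eval_mul, Polynomial.eval_add, Polynomial.eval_sub,
        Polynomial.eval_pow, Polynomial.eval_C, Polynomial.eval_X]
      by_cases e1 : (n * s : F) = 0
      · rw [e1]; ring
      by_cases e2 : X x * (X x + n * s) + B * (n * s) ^ 2 = 0
      · rw [e2]; ring
      by_cases e3 : 2 * X x + n * s = 0
      · rw [e3]; ring
      rw [hne n e1 e2 e3]; ring
    have hev : ∀ P : Polynomial F, P.eval 0 ≠ 0 → P ≠ 0 := by
      rintro P hP rfl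
      exact hP Polynomial.eval_zero
    refine mul_ne_zero (mul_ne_zero (mul_ne_zero Polynomial.X_ne_zero (hev _ ?_)) (hev _ ?_))
      (hev _ ?_) h0 <;>
    simp [Y, C, hx]
  obtain ⟨hw, n₁, n₂, n₃⟩ := hj
  obtain ⟨w, hw'⟩ : ∃ w : F, w = j * s := ⟨_, rfl⟩
  rw [← hw'] at hw n₁ n₂ n₃
  obtain ⟨v, hv⟩ : ∃ v, v = x + (j : ℤ) • h := ⟨_, rfl⟩
  have hXv : X v = X x + w := by
    rw [hv, H.weight_add_zsmul, hw', hs']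
    push_cast
    ring
  obtain ⟨d₁, d₀, hd⟩ := H.loopForm_eq_of_line hh0 x γ
  obtain ⟨d₁', d₀', hd'⟩ := H.loopForm_eq_of_line hh0 v γ
  rw [← hs', ← ht, ← hB] at hd
  rw [hv, H.loopForm_add_zsmul, ← hs', ← ht, ← hB, ← hv] at hd'
  obtain ⟨h1, h0⟩ : d₁ = 0 ∧ d₀ = 0 := by
    refine deviation_eq_zero hx hw hB0 n₁ n₂ n₃ (d₁' := d₁') (d₀' := d₀') fun q => ?_
    obtain ⟨b, hb⟩ : ∃ b, b = loopForm X e (x + q • γ) h / s ^ 2 := ⟨_, rfl⟩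
    have hbs : loopForm X e (x + q • γ) h = b * s ^ 2 := by
      rw [hb]
      field_simp
    -- the vertices of the triangle and their reflections
    obtain ⟨z, hz⟩ : ∃ z : ℕ → G, ∀ n, z n = x + q • γ + ((n : ℤ) + j) • h := ⟨_, fun _ => rfl⟩
    obtain ⟨z₁, hz₁⟩ : ∃ z : ℕ → G, ∀ n, z n = x + q • γ + (n : ℤ) • h := ⟨_, fun _ => rfl⟩
    obtain ⟨z₂, hz₂⟩ : ∃ z : ℕ → G, ∀ n, z n = x - (q • γ + (n : ℤ) • h) := ⟨_, fun _ => rfl⟩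
    obtain ⟨z₃, hz₃⟩ : ∃ z : ℕ → G, ∀ n, z n = x + q • γ + ((n : ℤ) + j + j) • h :=
      ⟨_, fun _ => rfl⟩
    have hX : ∀ (q' k : ℤ) (u : G), X (u + (q' • γ + k • h)) = X u + (q' * t + k * s) := by
      intro q' k u
      rw [← add_assoc, H.weight_add_zsmul, H.weight_add_zsmul, hs', ht]
      ring
    have Xz : ∀ (n : ℕ) (y : F), y = q * t + n * s → X (z n) = X x + w + y := by
      intro n y hy
      rw [hz, add_assoc, hX, hy, hw']
      push_cast
      ring
    have Xz₁ : ∀ (n : ℕ) (y : F), y = q * t + n * s → X (z₁ n) = X x + y := by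
      intro n y hy
      rw [hz₁, add_assoc, hX, hy]
      push_cast
      ring
    have Xz₂ : ∀ (n : ℕ) (y : F), y = q * t + n * s → X (z₂ n) = X x - y := by
      intro n y hy
      have := hX (-q) (-n) x
      rw [neg_smul, neg_smul, ← neg_add, ← sub_eq_add_neg] at this
      rw [hz₂, this, hy]
      push_cast
      ring
    have Xz₃ : ∀ (n : ℕ) (y : F), y = q * t + n * s → X (z₃ n) = X x + 2 * w + y := by
      intro n y hy
      rw [hz₃, add_assoc, hX, hy, hw']
      push_cast
      ring
    have tv : e x v * e v x = X x * (X x + w) + B * w ^ 2 := by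
      rw [loop_eq X e, hXv, hv, add_sub_cancel_left, H.loopForm_zsmul, hBs, hw']
      push_cast
      ring
    have qx : ∀ (n : ℕ) (y : F), y = q * t + n * s →
        loopForm X e x (q • γ + (n : ℤ) • h) = B * y ^ 2 + q * d₁ * y + q ^ 2 * d₀ := by
      intro n y hy
      rw [hd, hy]
      push_cast
      rfl
    have qxw : ∀ (n : ℕ) (y : F), y = q * t + n * s →
        loopForm X e x (q • γ + ((n : ℤ) + j) • h)
          = B * (w + y) ^ 2 + q * d₁ * (w + y) + q ^ 2 * d₀ := by
      intro n y hy
      rw [hd, hy, hw']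
      push_cast
      ring
    have qv : ∀ (n : ℕ) (y : F), y = q * t + n * s →
        loopForm X e v (q • γ + (n : ℤ) • h) = B * y ^ 2 + q * d₁' * y + q ^ 2 * d₀' := by
      intro n y hy
      rw [hd', hy]
      push_cast
      rfl
    have qvw : ∀ (n : ℕ) (y : F), y = q * t + n * s →
        loopForm X e v (q • γ + ((n : ℤ) + j) • h)
          = B * (w + y) ^ 2 + q * d₁' * (w + y) + q ^ 2 * d₀' := by
      intro n y hy
      rw [hd', hy, hw']
      push_cast
      ring
    have par : ∀ k : ℤ, loopForm X e (x + q • γ + k • h) ((j : ℤ) • h) = b * w ^ 2 := by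
      intro k
      rw [H.loopForm_zsmul, H.loopForm_add_zsmul, hbs, hw']
      push_cast
      ring
    -- the loops along the edges of the four triangles
    have l₁ : ∀ (n : ℕ) (y : F), y = q * t + n * s → e x (z n) * e (z n) x
        = X x * (X x + w + y) + (B * (w + y) ^ 2 + q * d₁ * (w + y) + q ^ 2 * d₀) := by
      intro n y hy
      rw [loop_eq X e, Xz n y hy, hz, add_assoc x, add_sub_cancel_left, qxw n y hy]
    have l₂ : ∀ (n : ℕ) (y : F), y = q * t + n * s → e v (z n) * e (z n) v
        = (X x + w) * (X x + w + y) + (B * y ^ 2 + q * d₁' * y + q ^ 2 * d₀') := by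
      intro n y hy
      rw [loop_eq X e, Xz n y hy, hXv, ← qv n y hy, hz, hv, add_smul]
      congr 2
      abel
    have l₃ : ∀ (n : ℕ) (y : F), y = q * t + n * s → e x (z₁ n) * e (z₁ n) x
        = X x * (X x + y) + (B * y ^ 2 + q * d₁ * y + q ^ 2 * d₀) := by
      intro n y hy
      rw [loop_eq X e, Xz₁ n y hy, hz₁, add_assoc x, add_sub_cancel_left, qx n y hy]
    have l₄ : ∀ (n : ℕ) (y : F), y = q * t + n * s → e (z₁ n) (z n) * e (z n) (z₁ n)
        = (X x + y) * (X x + y + w) + b * w ^ 2 := by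
      intro n y hy
      rw [loop_eq X e, Xz₁ n y hy, Xz n y hy, ← par n, hz, hz₁, add_smul, ← add_assoc,
        add_sub_cancel_left]
      ring
    have l₅ : ∀ (n : ℕ) (y : F), y = q * t + n * s → e x (z₂ n) * e (z₂ n) x
        = X x * (X x - y) + (B * y ^ 2 + q * d₁ * y + q ^ 2 * d₀) := by
      intro n y hy
      rw [loop_eq X e, Xz₂ n y hy, hz₂, sub_sub_cancel_left, H.loopForm_neg, qx n y hy]
    have l₆ : ∀ (n : ℕ) (y : F), y = q * t + n * s → e v (z₂ n) * e (z₂ n) v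
        = (X x + w) * (X x - y) + (B * (w + y) ^ 2 + q * d₁' * (w + y) + q ^ 2 * d₀') := by
      intro n y hy
      rw [loop_eq X e, Xz₂ n y hy, hXv, ← qvw n y hy, ← H.loopForm_neg, hz₂, hv, add_smul]
      congr 2
      abel
    have l₇ : ∀ (n : ℕ) (y : F), y = q * t + n * s → e v (z₃ n) * e (z₃ n) v
        = (X x + w) * (X x + 2 * w + y)
          + (B * (w + y) ^ 2 + q * d₁' * (w + y) + q ^ 2 * d₀') := by
      intro n y hy
      rw [loop_eq X e, Xz₃ n y hy, hXv, ← qvw n y hy, hz₃, hv, add_smul _ (j : ℤ)]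
      congr 2
      abel
    have l₈ : ∀ (n : ℕ) (y : F), y = q * t + n * s → e (z n) (z₃ n) * e (z₃ n) (z n)
        = (X x + w + y) * (X x + 2 * w + y) + b * w ^ 2 := by
      intro n y hy
      rw [loop_eq X e, Xz n y hy, Xz₃ n y hy, ← par (n + j), hz, hz₃,
        add_smul ((n : ℤ) + j) (j : ℤ) h, ← add_assoc, add_sub_cancel_left]
    obtain ⟨g, hg⟩ : ∃ g : ℕ → F, ∀ n,
        g n = e x v * e v (z n) * e (z n) x + e v x * e (z n) v * e x (z n) := ⟨_, fun _ => rfl⟩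
    refine ⟨b, ?_⟩
    obtain ⟨a1, a2, a3⟩ := neighbour_relations (x := X x) (w := w) (B := B) (b := b)
      (q₁ := q * d₁) (q₀ := q ^ 2 * d₀) (r₁ := q * d₁') (r₀ := q ^ 2 * d₀') (c := q * t) (s := s)
      hw hB0 hs g
      (by
        intro n y hy
        have := H.reflect_loops (u := x) (v := v) (v' := z₁ n) (w := z n)
          (by rw [hv, hz₁, hz, add_smul]; abel) (hg n)
        rw [tv, l₁ n y hy, l₂ n y hy, l₃ n y hy, l₄ n y hy, hXv, Xz₁ n y hy] at this
        linear_combination this)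
      (by
        intro n y hy
        have := H.reflect_loops (u := x) (v := z n) (v' := z₂ n) (w := v) (g := g n)
          (by rw [hv, hz₂, hz, add_smul]; abel) (by rw [hg]; ring)
        rw [mul_comm (e (z n) v), mul_comm (e (z₂ n) v), tv, l₁ n y hy, l₂ n y hy, l₅ n y hy,
          l₆ n y hy, Xz n y hy, Xz₂ n y hy] at this
        have := (mul_eq_zero.mp this).resolve_left n₁
        linear_combination this)
      (by
        intro n y hy
        have := H.reflect_loops (u := v) (v := x) (v' := z₃ n) (w := z n) (g := g n)
          (by rw [hv, hz₃, hz, add_smul ((n : ℤ) + j) (j : ℤ) h, add_smul]; abel)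
          (by rw [hg]; ring)
        rw [mul_comm (e v x), mul_comm (e (z₃ n) (z n)), tv, l₁ n y hy, l₂ n y hy, l₇ n y hy,
          l₈ n y hy, Xz₃ n y hy] at this
        linear_combination this)
    exact ⟨by linear_combination a1, by linear_combination a2, by linear_combination a3⟩
  have := hd 1 0
  rw [h1, h0] at this
  push_cast at this
  rw [one_smul, zero_smul, add_zero] at this
  rw [this, hB, hs', ht]
  ring

/-- The loops of length two are those of a tensor density module. -/
theorem exists_pairing_eq (H : System X e) :
    ∃ B : F, ∀ u v, e u v * e v u = pairing B (X u) (X v) := by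
  have hloc : ∀ x, X x ≠ 0 → ∃ B : F, ∀ v, e x v * e v x = pairing B (X x) (X v) := by
    intro x hx
    have hform : ∃ B : F, ∀ γ, loopForm X e x γ = B * (X γ - X 0) ^ 2 := by
      by_cases hh : ∃ h, loopForm X e x h ≠ 0
      · obtain ⟨h, hh⟩ := hh
        exact ⟨_, H.loopForm_eq_of_ne_zero hx hh⟩
      · push Not at hh
        exact ⟨0, fun γ => by rw [hh, zero_mul]⟩
    obtain ⟨B, hB⟩ := hform
    refine ⟨B, fun v => ?_⟩
    rw [loop_eq X e, hB, H.weight_sub, pairing]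
    ring
  by_cases hne : ∃ x, X x ≠ 0
  swap
  · push Not at hne
    refine ⟨0, fun u v => ?_⟩
    rw [H.injective ((hne u).trans (hne v).symm), H.diag, hne v, pairing]
    ring
  obtain ⟨x, hx⟩ := hne
  obtain ⟨B, hB⟩ := hloc x hx
  have symm : ∀ u v, pairing B (X u) (X v) = pairing B (X v) (X u) := by
    intro u v
    simp only [pairing]
    ring
  have hall : ∀ u, X u ≠ 0 → ∀ v, e u v * e v u = pairing B (X u) (X v) := by
    intro u hu v
    obtain ⟨B', hB'⟩ := hloc u hu
    by_cases hux : X u = X x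
    · rw [H.injective hux, hB]
    · have h1 := hB u
      have h2 := hB' x
      rw [mul_comm, h1, pairing, pairing] at h2
      have h3 : (X u - X x) ^ 2 * (B - B') = 0 := by linear_combination h2
      have h4 := (mul_eq_zero.mp h3).resolve_left (pow_ne_zero 2 (sub_ne_zero.mpr hux))
      rw [sub_eq_zero.mp h4, hB']
  refine ⟨B, fun u v => ?_⟩
  by_cases hu : X u = 0
  · by_cases hv : X v = 0
    · rw [H.injective (hu.trans hv.symm), H.diag, hv, pairing]
      ring
    · rw [mul_comm, hall v hv, symm]
  · exact hall u hu v

end System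
end GenVir

/-! ### Modules in coordinates -/

namespace GenVir

/-- Two quotients of a Lie module by the same kernel are isomorphic. -/
theorem nonempty_equiv_of_ker_eq {R L P V T : Type*} [CommRing R] [LieRing L] [LieAlgebra R L]
    [AddCommGroup P] [Module R P] [LieRingModule L P]
    [AddCommGroup V] [Module R V] [LieRingModule L V]
    [AddCommGroup T] [Module R T] [LieRingModule L T]
    (p : P →ₗ⁅R,L⁆ V) (q : P →ₗ⁅R,L⁆ T) (hp : Function.Surjective p) (hq : Function.Surjective q)
    (h : ∀ x, p x = 0 ↔ q x = 0) : Nonempty (V ≃ₗ⁅R,L⁆ T) := by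
  have key : ∀ x y, p x = p y ↔ q x = q y := fun x y => by
    rw [← sub_eq_zero, ← map_sub, h, map_sub, sub_eq_zero]
  have hs : ∀ x, q (Function.surjInv hp (p x)) = q x := fun x =>
    (key _ _).mp (Function.surjInv_eq hp _)
  have ht : ∀ x, p (Function.surjInv hq (q x)) = p x := fun x =>
    (key _ _).mpr (Function.surjInv_eq hq _)
  exact ⟨
    { toFun := fun v => q (Function.surjInv hp v)
      map_add' := fun u v => by
        obtain ⟨u, rfl⟩ := hp u
        obtain ⟨v, rfl⟩ := hp v
        rw [← map_add, hs, hs, hs, map_add]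
      map_smul' := fun r v => by
        obtain ⟨v, rfl⟩ := hp v
        rw [← map_smul, hs, hs, map_smul, RingHom.id_apply]
      map_lie' := fun {x v} => by
        obtain ⟨v, rfl⟩ := hp v
        rw [← LieModuleHom.map_lie, hs, hs, LieModuleHom.map_lie]
      invFun := fun t => p (Function.surjInv hq t)
      left_inv := fun v => by
        obtain ⟨v, rfl⟩ := hp v
        change p (Function.surjInv hq (q (Function.surjInv hp (p v)))) = p v
        rw [hs, ht]
      right_inv := fun t => by
        obtain ⟨t, rfl⟩ := hq t
        change q (Function.surjInv hp (p (Function.surjInv hq (q t)))) = q t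
        rw [ht, hs] }⟩

theorem Vir.induction {F : Type*} [Field F] {M : AddSubgroup F} {p : Vir M → Prop}
    (add : ∀ x y, p x → p y → p (x + y)) (smul : ∀ (r : F) (x), p x → p (r • x))
    (hL : ∀ μ, p (Vir.L μ)) (hc : p (Vir.c M)) (x : Vir M) : p x := by
  have hL' : ∀ f : M →₀ F, p ((f, 0) : (M →₀ F) × F) := by
    intro f
    induction f using Finsupp.induction_linear with
    | zero =>
      have := smul 0 _ hc
      rwa [zero_smul] at this
    | add f g hf hg =>
      have := add _ _ hf hg
      have e : ((f + g, 0) : (M →₀ F) × F) = (f, 0) + (g, 0) := by simp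
      rw [e]
      exact this
    | single μ r =>
      have := smul r _ (hL μ)
      have e : ((Finsupp.single μ r, 0) : (M →₀ F) × F) = r • (Finsupp.single μ 1, 0) := by simp
      rw [e]
      exact this
  have e : x = ((x.1, 0) : (M →₀ F) × F) + x.2 • ((0, 1) : (M →₀ F) × F) := by
    refine Prod.ext ?_ ?_ <;> simp
  rw [e]
  exact add _ _ (hL' _) (smul _ _ hc)

section Coordinates

variable {F : Type*} [Field F] [CharZero F] {M : AddSubgroup F}
  {V : Type*} [AddCommGroup V] [Module F V] [LieRingModule (Vir M) V] [LieModule F (Vir M) V]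

/-- The vectors `w j`, up to those that are zero, form a basis of the `Vir[M]`-module `V`, with
`L_μ w_j = e j (μ + j) • w_{μ + j}` and `c w_j = 0`. -/
structure Coordinates (w : M → V) (e : M → M → F) : Prop where
  lie : ∀ μ j, ⁅(Vir.L μ : Vir M), w j⁆ = e j (μ + j) • w (μ + j)
  c_lie : ∀ j, ⁅Vir.c M, w j⁆ = 0
  span : Submodule.span F (Set.range w) = ⊤
  indep : ∀ (s : Finset M) (g : M → F), ∑ j ∈ s, g j • w j = 0 → ∀ j ∈ s, g j • w j = 0

namespace Coordinates

variable {w : M → V} {e : M → M → F}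

omit [LieModule F (Vir M) V] in
theorem linearCombination_eq_zero_iff (C : Coordinates w e) (f : M →₀ F) :
    Finsupp.linearCombination F w f = 0 ↔ ∀ j, f j • w j = 0 := by
  rw [Finsupp.linearCombination_apply, Finsupp.sum]
  refine ⟨fun h j => ?_, fun h => Finset.sum_eq_zero fun j _ => h j⟩
  by_cases hj : j ∈ f.support
  · exact C.indep _ _ h j hj
  · rw [Finsupp.notMem_support_iff.mp hj, zero_smul]

omit [LieModule F (Vir M) V] in
theorem linearCombination_surjective (C : Coordinates w e) :
    Function.Surjective (Finsupp.linearCombination F w) := by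
  rw [← LinearMap.range_eq_top, Finsupp.range_linearCombination, C.span]

/-- The surjection from the module with the same structure constants. -/
noncomputable def hom (C : Coordinates w e) (φ : Coeff M) (hφ : ∀ μ j, φ.φ μ j = e j (μ + j)) :
    CoeffModule φ →ₗ⁅F, Vir M⁆ V :=
  { (Finsupp.linearCombination F w : (M →₀ F) →ₗ[F] V) with
    map_lie' := by
      intro x m
      change Finsupp.linearCombination F w (⁅x, m⁆ : CoeffModule φ)
        = ⁅x, Finsupp.linearCombination F w m⁆
      let Φ : CoeffModule φ →ₗ[F] V := (Finsupp.linearCombination F w : (M →₀ F) →ₗ[F] V)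
      change Φ ⁅x, m⁆ = ⁅x, Φ m⁆
      have hv : ∀ j, Φ (CoeffModule.v φ j) = w j := fun j => by
        change Finsupp.linearCombination F w (Finsupp.single j 1) = w j
        simp
      have hm : m ∈ Submodule.span F (Set.range (CoeffModule.v φ)) := by
        have h : (m : M →₀ F) ∈ Finsupp.supported F F (Set.univ : Set M) := by
          rw [Finsupp.supported_univ]
          trivial
        rw [Finsupp.supported_eq_span_single, Set.image_univ] at h
        exact h
      induction hm using Submodule.span_induction with
      | zero => simp
      | add m n _ _ h₁ h₂ => simp only [lie_add, map_add, h₁, h₂]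
      | smul r m _ h => simp only [lie_smul, map_smul, h]
      | mem m hm =>
        obtain ⟨j, rfl⟩ := hm
        induction x using Vir.induction with
        | add x y hx hy => simp only [add_lie, map_add, hx, hy]
        | smul r x hx => simp only [smul_lie, map_smul, hx]
        | hL μ => rw [CoeffModule.L_lie_v, map_smul, hv, hv, C.lie, hφ]
        | hc => rw [CoeffModule.c_lie, map_zero, hv, C.c_lie] }

variable {T : Type*} [AddCommGroup T] [Module F T] [LieRingModule (Vir M) T]
  [LieModule F (Vir M) T] {X : M → F}

/-- Modules with the same structure constants, and the same missing vectors, are isomorphic. -/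
theorem nonempty_equiv {w' : M → T} (C : Coordinates w e) (C' : Coordinates w' e) (H : System X e)
    (hX : ∀ u v : M, X u - X v = (u : F) - v) (h : ∀ j, w j = 0 ↔ w' j = 0) :
    Nonempty (V ≃ₗ⁅F, Vir M⁆ T) := by
  let φ : Coeff M :=
    { φ := fun μ j => e j (μ + j)
      rel := fun μ ν k => by
        have h1 := H.comm k (ν + k) (μ + k) (μ + ν + k) (by abel)
        rw [hX] at h1
        rw [show μ + (ν + k) = μ + ν + k by abel, show ν + (μ + k) = μ + ν + k by abel]
        simp only [AddSubgroup.coe_add] at h1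
        linear_combination h1 }
  refine nonempty_equiv_of_ker_eq (C.hom φ fun _ _ => rfl) (C'.hom φ fun _ _ => rfl)
    C.linearCombination_surjective C'.linearCombination_surjective fun f => ?_
  have h1 := C.linearCombination_eq_zero_iff f
  have h2 := C'.linearCombination_eq_zero_iff f
  simp only [smul_eq_zero, ← h] at h1 h2
  exact h1.trans h2.symm

theorem rescale (C : Coordinates w e) {f : M → F} (hf : ∀ u, f u ≠ 0) :
    Coordinates (fun j => f j • w j) (fun u v => e u v * f u / f v) where
  lie μ j := by
    have := hf (μ + j)
    rw [lie_smul, C.lie, smul_smul, smul_smul]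
    congr 1
    field_simp
  c_lie j := by rw [lie_smul, C.c_lie, smul_zero]
  span := by
    rw [eq_top_iff, ← C.span, Submodule.span_le]
    rintro _ ⟨j, rfl⟩
    have h : f j • w j ∈ Submodule.span F (Set.range fun j => f j • w j) :=
      Submodule.subset_span ⟨j, rfl⟩
    have h' := Submodule.smul_mem _ (f j)⁻¹ h
    rwa [smul_smul, inv_mul_cancel₀ (hf j), one_smul] at h'
  indep s g hg j hj := by
    simp only [smul_smul] at hg ⊢
    exact C.indep s _ hg j hj

omit [LieModule F (Vir M) V] in
theorem translate (C : Coordinates w e) (k : M) :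
    Coordinates (fun j => w (j + k)) (fun u v => e (u + k) (v + k)) where
  lie μ j := by rw [C.lie, add_assoc]
  c_lie j := C.c_lie _
  span := by
    rw [← C.span]
    congr 1
    exact (add_right_surjective k).range_comp w
  indep s g hg j hj := by
    have h := C.indep (s.map (addRightEmbedding k)) (fun i => g (i - k))
      (by simpa [Finset.sum_map] using hg) (j + k)
      (by simpa using hj)
    simpa using h

end Coordinates

/-- The standard coordinates of a module that is given by its structure constants. -/
theorem coordinates_v (ψ : Coeff M) {e : M → M → F} (he : ∀ μ j, ψ.φ μ j = e j (μ + j)) :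
    Coordinates (CoeffModule.v ψ) e where
  lie μ j := by rw [CoeffModule.L_lie_v, he]
  c_lie j := CoeffModule.c_lie _ _
  span := by
    have h : Submodule.span F (Set.range fun j : M => (Finsupp.single j 1 : M →₀ F)) = ⊤ := by
      rw [← Set.image_univ, ← Finsupp.supported_eq_span_single, Finsupp.supported_univ]
    exact h
  indep s g hg j hj := by
    classical
    have h : ∑ i ∈ s, g i • (Finsupp.single i 1 : M →₀ F) = 0 := hg
    have h' := DFunLike.congr_fun h j
    simp [Finsupp.single_apply, hj] at h'
    rw [h', zero_smul]

theorem v_ne_zero (ψ : Coeff M) (j : M) : CoeffModule.v ψ j ≠ 0 :=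
  (Finsupp.single_ne_zero.mpr one_ne_zero : (Finsupp.single j 1 : M →₀ F) ≠ 0)

end Coordinates
end GenVir

/-! ### Coordinates of the subquotients -/

namespace GenVir

variable {F : Type*} [Field F] [CharZero F] {M : AddSubgroup F}

theorem mem_spanOn_iff (φ : Coeff M) (S : Set M) (hS : ∀ μ, ∀ ν ∈ S, φ.φ μ ν ≠ 0 → μ + ν ∈ S)
    (f : M →₀ F) : (f : CoeffModule φ) ∈ CoeffModule.spanOn φ S hS ↔ ∀ i ∉ S, f i = 0 := by
  have h : f ∈ Submodule.span F ((fun i : M => (Finsupp.single i 1 : M →₀ F)) '' S)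
      ↔ ∀ i ∉ S, f i = 0 := by
    rw [← Finsupp.supported_eq_span_single, Finsupp.mem_supported']
  exact h

section Subquotient

variable (a b : F) (hT : ∀ ν : M, b = 1 → a + (ν : F) ≠ 0)

/-- The image of the basis vector `v_j` in `A'_{a,b}(M)`, in the cases where `A'_{a,b}(M)` is a
quotient of `A_{a,b}(M)`. -/
noncomputable def vAab' (j : M) : Aab' M a b :=
  LieSubmodule.Quotient.mk' _
    (⟨CoeffModule.v _ j, Submodule.subset_span ⟨j, hT j, rfl⟩⟩ : AabTop M a b)

theorem vAab'_eq_zero_iff (j : M) : vAab' a b hT j = 0 ↔ b = 0 ∧ a + (j : F) = 0 := by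
  rw [vAab', LieSubmodule.Quotient.mk_eq_zero, LieSubmodule.mem_comap]
  refine (mem_spanOn_iff _ _ _ (Finsupp.single j 1)).trans ⟨fun h => ?_, fun h i hi => ?_⟩
  · by_contra hj
    have := h j hj
    rw [Finsupp.single_eq_same] at this
    exact one_ne_zero this
  · exact Finsupp.single_eq_of_ne fun hij => hi (hij ▸ h)

theorem coordinates_vAab' {e : M → M → F}
    (he : ∀ μ j : M, ¬ (b = 0 ∧ a + ((μ + j : M) : F) = 0) →
      (coeffAab M a b).φ μ j = e j (μ + j)) :
    Coordinates (vAab' a b hT) e where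
  lie μ j := by
    have h1 : ⁅(Vir.L μ : Vir M),
        (⟨CoeffModule.v _ j, Submodule.subset_span ⟨j, hT j, rfl⟩⟩ : AabTop M a b)⁆
        = (coeffAab M a b).φ μ j
          • ⟨CoeffModule.v _ (μ + j), Submodule.subset_span ⟨_, hT (μ + j), rfl⟩⟩ :=
      Subtype.ext (CoeffModule.L_lie_v _ μ j)
    have h2 : ⁅(Vir.L μ : Vir M), vAab' a b hT j⁆
        = (coeffAab M a b).φ μ j • vAab' a b hT (μ + j) := by
      rw [vAab', ← LieModuleHom.map_lie, h1, map_smul]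
      rfl
    rw [h2]
    by_cases h : b = 0 ∧ a + ((μ + j : M) : F) = 0
    · rw [(vAab'_eq_zero_iff a b hT _).mpr h, smul_zero, smul_zero]
    · rw [he μ j h]
  c_lie j := by
    have h1 : ⁅Vir.c M,
        (⟨CoeffModule.v _ j, Submodule.subset_span ⟨j, hT j, rfl⟩⟩ : AabTop M a b)⁆ = 0 :=
      Subtype.ext (CoeffModule.c_lie _ _)
    rw [vAab', ← LieModuleHom.map_lie, h1, map_zero]
  span := by
    let u : M → AabTop M a b :=
      fun j => ⟨CoeffModule.v _ j, Submodule.subset_span ⟨j, hT j, rfl⟩⟩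
    have hu : Submodule.span F (Set.range u) = ⊤ := by
      rw [eq_top_iff]
      rintro x -
      have hx : (x : Aab M a b) ∈ Submodule.span F
          (Set.range (CoeffModule.v (coeffAab M a b))) := by
        rw [(coordinates_v (coeffAab M a b) (e := fun u v => (coeffAab M a b).φ (v - u) u)
          (by simp)).span]
        trivial
      have h : Set.range (CoeffModule.v (coeffAab M a b))
          = (AabTop M a b).toSubmodule.subtype '' Set.range u := by
        rw [← Set.range_comp]
        rfl
      rw [h, Submodule.span_image] at hx
      obtain ⟨y, hy, hxy⟩ := hx
      have : y = x := Subtype.ext hxy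
      rwa [← this]
    let q : AabTop M a b →ₗ⁅F, Vir M⁆ Aab' M a b := LieSubmodule.Quotient.mk' _
    have h1 : Set.range (vAab' a b hT) = (q : AabTop M a b →ₗ[F] Aab' M a b) '' Set.range u := by
      rw [← Set.range_comp]
      rfl
    rw [h1, Submodule.span_image, hu, Submodule.map_top, LinearMap.range_eq_top]
    exact LieSubmodule.Quotient.surjective_mk' _
  indep s g hg j hj := by
    classical
    by_cases hjb : b = 0 ∧ a + (j : F) = 0
    · rw [(vAab'_eq_zero_iff a b hT j).mpr hjb, smul_zero]
    let u : M → AabTop M a b :=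
      fun j => ⟨CoeffModule.v _ j, Submodule.subset_span ⟨j, hT j, rfl⟩⟩
    have h1 : LieSubmodule.Quotient.mk' ((AabBot M a b).comap (AabTop M a b).incl)
        (∑ i ∈ s, g i • u i) = 0 := by
      rw [map_sum, ← hg]
      exact Finset.sum_congr rfl fun i _ => map_smul _ _ _
    rw [LieSubmodule.Quotient.mk_eq_zero, LieSubmodule.mem_comap, map_sum] at h1
    have h2 : ((∑ i ∈ s, g i • (Finsupp.single i 1 : M →₀ F) : M →₀ F) : Aab M a b)
        ∈ AabBot M a b := h1
    have h3 := (mem_spanOn_iff _ _ _ _).mp h2 j hjb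
    have h4 : g j = 0 := by
      simpa [Finsupp.finsetSum_apply, Finsupp.single_apply, hj] using h3
    rw [h4, zero_smul]

end Subquotient

/-- Filling in a missing vector with a trivial module. -/
theorem Coordinates.prod_trivial [DecidableEq M] {V : Type*} [AddCommGroup V] [Module F V]
    [LieRingModule (Vir M) V] [LieModule F (Vir M) V] {w : M → V} {e : M → M → F}
    (C : Coordinates w e) {k : M} (hk : w k = 0) (hin : ∀ u, e u k = 0) :
    Coordinates (V := V × Fv0 M)
      (fun j => (w j, if j = k then (TrivialLieModule.equiv F (Vir M) F).symm 1 else 0)) e where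
  lie μ j := by
    refine Prod.ext (C.lie μ j) ?_
    change ⁅(Vir.L μ : Vir M), (_ : Fv0 M)⁆ = e j (μ + j) • (_ : Fv0 M)
    rw [trivial_lie_zero]
    split_ifs with h
    · rw [h, hin, zero_smul]
    · rw [smul_zero]
  c_lie j := Prod.ext (C.c_lie j) (trivial_lie_zero _ _ _ _)
  span := by
    obtain ⟨S, hS⟩ : ∃ S, S = Submodule.span F (Set.range fun j =>
      ((w j, if j = k then (TrivialLieModule.equiv F (Vir M) F).symm 1 else 0) : V × Fv0 M)) :=
        ⟨_, rfl⟩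
    rw [← hS]
    have h1 : ((0, (TrivialLieModule.equiv F (Vir M) F).symm 1) : V × Fv0 M) ∈ S := by
      rw [hS]
      exact Submodule.subset_span ⟨k, by simp [hk]⟩
    have h2 : ∀ j, ((w j, 0) : V × Fv0 M) ∈ S := by
      intro j
      by_cases hj : j = k
      · rw [hj, hk]
        exact Submodule.zero_mem _
      · rw [hS]
        exact Submodule.subset_span ⟨j, by simp [hj]⟩
    have h3 : ∀ v : V, ((v, 0) : V × Fv0 M) ∈ S := by
      intro v
      have hv : v ∈ Submodule.span F (Set.range w) := by
        rw [C.span]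
        trivial
      have h4 : Submodule.span F (Set.range w) ≤ S.comap (LinearMap.inl F V (Fv0 M)) := by
        rw [Submodule.span_le]
        rintro _ ⟨j, rfl⟩
        exact h2 j
      exact h4 hv
    rw [eq_top_iff]
    rintro ⟨v, t⟩ -
    have h5 : ((v, t) : V × Fv0 M) = (v, 0) + TrivialLieModule.equiv F (Vir M) F t
        • (0, (TrivialLieModule.equiv F (Vir M) F).symm 1) := by
      refine Prod.ext (by simp) ?_
      change t = 0 + _ • (TrivialLieModule.equiv F (Vir M) F).symm 1
      rw [zero_add, ← map_smul, smul_eq_mul, mul_one, LinearEquiv.symm_apply_apply]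
    rw [h5]
    exact S.add_mem (h3 v) (S.smul_mem _ h1)
  indep s g hg j hj := by
    have h1 := congrArg Prod.fst hg
    have h2 := congrArg Prod.snd hg
    rw [Prod.fst_sum] at h1
    rw [Prod.snd_sum] at h2
    refine Prod.ext (C.indep s g h1 j hj) ?_
    change g j • (if j = k then (TrivialLieModule.equiv F (Vir M) F).symm 1 else 0 : Fv0 M) = 0
    split_ifs with hjk
    · subst hjk
      rw [Finset.sum_eq_single_of_mem j hj (fun i _ hi => by simp [hi])] at h2
      simpa using h2
    · rw [smul_zero]

end GenVir

/-! ### Coordinates of weight modules -/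

namespace GenVir

open scoped Classical in
/-- A module with weight multiplicities at most one has coordinates. -/
theorem exists_coordinates {F : Type*} [Field F] [CharZero F] (M : AddSubgroup F)
    {V : Type*} [AddCommGroup V] [Module F V] [LieRingModule (Vir M) V] [LieModule F (Vir M) V]
    (Vj : M → Submodule F V) (hgr : IsGrading Vj)
    (hV : 1 < Module.rank F V) (hVj : ∀ j : M, Module.rank F (Vj j) ≤ 1)
    (a : F) (hL0 : ∀ j : M, ∀ v ∈ Vj j, ⁅(Vir.L 0 : Vir M), v⁆ = (a + (j : F)) • v) :
    ∃ (w : M → V) (e : M → M → F), Coordinates w e ∧ System (fun j : M => a + (j : F)) e ∧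
      Infinite M ∧ (∀ j : M, a + (j : F) ≠ 0 → w j ≠ 0) ∧
      ∀ u v, w u = 0 → e u v = 0 ∧ e v u = 0 := by
  choose w hw hspan using fun j => (rank_submodule_le_one_iff (Vj j)).mp (hVj j)
  have hL : ∀ μ : M, (Vir.L μ : Vir M) ∈ Vir.homogeneous μ := by
    intro μ
    rw [Vir.homogeneous]
    split_ifs with h
    · rw [h]
      exact Submodule.subset_span (by simp)
    · exact Submodule.subset_span (by simp)
  have hc : Vir.c M ∈ Vir.homogeneous (0 : M) := by
    rw [Vir.homogeneous, if_pos rfl]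
    exact Submodule.subset_span (by simp)
  have hex : ∀ u v : M, ∃ t : F, ⁅(Vir.L (v - u) : Vir M), w u⁆ = t • w v := by
    intro u v
    have h := hgr.lie_mem (v - u) u _ (hL _) _ (hw u)
    rw [sub_add_cancel] at h
    obtain ⟨t, ht⟩ := Submodule.mem_span_singleton.mp (hspan v h)
    exact ⟨t, ht.symm⟩
  choose e₀ he₀ using hex
  obtain ⟨e, he⟩ : ∃ e : M → M → F, ∀ u v, e u v = if w u = 0 ∨ w v = 0 then 0 else e₀ u v :=
    ⟨_, fun _ _ => rfl⟩
  have hlie : ∀ u v, ⁅(Vir.L (v - u) : Vir M), w u⁆ = e u v • w v := by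
    intro u v
    rw [he]
    split_ifs with h
    · rcases h with h | h
      · rw [h, lie_zero, zero_smul]
      · rw [he₀, h, smul_zero, smul_zero]
    · exact he₀ u v
  have he0 : ∀ u v, e u v ≠ 0 → w u ≠ 0 ∧ w v ≠ 0 := by
    intro u v h
    rw [he] at h
    rw [← not_or]
    intro h'
    rw [if_pos h'] at h
    exact h rfl
  have hcex : ∀ u : M, ∃ t : F, ⁅Vir.c M, w u⁆ = t • w u := by
    intro u
    have h := hgr.lie_mem 0 u _ hc _ (hw u)
    rw [zero_add] at h
    obtain ⟨t, ht⟩ := Submodule.mem_span_singleton.mp (hspan u h)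
    exact ⟨t, ht.symm⟩
  choose cc hcc using hcex
  have hcharge : ∀ u v, e u v ≠ 0 → cc u = cc v := by
    intro u v h
    have h1 : ⁅Vir.c M, ⁅(Vir.L (v - u) : Vir M), w u⁆⁆
        = ⁅(Vir.L (v - u) : Vir M), ⁅Vir.c M, w u⁆⁆ := by
      rw [leibniz_lie, Vir.c_bracket, zero_lie, zero_add]
    rw [hcc, lie_smul, hlie, lie_smul, hcc, smul_smul, smul_smul, ← sub_eq_zero, ← sub_smul,
      smul_eq_zero] at h1
    have h2 := h1.resolve_right (he0 u v h).2
    exact mul_left_cancel₀ h (by linear_combination -h2)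
  have hXaff : ∀ u v v' x : M, v + v' = u + x →
      a + (v : F) + (a + (v' : F)) = a + (u : F) + (a + (x : F)) := by
    intro u v v' x h
    have := congrArg (Subtype.val) h
    simp only [AddSubgroup.coe_add] at this
    linear_combination this
  have hXinj : Function.Injective fun j : M => a + (j : F) :=
    fun u v h => Subtype.ext (add_left_cancel h)
  -- the relation of the operators of degrees `x - v` and `v - u`
  have hrel : ∀ u v v' x : M, v + v' = u + x → (e u v * e v x - e u v' * e v' x) • w x
      = (((v : F) - v') * e u x) • w x
        + (if u = x then ((((u : F) - v) ^ 3 - ((u : F) - v)) / 12 * cc u) • w u else 0) := by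
    intro u v v' x h
    have hv' : v' = u + x - v := by rw [← h]; abel
    have h1 := lie_lie (Vir.L (x - v) : Vir M) (Vir.L (v - u)) (w u)
    rw [hlie, lie_smul, hlie] at h1
    have h2 : ⁅(Vir.L (x - v) : Vir M), w u⁆ = e u v' • w v' := by
      rw [← hlie, hv']
      congr 2
      abel
    have h3 : ⁅(Vir.L (v - u) : Vir M), w v'⁆ = e v' x • w x := by
      rw [← hlie, hv']
      congr 2
      abel
    rw [h2, lie_smul, h3, Vir.L_bracket_L, add_lie, smul_lie, smul_lie, hcc,
      show x - v + (v - u) = x - u by abel, hlie] at h1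
    have h4 : x - u = 0 ↔ u = x := by rw [sub_eq_zero, eq_comm]
    simp only [h4, smul_smul, AddSubgroupClass.coe_sub] at h1
    rw [sub_smul, ← h1]
    have h5 : (v' : F) = u + x - v := by rw [hv']; simp
    rw [h5]
    split_ifs with hux
    · subst hux
      congr 2
      ring
    · rw [zero_mul, zero_smul, add_zero, add_zero]
      congr 1
      ring
  have hpart : ∀ C : F, PartialSystem (fun j : M => a + (j : F)) C {u | w u ≠ 0 ∧ cc u = C}
      (fun u v => if cc u = C then e u v else 0) := by
    intro C
    have hcomp : ∀ u v x, (if cc u = C then e u v else 0) * (if cc v = C then e v x else 0)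
        = if cc u = C then e u v * e v x else 0 := by
      intro u v x
      split_ifs with h1 h2 h2
      · rfl
      · have h3 : e u v = 0 := by_contra fun h => h2 ((hcharge u v h).symm.trans h1)
        rw [h3, zero_mul, zero_mul]
      · rw [zero_mul]
      · rw [zero_mul]
    refine ⟨hXaff, hXinj, fun u v h => ?_, fun u hu => ?_, fun u v v' x h hux => ?_,
      fun u hu v v' h => ?_⟩
    · split_ifs at h with hC
      · exact ⟨⟨(he0 u v h).1, hC⟩, (he0 u v h).2, (hcharge u v h).symm.trans hC⟩
      · exact absurd rfl h
    · rw [if_pos hu.2]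
      have h1 := hlie u u
      rw [sub_self, hL0 u _ (hw u), ← sub_eq_zero, ← sub_smul, smul_eq_zero] at h1
      exact (sub_eq_zero.mp (h1.resolve_right hu.1)).symm
    · rw [hcomp, hcomp]
      split_ifs with hC
      · by_cases hx : w x = 0
        · have h0 : ∀ v, e v x = 0 := fun v => by_contra fun h => (he0 v x h).2 hx
          rw [h0, h0, h0]
          ring
        · have h1 := hrel u v v' x h
          rw [if_neg hux, add_zero, ← sub_eq_zero, ← sub_smul, smul_eq_zero] at h1
          linear_combination h1.resolve_right hx
      · ring
    · have hd : e u u = a + u := by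
        have h1 := hlie u u
        rw [sub_self, hL0 u _ (hw u), ← sub_eq_zero, ← sub_smul, smul_eq_zero] at h1
        exact (sub_eq_zero.mp (h1.resolve_right hu.1)).symm
      rw [hcomp, hcomp, if_pos hu.2, if_pos hu.2]
      have h1 := hrel u v v' u h
      rw [if_pos rfl, ← add_smul, ← sub_eq_zero, ← sub_smul, smul_eq_zero, hd, hu.2] at h1
      linear_combination h1.resolve_right hu.1
  have hwspan : Submodule.span F (Set.range w) = ⊤ := by
    rw [eq_top_iff, ← hgr.isInternal.submodule_iSup_eq_top]
    refine iSup_le fun j => (hspan j).trans (Submodule.span_mono ?_)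
    rintro _ rfl
    exact ⟨j, rfl⟩
  obtain ⟨u₁, u₂, hu₁, hu₂, hne⟩ : ∃ u₁ u₂ : M, w u₁ ≠ 0 ∧ w u₂ ≠ 0 ∧ u₁ ≠ u₂ := by
    by_contra! h
    refine hV.not_ge (rank_le_one_iff.mpr ?_)
    by_cases hu : ∃ u, w u ≠ 0
    · obtain ⟨u, hu⟩ := hu
      refine ⟨w u, fun v => ?_⟩
      have hv : v ∈ Submodule.span F (Set.range w) := by
        rw [hwspan]
        trivial
      have hle : Submodule.span F (Set.range w) ≤ Submodule.span F {w u} := by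
        rw [Submodule.span_le]
        rintro _ ⟨j, rfl⟩
        by_cases hj : w j = 0
        · rw [hj]
          exact Submodule.zero_mem _
        · rw [← h u j hu hj]
          exact Submodule.subset_span rfl
      exact Submodule.mem_span_singleton.mp (hle hv)
    · push Not at hu
      refine ⟨0, fun v => ⟨0, ?_⟩⟩
      have hv : v ∈ Submodule.span F (Set.range w) := by
        rw [hwspan]
        trivial
      have hle : Submodule.span F (Set.range w) ≤ ⊥ := by
        rw [Submodule.span_le]
        rintro _ ⟨j, rfl⟩
        exact hu j
      rw [smul_zero]
      exact ((Submodule.mem_bot F).mp (hle hv)).symm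
  have hnt : Nontrivial M := ⟨u₁, u₂, hne⟩
  have hc0 : ∀ u, w u ≠ 0 → cc u = 0 := fun u hu =>
    (hpart (cc u)).charge_eq_zero ⟨u, hu, rfl⟩
  have hinf : Infinite M := by
    obtain ⟨h, hh⟩ := exists_ne (0 : M)
    exact Infinite.of_injective _
      (zsmul_line_injective hXaff hXinj 0 hh)
  have hP := hpart 0
  have hsupp : ∀ j : M, a + (j : F) ≠ 0 → w j ≠ 0 := by
    intro j hj
    by_cases h1 : a + (u₁ : F) = 0
    · have h2 : a + (u₂ : F) ≠ 0 := fun h2 => hne (hXinj (h1.trans h2.symm))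
      exact (hP.mem_of_weight_ne_zero ⟨hu₂, hc0 _ hu₂⟩ h2 hj).1
    · exact (hP.mem_of_weight_ne_zero ⟨hu₁, hc0 _ hu₁⟩ h1 hj).1
  have hS := hP.toSystem fun u hu => by
    by_contra h
    exact hu ⟨hsupp u h, hc0 u (hsupp u h)⟩
  have hee : (fun u v => if cc u = 0 then e u v else 0) = e := by
    funext u v
    split_ifs with h
    · rfl
    · by_contra h'
      exact h (hc0 u (he0 u v (Ne.symm h')).1)
  rw [hee] at hS
  refine ⟨w, e, ⟨fun μ j => ?_, fun j => ?_, hwspan, fun s g hg j hj => ?_⟩, hS, hinf, hsupp,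
    fun u v hu => ⟨?_, ?_⟩⟩
  · rw [← hlie, add_sub_cancel_right]
  · rw [hcc]
    by_cases h : w j = 0
    · rw [h, smul_zero]
    · rw [hc0 j h, zero_smul]
  · exact (iSupIndep_iff_finsetSum_eq_zero_imp_eq_zero Vj).mp hgr.isInternal.submodule_iSupIndep s
      (fun j => g j • w j) (fun i _ => Submodule.smul_mem _ _ (hw i)) hg j hj
  · exact by_contra fun h => (he0 u v h).1 hu
  · exact by_contra fun h => (he0 v u h).2 hu

end GenVir

/-! ### Identification of the modules -/

namespace GenVir

namespace Coordinates

variable {F : Type*} [Field F] [CharZero F] {M : AddSubgroup F}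
  {V : Type*} [AddCommGroup V] [Module F V] [LieRingModule (Vir M) V] [LieModule F (Vir M) V]
  {w : M → V} {e : M → M → F} {a B : F}

/-- If every vector lies on nonzero loops of length two, then the module is an irreducible tensor
density module. -/
theorem exists_equiv_Aab' [Infinite M] (C : Coordinates w e)
    (H : System (fun j : M => a + (j : F)) e)
    (hB : ∀ u v : M, e u v * e v u = pairing B (a + (u : F)) (a + (v : F)))
    (hV : ∀ u : M, a + (u : F) ≠ 0 ∨ B ≠ 0) (hw : ∀ j : M, a + (j : F) ≠ 0 → w j ≠ 0)
    (h0 : ∀ u v, w u = 0 → e u v = 0 ∧ e v u = 0) :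
    ∃ β : F, Nonempty (V ≃ₗ⁅F, Vir M⁆ Aab' M a β) := by
  obtain ⟨β, f, hβ, -, hf, hfe⟩ := H.exists_rescaling hB
  have hw' : ∀ j, w j ≠ 0 := by
    intro j hj
    have hX : a + (j : F) = 0 := by_contra fun h => hw j h hj
    have hB0 := (hV j).resolve_left (not_not.mpr hX)
    obtain ⟨v, hv⟩ := exists_ne j
    have h1 := hB j v
    rw [(h0 j v hj).1, hX, pairing] at h1
    have h2 : a + (v : F) ≠ 0 := fun h => hv (H.injective (h.trans hX.symm))
    exact mul_ne_zero hB0 (pow_ne_zero 2 h2) (by linear_combination -h1)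
  have hT : ∀ ν : M, β = 1 → a + (ν : F) ≠ 0 := by
    rintro ν rfl
    exact (hV ν).resolve_right (not_not.mpr (by rw [← hβ]; ring))
  have hT' : ∀ ν : M, ¬ (β = 0 ∧ a + (ν : F) = 0) := by
    rintro ν ⟨rfl, h⟩
    exact (hV ν).resolve_right (not_not.mpr (by rw [← hβ]; ring)) h
  refine ⟨β, (C.rescale hf).nonempty_equiv (coordinates_vAab' a β hT fun μ j _ => ?_) (H.twist hf)
    (fun u v => by ring) fun j => ?_⟩
  · rw [hfe _ _ (hV _) (hV _), density]
    simp only [coeffAab, AddSubgroup.coe_add]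
    ring
  · rw [vAab'_eq_zero_iff]
    exact iff_of_false (smul_ne_zero (hf j) (hw' j)) (hT' j)

open scoped Classical in
/-- The modules in which a vector of weight zero does not lie on any nonzero loop of length two. -/
theorem nonempty_equiv_of_weight_eq_zero [Infinite M] (C : Coordinates w e)
    (H : System (fun j : M => a + (j : F)) e)
    (hB : ∀ u v : M, e u v * e v u = pairing 0 (a + (u : F)) (a + (v : F)))
    {k : M} (hk : a + (k : F) = 0) (hw : ∀ j : M, a + (j : F) ≠ 0 → w j ≠ 0)
    (h0 : ∀ u v, w u = 0 → e u v = 0 ∧ e v u = 0) :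
    Nonempty (V ≃ₗ⁅F, Vir M⁆ Aab' M 0 0) ∨
    Nonempty (V ≃ₗ⁅F, Vir M⁆ (Aab' M 0 0 × Fv0 M)) ∨
    (∃ α : F, Nonempty (V ≃ₗ⁅F, Vir M⁆ Aa M α)) ∨
    (∃ α : F, Nonempty (V ≃ₗ⁅F, Vir M⁆ Ba M α)) ∨
    Nonempty (V ≃ₗ⁅F, Vir M⁆ Aab M 0 0) ∨
    Nonempty (V ≃ₗ⁅F, Vir M⁆ Aab M 0 1) := by
  obtain ⟨f, κ, l, κ', l', hf, he, hout, hin, hor⟩ := H.exists_rescaling_of_weight_eq_zero hB hk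
  -- coordinates in which the weights are the degrees
  obtain ⟨w', hw'⟩ : ∃ w' : M → V, w' = fun j => f (j + k) • w (j + k) := ⟨_, rfl⟩
  obtain ⟨d, hd⟩ : ∃ d : M → M → F,
      d = fun u v => e (u + k) (v + k) * f (u + k) / f (v + k) := ⟨_, rfl⟩
  have C' : Coordinates w' d := by
    rw [hw', hd]
    exact (C.rescale hf).translate k
  have hXk : ∀ j : M, a + ((j + k : M) : F) = j := by
    intro j
    rw [AddSubgroup.coe_add]
    linear_combination hk
  have H' : System (fun j : M => (j : F)) d := by
    have hT := H.twist hf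
    rw [hd]
    refine ⟨fun u v v' x h => by exact_mod_cast h, Subtype.val_injective, fun u => ?_,
      fun u v v' x h => ?_⟩
    · have := hT.diag (u + k)
      simp only [hXk] at this
      exact this
    · have := hT.comm (u + k) (v + k) (v' + k) (x + k)
        (by rw [add_add_add_comm, h, add_add_add_comm])
      simp only [hXk] at this
      exact this
  have hne : ∀ j : M, j ≠ 0 → j + k ≠ k := fun j hj h => hj (by simpa using h)
  have c0 : ∀ j : M, j ≠ 0 → (j : F) ≠ 0 := fun j hj h => hj (Subtype.ext h)
  have hd₁ : ∀ u v : M, u ≠ 0 → v ≠ 0 → d u v = u := by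
    intro u v hu hv
    rw [hd]
    exact (he _ _ (hne u hu) (hne v hv)).trans (hXk u)
  have hd₂ : ∀ v : M, v ≠ 0 → d 0 v = κ * v + l := by
    intro v hv
    have := hout _ (hne v hv)
    rw [hXk] at this
    simp only [hd, ← this, zero_add]
  have hd₃ : ∀ v : M, v ≠ 0 → d v 0 = v * (κ' * v + l') := by
    intro v hv
    have := hin _ (hne v hv)
    rw [hXk] at this
    simp only [hd, ← this, zero_add]
  have hd₀ : d 0 0 = 0 := by
    rw [H'.diag]
    rfl
  have hwne : ∀ j : M, j ≠ 0 → w' j ≠ 0 := by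
    intro j hj
    rw [hw']
    refine smul_ne_zero (hf _) (hw _ ?_)
    rw [hXk]
    exact c0 j hj
  have hT : ∀ ν : M, (0 : F) = 1 → 0 + (ν : F) ≠ 0 := fun ν h => absurd h zero_ne_one
  have hX : ∀ u v : M, (u : F) - v = (u : F) - v := fun u v => rfl
  have hz : ∀ j : M, vAab' (0 : F) 0 hT j = 0 ↔ j = 0 := by
    intro j
    rw [vAab'_eq_zero_iff]
    simp
  have hquot : (∀ v, d 0 v = 0) → Coordinates (vAab' (0 : F) 0 hT) d := by
    intro hd₂'
    refine coordinates_vAab' 0 0 hT fun μ j h => ?_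
    have hμ : μ + j ≠ 0 := fun h' => h ⟨rfl, by rw [h', zero_add]; rfl⟩
    by_cases hj : j = 0
    · rw [hj, hd₂']
      simp [coeffAab]
    · rw [hd₁ _ _ hj hμ]
      simp [coeffAab]
  by_cases hwk : w' 0 = 0
  · -- the vector of weight zero is missing
    have hwk' : w k = 0 := by
      rw [hw'] at hwk
      simpa [hf] using hwk
    left
    refine C'.nonempty_equiv (hquot fun v => ?_) H' hX fun j => ?_
    · rw [hd]
      simp [(h0 k _ hwk').1]
    · rw [hz]
      exact ⟨fun h => by_contra fun hj => hwne j hj h, fun h => by rw [h, hwk]⟩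
  have hwall : ∀ j, w' j ≠ 0 := by
    intro j
    by_cases hj : j = 0
    · rwa [hj]
    · exact hwne j hj
  right
  by_cases hin0 : κ' = 0 ∧ l' = 0
  · obtain ⟨rfl, rfl⟩ := hin0
    have hd₃' : ∀ u, d u 0 = 0 := by
      intro u
      by_cases hu : u = 0
      · rw [hu, hd₀]
      · rw [hd₃ u hu]
        ring
    by_cases hout0 : κ = 0 ∧ l = 0
    · obtain ⟨rfl, rfl⟩ := hout0
      left
      have hd₂' : ∀ v, d 0 v = 0 := by
        intro v
        by_cases hv : v = 0
        · rw [hv, hd₀]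
        · rw [hd₂ v hv]
          ring
      refine C'.nonempty_equiv ((hquot hd₂').prod_trivial (k := 0) ((hz 0).mpr rfl) hd₃') H' hX
        fun j => iff_of_false (hwall j) fun h => ?_
      have h1 := congrArg Prod.fst h
      have h2 := congrArg Prod.snd h
      have hj := (hz j).mp h1
      simp only [hj, if_true] at h2
      have h3 := congrArg (TrivialLieModule.equiv F (Vir M) F) h2
      rw [LinearEquiv.apply_symm_apply] at h3
      exact one_ne_zero (h3.trans (map_zero _))
    right
    -- rescaling by the inverse weights turns the coefficients into those of `A_α`
    obtain ⟨s, hs⟩ : ∃ s : F, s = if κ = 0 then l else κ := ⟨_, rfl⟩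
    have hs0 : s ≠ 0 := by
      rw [hs]
      split_ifs with h
      · exact fun h' => hout0 ⟨h, h'⟩
      · exact h
    obtain ⟨g, hg⟩ : ∃ g : M → F, ∀ j, g j = if j = 0 then 1 / s else 1 / (j : F) :=
      ⟨_, fun _ => rfl⟩
    have hg0 : ∀ j, g j ≠ 0 := by
      intro j
      rw [hg]
      split_ifs with h
      · exact one_div_ne_zero hs0
      · exact one_div_ne_zero (c0 j h)
    have Cg := C'.rescale hg0
    have Hg := H'.twist hg0
    have hgw : ∀ (ψ : Coeff M) (j : M), g j • w' j = 0 ↔ CoeffModule.v ψ j = 0 := fun ψ j =>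
      iff_of_false (smul_ne_zero (hg0 j) (hwall j)) (v_ne_zero ψ j)
    have hg₁ : ∀ μ j : M, j ≠ 0 → d j (μ + j) * g j / g (μ + j) = j + μ := by
      intro μ j hj
      by_cases hμ : μ + j = 0
      · have := congrArg (Subtype.val) hμ
        simp only [AddSubgroup.coe_add, ZeroMemClass.coe_zero] at this
        rw [hμ, hd₃']
        linear_combination -this
      · rw [hd₁ j _ hj hμ, hg, hg, if_neg hj, if_neg hμ]
        have h1 := c0 j hj
        have h2 := c0 _ hμ
        rw [AddSubgroup.coe_add] at h2 ⊢
        field_simp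
        ring
    have hg₂ : ∀ μ : M, d 0 (μ + 0) * g 0 / g (μ + 0) = μ * ((κ * μ + l) / s) := by
      intro μ
      rw [add_zero]
      by_cases hμ : μ = 0
      · rw [hμ, hd₀]
        simp
      · rw [hd₂ μ hμ, hg, hg, if_pos rfl, if_neg hμ]
        have h1 := c0 μ hμ
        field_simp
    by_cases hκ : κ = 0
    · right; right; right
      rw [if_pos hκ] at hs
      refine Cg.nonempty_equiv (coordinates_v (coeffAab M 0 1) fun μ j => ?_) Hg hX (hgw _)
      by_cases hj : j = 0
      · subst hj
        rw [hg₂, hκ, ← hs, zero_mul, zero_add, div_self hs0]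
        simp [coeffAab]
      · rw [hg₁ μ j hj]
        simp [coeffAab]
    · left
      rw [if_neg hκ] at hs
      refine ⟨l / κ, Cg.nonempty_equiv (coordinates_v (coeffAa M (l / κ)) fun μ j => ?_) Hg hX
        (hgw _)⟩
      by_cases hj : j = 0
      · subst hj
        rw [hg₂, hs]
        simp only [coeffAa, if_true]
        field_simp
      · rw [hg₁ μ j hj]
        simp only [coeffAa, if_neg hj]
  · obtain ⟨rfl, rfl⟩ := hor.resolve_right hin0
    right; right
    have hd₂' : ∀ v, d 0 v = 0 := by
      intro v
      by_cases hv : v = 0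
      · rw [hv, hd₀]
      · rw [hd₂ v hv]
        ring
    obtain ⟨s, hs⟩ : ∃ s : F, s = if κ' = 0 then l' else -κ' := ⟨_, rfl⟩
    have hs0 : s ≠ 0 := by
      rw [hs]
      split_ifs with h
      · exact fun h' => hin0 ⟨h, h'⟩
      · exact neg_ne_zero.mpr h
    obtain ⟨g, hg⟩ : ∃ g : M → F, ∀ j, g j = if j = 0 then s else 1 := ⟨_, fun _ => rfl⟩
    have hg0 : ∀ j, g j ≠ 0 := by
      intro j
      rw [hg]
      split_ifs with h
      · exact hs0
      · exact one_ne_zero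
    have Cg := C'.rescale hg0
    have Hg := H'.twist hg0
    have hgw : ∀ (ψ : Coeff M) (j : M), g j • w' j = 0 ↔ CoeffModule.v ψ j = 0 := fun ψ j =>
      iff_of_false (smul_ne_zero (hg0 j) (hwall j)) (v_ne_zero ψ j)
    have hg₁ : ∀ μ j : M, μ + j ≠ 0 → d j (μ + j) * g j / g (μ + j) = j := by
      intro μ j hμ
      by_cases hj : j = 0
      · rw [hj, hd₂']
        simp
      · rw [hd₁ j _ hj hμ, hg, hg, if_neg hj, if_neg hμ, mul_one, div_one]
    have hg₂ : ∀ j : M, d j 0 * g j / g 0 = j * ((κ' * j + l') / s) := by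
      intro j
      by_cases hj : j = 0
      · rw [hj, hd₀]
        simp
      · rw [hd₃ j hj, hg, hg, if_pos rfl, if_neg hj, mul_one, mul_div_assoc]
    by_cases hκ : κ' = 0
    · right; left
      rw [if_pos hκ] at hs
      refine Cg.nonempty_equiv (coordinates_v (coeffAab M 0 0) fun μ j => ?_) Hg hX (hgw _)
      by_cases hμ : μ + j = 0
      · rw [hμ, hg₂, hκ, ← hs, zero_mul, zero_add, div_self hs0]
        simp [coeffAab]
      · rw [hg₁ μ j hμ]
        simp [coeffAab]
    · left
      rw [if_neg hκ] at hs
      refine ⟨-(l' / κ'), Cg.nonempty_equiv (coordinates_v (coeffBa M (-(l' / κ'))) fun μ j => ?_)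
        Hg hX (hgw _)⟩
      by_cases hμ : μ + j = 0
      · have hμ' : j = -μ := eq_neg_of_add_eq_zero_right hμ
        rw [hμ, hg₂, hs]
        simp only [coeffBa, if_pos hμ']
        rw [hμ', NegMemClass.coe_neg]
        field_simp
        ring
      · rw [hg₁ μ j hμ]
        have hμ' : j ≠ -μ := fun h => hμ (by rw [h, add_neg_cancel])
        simp only [coeffBa, if_neg hμ']

end Coordinates

end GenVir

theorem theorem4p5 {F : Type*} [Field F] [CharZero F] (M : AddSubgroup F)
    (n : ℕ) (hM : Module.rank ℤ M = n)
    {V : Type*} [AddCommGroup V] [Module F V] [LieRingModule (GenVir.Vir M) V]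
    [LieModule F (GenVir.Vir M) V]
    (Vj : M → Submodule F V) (hgr : GenVir.IsGrading Vj)
    (hV : 1 < Module.rank F V) (hVj : ∀ j : M, Module.rank F (Vj j) ≤ 1)
    (a : F) (hL0 : ∀ j : M, ∀ v ∈ Vj j, ⁅(GenVir.Vir.L 0 : GenVir.Vir M), v⁆ = (a + (j : F)) • v) :
    (∃ α β : F, Nonempty (V ≃ₗ⁅F, GenVir.Vir M⁆ GenVir.Aab' M α β)) ∨
    Nonempty (V ≃ₗ⁅F, GenVir.Vir M⁆ (GenVir.Aab' M 0 0 × GenVir.Fv0 M)) ∨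
    (∃ α : F, Nonempty (V ≃ₗ⁅F, GenVir.Vir M⁆ GenVir.Aa M α)) ∨
    (∃ α : F, Nonempty (V ≃ₗ⁅F, GenVir.Vir M⁆ GenVir.Ba M α)) ∨
    Nonempty (V ≃ₗ⁅F, GenVir.Vir M⁆ GenVir.Aab M 0 0) ∨
    Nonempty (V ≃ₗ⁅F, GenVir.Vir M⁆ GenVir.Aab M 0 1) := by
  obtain ⟨w, e, C, H, hinf, hw, h0⟩ := GenVir.exists_coordinates M Vj hgr hV hVj a hL0
  obtain ⟨B, hB⟩ := H.exists_pairing_eq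
  by_cases hall : ∀ u : M, a + (u : F) ≠ 0 ∨ B ≠ 0
  · obtain ⟨β, h⟩ := C.exists_equiv_Aab' H hB hall hw h0
    exact Or.inl ⟨a, β, h⟩
  · push Not at hall
    obtain ⟨k, hk, rfl⟩ := hall
    rcases C.nonempty_equiv_of_weight_eq_zero H hB hk hw h0 with h | h
    · exact Or.inl ⟨0, 0, h⟩
    · exact Or.inr h
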